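/- A \emph{Cousin group} is a connected (finite-dimensional) complex Lie group on which every holomorphic function is constant; such a group is commutative, and $G_c\subseteq G$ denotes its maximal compact subgroup. If $h$ is a left invariant Hermitian metric on $G$, then each tangent space $T_xG_c\subseteq T_xG$ carries the distinguished complex subspace $H_x=T_xG_c\cap\sqrt{-1}\,T_xG_c$, its orthogonal complement $F_x$ in $T_xG_c$ with respect to $\mathrm{Re}\,h$, and the induced pseudo-Euclidean form $g$ with $g|_{H_x}=-\mathrm{Re}\,h|_{H_x}$, $g|_{F_x}=\mathrm{Re}\,h|_{F_x}$ and $H_x\perp F_x$. An \emph{abelian Cousin group} is a Cousin group $G$ with a left invariant Hermitian metric such that every closed geodesic $c\colon[0,1]\to G_c$ of the pseudo-Riemannian manifold $(G_c,g)$ has rational action $\int_0^1 g(\dot c,\dot c)\,dt\in\mathbb{Q}$. A \emph{morphism} of abelian Cousin groups $G\to G'$ is a holomorphic group homomorphism whose restriction $G_c\to G'_c$ is a map of bi-CR manifolds, that is, whose differential maps $F$ to $F'$ (it automatically maps $H$ to $H'$ complex linearly). An \emph{isogeny} is a surjective morphism with finite kernel, and the \emph{category of abelian Cousin groups up to isogeny}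 is the localization of the category of abelian Cousin groups at the isogenies. \textbf{Theorem} (Poincaré complete reducibility theorem for Cousin groups). The category of abelian Cousin groups up to isogeny is semisimple: it is an abelian category, every object is a finite direct sum of simple objects, and every monomorphism splits. -/

import Mathlib

open CategoryTheory CategoryTheory.Limits
open scoped Manifold ContDiff

noncomputable section

namespace Cousin

/-! ### Linear algebra: Hermitian forms and the CR Hermitian structure of a real subspace -/

/-- A positive definite Hermitian form on a complex vector space
(conjugate-linear in the first variable). -/
structure HermitianForm (T : Type) [AddCommGroup T] [Module ℂ T] where
  form : T →ₗ⋆[ℂ] T →ₗ[ℂ] ℂ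
  conj_symm : ∀ v w, starRingEnd ℂ (form v w) = form w v
  pos : ∀ v, v ≠ 0 → 0 < (form v v).re

section Linear

variable {T : Type} [AddCommGroup T] [Module ℂ T]

/-- The real part of a Hermitian form, a real bilinear form. -/
def HermitianForm.re (h : HermitianForm T) : LinearMap.BilinForm ℝ T :=
  LinearMap.mk₂ ℝ (fun v w => (h.form v w).re)
    (fun v v' w => by simp)
    (fun r v w => by
      have : (r • v : T) = (r : ℂ) • v := rfl
      rw [this, LinearMap.map_smulₛₗ, LinearMap.smul_apply, smul_eq_mul, Complex.conj_ofReal,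
        Complex.re_ofReal_mul, smul_eq_mul])
    (fun v w w' => by simp)
    (fun r v w => by
      have : (r • w : T) = (r : ℂ) • w := rfl
      rw [this, LinearMap.map_smul, smul_eq_mul, Complex.re_ofReal_mul, smul_eq_mul])

theorem HermitianForm.re_apply (h : HermitianForm T) (v w : T) :
    h.re v w = (h.form v w).re := rfl

theorem HermitianForm.re_isRefl (h : HermitianForm T) : h.re.IsRefl := by
  intro v w hvw
  rw [HermitianForm.re_apply] at *
  rw [← h.conj_symm v w, Complex.conj_re, hvw]

/-- The distinguished complex subspace `H = V ∩ √-1 V` of a real subspace `V` of a complex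
vector space: the vectors `v ∈ V` with `√-1 v ∈ V`. -/
def complexPart (V : Submodule ℝ T) : Submodule ℝ T where
  carrier := {v | v ∈ V ∧ Complex.I • v ∈ V}
  add_mem' := fun {a b} ha hb => ⟨V.add_mem ha.1 hb.1, by
    rw [smul_add]; exact V.add_mem ha.2 hb.2⟩
  zero_mem' := ⟨V.zero_mem, by rw [smul_zero]; exact V.zero_mem⟩
  smul_mem' := fun r v hv => ⟨V.smul_mem r hv.1, by
    rw [smul_comm]; exact V.smul_mem r hv.2⟩

/-- The distinguished cocomplex subspace `F`: the orthogonal complement of `H = V ∩ √-1 V`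
inside `V`. -/
def cocomplexPart (h : HermitianForm T) (V : Submodule ℝ T) : Submodule ℝ T :=
  V ⊓ h.re.orthogonal (complexPart V)

theorem isCompl_orthogonal [FiniteDimensional ℂ T] (h : HermitianForm T) (H : Submodule ℝ T) :
    IsCompl H (h.re.orthogonal H) := by
  have : FiniteDimensional ℝ T := FiniteDimensional.complexToReal T
  apply LinearMap.BilinForm.isCompl_orthogonal_of_restrict_nondegenerate h.re_isRefl
  have key : ∀ x : H, (h.re.restrict H) x x = 0 → x = 0 := by
    intro x hx
    by_contra hne
    have := h.pos (x : T) (fun h0 => hne (Subtype.ext h0))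
    have hx' : (h.form (x : T) (x : T)).re = 0 := hx
    linarith
  exact ⟨fun x hx => key x (hx x), fun x hx => key x (hx x)⟩

/-- The orthogonal projection onto a real subspace `H`, for the real part of `h`. -/
def orthProj [FiniteDimensional ℂ T] (h : HermitianForm T) (H : Submodule ℝ T) : T →ₗ[ℝ] T :=
  H.subtype ∘ₗ Submodule.projectionOnto H _ (isCompl_orthogonal h H)

/-- The CR Hermitian form `g` induced on a real subspace `V`: it is `-Re h` on
`H = V ∩ √-1 V`, it is `Re h` on the orthogonal complement `F` of `H` in `V`, and `H ⊥ F`.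
(It is given by a formula that makes sense for all vectors; only its values on `V` matter.) -/
def inducedForm [FiniteDimensional ℂ T] (h : HermitianForm T) (V : Submodule ℝ T) (v w : T) : ℝ :=
  h.re v w - 2 * h.re (orthProj h (complexPart V) v) (orthProj h (complexPart V) w)

/-- On `H` the induced form is `-Re h`. -/
theorem inducedForm_complexPart [FiniteDimensional ℂ T] (h : HermitianForm T)
    (V : Submodule ℝ T) (v w : T) (hv : v ∈ complexPart V) (hw : w ∈ complexPart V) :
    inducedForm h V v w = - h.re v w := by
  have e : ∀ u (_ : u ∈ complexPart V), orthProj h (complexPart V) u = u := fun u hu => by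
    have := Submodule.projectionOnto_apply_left
      (isCompl_orthogonal h (complexPart V)) ⟨u, hu⟩
    simp only [orthProj, LinearMap.comp_apply]
    rw [this]; rfl
  rw [inducedForm, e v hv, e w hw]; ring

/-- On `F`, and between `F` and anything, the induced form is `Re h`;
in particular `H ⊥ F`. -/
theorem inducedForm_cocomplexPart [FiniteDimensional ℂ T] (h : HermitianForm T)
    (V : Submodule ℝ T) (v w : T) (hw : w ∈ cocomplexPart h V) :
    inducedForm h V v w = h.re v w := by
  have e : orthProj h (complexPart V) w = 0 := by
    have := (Submodule.projectionOnto_apply_eq_zero_iff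
      (isCompl_orthogonal h (complexPart V))).2 hw.2
    simp only [orthProj, LinearMap.comp_apply]
    rw [this]; simp
  rw [inducedForm, e]; simp

end Linear

/-! ### Geometry of submanifolds of a complex manifold with a Hermitian metric -/

section Geometry

variable {E : Type} [NormedAddCommGroup E] [NormedSpace ℂ E]
  {X : Type} [TopologicalSpace X] [ChartedSpace E X]

/-- A curve `ℝ → X` is smooth (`X` is seen as a real manifold). -/
def SmoothCurve (c : ℝ → X) : Prop :=
  ContMDiff 𝓘(ℝ, ℝ) 𝓘(ℝ, E) ∞ c

/-- The velocity of a curve at time `t`. -/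
def velocity (c : ℝ → X) (t : ℝ) : TangentSpace 𝓘(ℂ, E) (c t) :=
  (mfderiv 𝓘(ℝ, ℝ) 𝓘(ℝ, E) c t (1 : ℝ) : E)

/-- The tangent space at `x` of a submanifold `Y ⊆ X`: it is spanned by the velocities at `x` of
the smooth curves in `Y` through `x`. -/
def tangentTo (Y : Set X) (x : X) : Submodule ℝ (TangentSpace 𝓘(ℂ, E) x) :=
  Submodule.span ℝ {v | ∃ c : ℝ → X, SmoothCurve (E := E) c ∧ (∀ t, c t ∈ Y) ∧ c 0 = x ∧
    (velocity (E := E) c 0 : E) = v}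

variable [FiniteDimensional ℂ E]

instance (x : X) : FiniteDimensional ℂ (TangentSpace 𝓘(ℂ, E) x) :=
  inferInstanceAs (FiniteDimensional ℂ E)

/-- The induced CR Hermitian (pseudo-Riemannian) metric of a submanifold `Y ⊆ X`
at the point `x`. -/
def inducedMetric (h : ∀ x : X, HermitianForm (TangentSpace 𝓘(ℂ, E) x)) (Y : Set X) (x : X)
    (v w : TangentSpace 𝓘(ℂ, E) x) : ℝ :=
  inducedForm (h x) (tangentTo Y x) v w

/-- The action `∫ g(c', c') dt`, over `[a, b]`, of a curve in `Y`. -/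
def action (h : ∀ x : X, HermitianForm (TangentSpace 𝓘(ℂ, E) x)) (Y : Set X)
    (c : ℝ → X) (a b : ℝ) : ℝ :=
  ∫ t in a..b, inducedMetric h Y (c t) (velocity c t) (velocity c t)

/-- A smooth family of curves in `Y`, all with the same values at the times `a` and `b`,
which is `c` for the parameter `0`. -/
structure IsVariation (E : Type) [NormedAddCommGroup E] [NormedSpace ℂ E] {X : Type}
    [TopologicalSpace X] [ChartedSpace E X]
    (Y : Set X) (c : ℝ → X) (a b : ℝ) (Γ : ℝ → ℝ → X) : Prop where
  smooth : ContMDiff 𝓘(ℝ, ℝ × ℝ) 𝓘(ℝ, E) ∞ (fun p : ℝ × ℝ => Γ p.1 p.2)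
  mem : ∀ s t, Γ s t ∈ Y
  zero : ∀ t, Γ 0 t = c t
  left : ∀ s, Γ s a = c a
  right : ∀ s, Γ s b = c b

/-- Geodesics of the pseudo-Riemannian manifold `Y`: the smooth curves in `Y` that are, on
every interval, critical points of the action under variations with fixed end points. -/
structure IsGeodesic (h : ∀ x : X, HermitianForm (TangentSpace 𝓘(ℂ, E) x)) (Y : Set X)
    (c : ℝ → X) : Prop where
  smooth : SmoothCurve (E := E) c
  mem : ∀ t, c t ∈ Y
  critical : ∀ a b : ℝ, a < b → ∀ Γ : ℝ → ℝ → X, IsVariation E Y c a b Γ →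
    HasDerivAt (fun s => action h Y (Γ s) a b) 0 0

/-- `Y` with its induced metric is polarized: every closed geodesic, parametrized by `[0, 1]`,
has rational action. -/
def IsPolarized (h : ∀ x : X, HermitianForm (TangentSpace 𝓘(ℂ, E) x)) (Y : Set X) : Prop :=
  ∀ c : ℝ → X, IsGeodesic h Y c → (∀ t, c (t + 1) = c t) → ∃ q : ℚ, action h Y c 0 1 = q

end Geometry

/-! ### Abelian Cousin groups -/

/-- The maximal compact subgroup of a (commutative) Lie group: the subgroup generated by all
compact subgroups. -/
def maxCompact (G : Type) [Group G] [TopologicalSpace G] : Subgroup G :=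
  sSup {K : Subgroup G | IsCompact (K : Set G)}

theorem map_mem_maxCompact {G G' : Type} [Group G] [TopologicalSpace G] [Group G']
    [TopologicalSpace G'] (f : G →* G') (hf : Continuous f) {x : G} (hx : x ∈ maxCompact G) :
    f x ∈ maxCompact G' := by
  have : maxCompact G ≤ (maxCompact G').comap f := by
    refine sSup_le fun K hK => ?_
    rw [← Subgroup.map_le_iff_le_comap]
    refine le_sSup ?_
    have hK' : IsCompact (K : Set G) := hK
    have := hK'.image hf
    rwa [← Subgroup.coe_map] at this
  exact this hx

/-- A complex manifold on which every holomorphic function is constant. -/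
def OnlyConstantFunctions (E : Type) [NormedAddCommGroup E] [NormedSpace ℂ E] (G : Type)
    [TopologicalSpace G] [ChartedSpace E G] : Prop :=
  ∀ f : G → ℂ, MDifferentiable 𝓘(ℂ, E) 𝓘(ℂ, ℂ) f → ∃ a : ℂ, ∀ x, f x = a

/-- An abelian Cousin group: a connected complex Lie group `G` (modelled on a finite-dimensional
complex vector space `E`) all of whose holomorphic functions are constant, with a left invariant
Hermitian metric (its smoothness follows from the invariance), such that the maximal compact
subgroup with the induced CR Hermitian structure is a polarized pseudo-Riemannian manifold. -/
structure AbelianCousinGroup : Type 1 where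
  E : Type
  [normed : NormedAddCommGroup E]
  [normedSpace : NormedSpace ℂ E]
  [finDim : FiniteDimensional ℂ E]
  G : Type
  [group : Group G]
  [top : TopologicalSpace G]
  [charted : ChartedSpace E G]
  [lie : LieGroup 𝓘(ℂ, E) ω G]
  [connected : ConnectedSpace G]
  cousin : OnlyConstantFunctions E G
  metric : ∀ x : G, HermitianForm (TangentSpace 𝓘(ℂ, E) x)
  metric_left_invariant : ∀ (a x : G) (v w : TangentSpace 𝓘(ℂ, E) x),
    (metric (a * x)).form (mfderiv 𝓘(ℂ, E) 𝓘(ℂ, E) (fun y => a * y) x v)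
      (mfderiv 𝓘(ℂ, E) 𝓘(ℂ, E) (fun y => a * y) x w) = (metric x).form v w
  polarized : IsPolarized metric (maxCompact G : Set G)

namespace AbelianCousinGroup

attribute [instance] normed normedSpace finDim group top charted lie connected

/-- The distinguished cocomplex subspace `F` of the tangent space at `x` of the maximal compact
subgroup. -/
def cocomplex (A : AbelianCousinGroup) (x : A.G) :
    Submodule ℝ (TangentSpace 𝓘(ℂ, A.E) x) :=
  cocomplexPart (A.metric x) (tangentTo (maxCompact A.G : Set A.G) x)

/-- A morphism of abelian Cousin groups: a holomorphic homomorphism whose restriction to the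
maximal compact subgroups is a morphism of bi-CR manifolds. The differential of a holomorphic
homomorphism always maps `H` to `H` complex linearly, so the condition is that it
maps `F` to `F`. -/
@[ext]
structure Hom (A B : AbelianCousinGroup) where
  toHom : A.G →* B.G
  holomorphic : MDifferentiable 𝓘(ℂ, A.E) 𝓘(ℂ, B.E) toHom
  map_cocomplex : ∀ x ∈ maxCompact A.G, ∀ v ∈ A.cocomplex x,
    mfderiv 𝓘(ℂ, A.E) 𝓘(ℂ, B.E) toHom x v ∈ B.cocomplex (toHom x)

def Hom.id (A : AbelianCousinGroup) : Hom A A where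
  toHom := MonoidHom.id A.G
  holomorphic := mdifferentiable_id
  map_cocomplex := fun x _ v hv => by
    have : mfderiv 𝓘(ℂ, A.E) 𝓘(ℂ, A.E) (MonoidHom.id A.G) x
        = ContinuousLinearMap.id ℂ (TangentSpace 𝓘(ℂ, A.E) x) := mfderiv_id
    rw [this]
    exact hv

def Hom.comp {A B C : AbelianCousinGroup} (f : Hom A B) (g : Hom B C) : Hom A C where
  toHom := g.toHom.comp f.toHom
  holomorphic := g.holomorphic.comp f.holomorphic
  map_cocomplex := fun x hx v hv => by
    have : mfderiv 𝓘(ℂ, A.E) 𝓘(ℂ, C.E) (g.toHom.comp f.toHom) x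
        = (mfderiv 𝓘(ℂ, B.E) 𝓘(ℂ, C.E) g.toHom (f.toHom x)).comp
          (mfderiv 𝓘(ℂ, A.E) 𝓘(ℂ, B.E) f.toHom x) :=
      mfderiv_comp x (g.holomorphic _) (f.holomorphic x)
    rw [this]
    exact g.map_cocomplex _ (map_mem_maxCompact f.toHom f.holomorphic.continuous hx) _
      (f.map_cocomplex x hx v hv)

/-- The category of abelian Cousin groups. -/
instance : Category AbelianCousinGroup where
  Hom := Hom
  id := Hom.id
  comp := Hom.comp
  id_comp := fun _ => rfl
  comp_id := fun _ => rfl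
  assoc := fun _ _ _ => rfl

/-- Isogenies: the surjective morphisms with finite kernel. -/
def isogenies : MorphismProperty AbelianCousinGroup := fun _ _ f =>
  Function.Surjective (Hom.toHom f) ∧ Finite (Hom.toHom f).ker

/-- The category of abelian Cousin groups up to isogeny: the localization of the category of
abelian Cousin groups at the isogenies. -/
abbrev UpToIsogeny := isogenies.Localization

end AbelianCousinGroup

attribute [local instance] Abelian.hasFiniteBiproducts

/-- A category is semisimple if it is abelian, every object is a finite direct sum of simple
objects, and every subobject is a direct summand. -/
def IsSemisimpleCategory (C : Type*) [Category C] : Prop :=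
  ∃ _ : Abelian C,
    (∀ X : C, ∃ (n : ℕ) (S : Fin n → C), (∀ i, Simple (S i)) ∧ Nonempty (X ≅ ⨁ S)) ∧
    (∀ (X Y : C) (f : X ⟶ Y), Mono f → IsSplitMono f)

end Cousin

end

open CategoryTheory CategoryTheory.Limits
open scoped Manifold ContDiff

noncomputable section

namespace Cousin

set_option linter.unusedSectionVars false

/-! ### Maps with vanishing derivative -/

section ManifoldCalculus

open Set Topology

variable {𝕜 : Type*} [RCLike 𝕜]
  {E : Type*} [NormedAddCommGroup E] [NormedSpace 𝕜 E]
  {M : Type*} [TopologicalSpace M] [ChartedSpace E M] [IsManifold 𝓘(𝕜, E) 1 M]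
  {F : Type*} [NormedAddCommGroup F] [NormedSpace 𝕜 F]
  {N : Type*} [TopologicalSpace N] [ChartedSpace F N] [IsManifold 𝓘(𝕜, F) 1 N]

/-! The adjoint representation of a Cousin group is a holomorphic matrix-valued map, hence constant,
so the group is commutative. Its exponential map `E → G` is then a surjective homomorphism with
discrete kernel `Γ`, the periods (`exists_isExpMap`), and `G = E / Γ`. The maximal compact subgroup
is the image of the real span `V` of `Γ`. Left invariance turns the induced metric into one constant
form `g` on `V`, negative on `H`, positive on `F`, hence nondegenerate. Geodesics are then images of
straight lines, the closed ones correspond to periods `γ` and have action `g γ γ`, so polarization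
means that `g` is rational on `Γ` (`IsExpMap.isPolarized_iff`).

All the geometry is thus encoded in the linear data `PeriodData`. Holomorphic homomorphisms are
complex linear maps that preserve periods; inverting isogenies, in particular multiplication by `n`,
leaves only the rational span of `Γ` to be preserved. Hence the localization is equivalent to
`PeriodData`, whose morphisms preserve rational spans and cocomplex parts
(`AbelianCousinGroup.strictUniversalProperty`, `PeriodData.periodData_toCousin`).

Semisimplicity comes from adjoints (`PeriodData.exists_adjoint`). A morphism `f` respects both `H`
and `F`, and `g` differs from `Re h` only by a sign on `H`, so the adjoints for `g` and for `Re h`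
coincide. The form `g` shows that the adjoint `f'` is rational; the form `Re h` shows that it is
complex linear on `H`, and its positivity gives `ker (f'f)² = ker f'f = ker f` on `V`. Some multiple
`t` of `f'f` preserves the finitely generated group `Γ`, so it satisfies a monic integral
polynomial; removing the powers of `X` leaves `q` with `q(0) ≠ 0` and `f q(t) = 0`, an equation that
can be solved for `f` and yields `g` with `f ≫ g ≫ f = f` (`PeriodData.hasPseudoInverses`). An
additive idempotent complete category with such pseudo-inverses is abelian and its monomorphisms
split; since the dimension drops along proper retracts, objects decompose into finitely many simple
ones. -/

theorem eventually_eq_of_hasMFDerivAt_zero {f : M → N} {x : M}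
    (hf : ∀ᶠ y in 𝓝 x, HasMFDerivAt 𝓘(𝕜, E) 𝓘(𝕜, F) f y 0) : ∀ᶠ y in 𝓝 x, f y = f x := by
  -- Real scalars serve for the convexity, hence connectedness, of a ball in the chart.
  let _ : NormedSpace ℝ E := NormedSpace.restrictScalars ℝ 𝕜 E
  set e := extChartAt 𝓘(𝕜, E) x
  set e' := extChartAt 𝓘(𝕜, F) (f x)
  have hfx := hf.self_of_nhds.continuousAt
  have h1 : ∀ᶠ y in 𝓝 x, HasMFDerivAt 𝓘(𝕜, E) 𝓘(𝕜, F) f y 0 ∧ f y ∈ e'.source ∧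
      y ∈ e.source :=
    hf.and ((hfx.eventually (extChartAt_source_mem_nhds (I := 𝓘(𝕜, F)) (f x))).and
      (extChartAt_source_mem_nhds (I := 𝓘(𝕜, E)) x))
  have h2 : ∀ᶠ z in 𝓝 (e x), z ∈ e.target ∧
      HasMFDerivAt 𝓘(𝕜, E) 𝓘(𝕜, F) f (e.symm z) 0 ∧ f (e.symm z) ∈ e'.source := by
    have hs : Filter.Tendsto e.symm (𝓝 (e x)) (𝓝 x) := by
      have := continuousAt_extChartAt_symm (I := 𝓘(𝕜, E)) x
      rwa [ContinuousAt, extChartAt_to_inv] at this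
    filter_upwards [hs.eventually h1, extChartAt_target_mem_nhds (I := 𝓘(𝕜, E)) x] with z hz hz'
    exact ⟨hz', hz.1, hz.2.1⟩
  obtain ⟨r, hr, hB⟩ := Metric.eventually_nhds_iff_ball.1 h2
  have hder : ∀ z ∈ Metric.ball (e x) r, HasFDerivAt (𝕜 := 𝕜) (e' ∘ f ∘ e.symm) 0 z := by
    intro z hz
    obtain ⟨hz1, hz2, hz3⟩ := hB z hz
    have d1 : MDifferentiableAt 𝓘(𝕜, E) 𝓘(𝕜, E) e.symm z :=
      (contMDiffOn_extChartAt_symm (n := 1) x).mdifferentiableOn one_ne_zero |>.mdifferentiableAt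
        ((isOpen_extChartAt_target (I := 𝓘(𝕜, E)) x).mem_nhds hz1)
    have d2 : MDifferentiableAt 𝓘(𝕜, F) 𝓘(𝕜, F) e' (f (e.symm z)) :=
      mdifferentiableAt_extChartAt (by simpa [e'] using hz3)
    have := d2.hasMFDerivAt.comp z (hz2.comp z d1.hasMFDerivAt)
    rw [hasMFDerivAt_iff_hasFDerivAt] at this
    refine this.congr_fderiv ?_
    ext v
    simp only [ContinuousLinearMap.zero_comp, ContinuousLinearMap.comp_zero]
    rfl
  have hconst : ∀ z ∈ Metric.ball (e x) r, (e' ∘ f ∘ e.symm) z = (e' ∘ f ∘ e.symm) (e x) := by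
    intro z hz
    refine Metric.isOpen_ball.is_const_of_fderiv_eq_zero (𝕜 := 𝕜)
      (convex_ball (e x) r).isPreconnected
      (fun w hw => (hder w hw).differentiableAt.differentiableWithinAt)
      (fun w hw => (hder w hw).fderiv) hz (Metric.mem_ball_self hr)
  filter_upwards [h1, (continuousAt_extChartAt (I := 𝓘(𝕜, E)) x).eventually
    (Metric.ball_mem_nhds (e x) hr)] with y hy hyB
  have := hconst _ hyB
  simp only [Function.comp_apply] at this
  rw [e.left_inv hy.2.2, e.left_inv (mem_extChartAt_source x)] at this
  exact e'.injOn hy.2.1 (mem_extChartAt_source (f x)) this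

theorem eq_of_hasMFDerivAt_zero [PreconnectedSpace M] {f : M → N}
    (hf : ∀ y, HasMFDerivAt 𝓘(𝕜, E) 𝓘(𝕜, F) f y 0) (x y : M) : f x = f y :=
  IsLocallyConstant.apply_eq_of_preconnectedSpace
    (IsLocallyConstant.iff_eventually_eq f |>.2 fun _ =>
      eventually_eq_of_hasMFDerivAt_zero (𝕜 := 𝕜) (.of_forall hf)) x y

end ManifoldCalculus

/-! ### First order calculus on Lie groups -/

/-- `f` has derivative `A` at `x`, for manifolds modelled on vector spaces, with the tangent
spaces identified with the model spaces through the preferred charts. -/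
def HasMD (𝕜 : Type*) [RCLike 𝕜]
    {E : Type*} [NormedAddCommGroup E] [NormedSpace 𝕜 E]
    {M : Type*} [TopologicalSpace M] [ChartedSpace E M]
    {F : Type*} [NormedAddCommGroup F] [NormedSpace 𝕜 F]
    {N : Type*} [TopologicalSpace N] [ChartedSpace F N]
    (f : M → N) (x : M) (A : E →L[𝕜] F) : Prop :=
  HasMFDerivAt 𝓘(𝕜, E) 𝓘(𝕜, F) f x A

namespace HasMD

open Set Topology

variable {𝕜 : Type*} [RCLike 𝕜]
  {E : Type*} [NormedAddCommGroup E] [NormedSpace 𝕜 E]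
  {M : Type*} [TopologicalSpace M] [ChartedSpace E M]
  {F : Type*} [NormedAddCommGroup F] [NormedSpace 𝕜 F]
  {N : Type*} [TopologicalSpace N] [ChartedSpace F N]
  {F' : Type*} [NormedAddCommGroup F'] [NormedSpace 𝕜 F']
  {N' : Type*} [TopologicalSpace N'] [ChartedSpace F' N']

theorem congr {f : M → N} {x : M} {A B : E →L[𝕜] F} (h : HasMD 𝕜 f x A) (e : A = B) :
    HasMD 𝕜 f x B := e ▸ h

theorem congr_of_eventuallyEq {f g : M → N} {x : M} {A : E →L[𝕜] F} (h : HasMD 𝕜 f x A)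
    (e : g =ᶠ[𝓝 x] f) : HasMD 𝕜 g x A :=
  HasMFDerivAt.congr_of_eventuallyEq h e

theorem continuousAt {f : M → N} {x : M} {A : E →L[𝕜] F} (h : HasMD 𝕜 f x A) :
    ContinuousAt f x := HasMFDerivAt.continuousAt h

theorem comp {f : M → N} {g : N → N'} {x : M} {y : N} {A : E →L[𝕜] F} {B : F →L[𝕜] F'}
    (hg : HasMD 𝕜 g y B) (hf : HasMD 𝕜 f x A) (hy : f x = y) :
    HasMD 𝕜 (fun z => g (f z)) x (B ∘L A) := by
  subst hy
  exact HasMFDerivAt.comp x hg hf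

theorem unique {f : M → N} {x : M} {A B : E →L[𝕜] F} (h : HasMD 𝕜 f x A) (h' : HasMD 𝕜 f x B) :
    A = B := hasMFDerivAt_unique h h'

variable (𝕜) in
theorem id (x : M) : HasMD 𝕜 (fun y : M => y) x (ContinuousLinearMap.id 𝕜 E) :=
  hasMFDerivAt_id x

variable (𝕜) in
theorem const (x : M) (c : N) : HasMD 𝕜 (fun _ : M => c) x (0 : E →L[𝕜] F) :=
  hasMFDerivAt_const c x

theorem _root_.HasFDerivAt.hasMD {f : E → F} {x : E} {A : E →L[𝕜] F} (h : HasFDerivAt f A x) :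
    HasMD 𝕜 f x A := h.hasMFDerivAt

theorem mfderiv_eq {f : M → N} {x : M} {A : E →L[𝕜] F} (h : HasMD 𝕜 f x A) :
    mfderiv 𝓘(𝕜, E) 𝓘(𝕜, F) f x = A := HasMFDerivAt.mfderiv h

theorem _root_.MDifferentiableAt.hasMD {f : M → N} {x : M}
    (h : MDifferentiableAt 𝓘(𝕜, E) 𝓘(𝕜, F) f x) :
    HasMD 𝕜 f x (show E →L[𝕜] F from mfderiv 𝓘(𝕜, E) 𝓘(𝕜, F) f x) :=
  MDifferentiableAt.hasMFDerivAt h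

theorem iff {f : M → N} {x : M} {A : E →L[𝕜] F} : HasMD 𝕜 f x A ↔ ContinuousAt f x ∧
    HasFDerivAt (writtenInExtChartAt 𝓘(𝕜, E) 𝓘(𝕜, F) x f) A (extChartAt 𝓘(𝕜, E) x x) := by
  have : HasMD 𝕜 f x A ↔ ContinuousAt f x ∧ HasFDerivWithinAt (E := E) (F := F)
      (writtenInExtChartAt 𝓘(𝕜, E) 𝓘(𝕜, F) x f) A (range 𝓘(𝕜, E)) (extChartAt 𝓘(𝕜, E) x x) :=
    Iff.rfl
  rw [this, modelWithCornersSelf_coe, range_id, hasFDerivWithinAt_univ]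

section Group

variable {G : Type*} [Group G] [TopologicalSpace G] [ChartedSpace F G] [LieGroup 𝓘(𝕜, F) 1 G]

theorem mul_left (a x : G) : ∃ A : F →L[𝕜] F, HasMD 𝕜 (fun y => a * y) x A :=
  ⟨show F →L[𝕜] F from _, MDifferentiableAt.hasMD
    ((contMDiff_mul_left (I := 𝓘(𝕜, F)) (n := 1) (a := a)).mdifferentiable one_ne_zero x)⟩

theorem mul_right (a x : G) : ∃ A : F →L[𝕜] F, HasMD 𝕜 (fun y => y * a) x A :=
  ⟨show F →L[𝕜] F from _, MDifferentiableAt.hasMD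
    ((contMDiff_mul_right (I := 𝓘(𝕜, F)) (n := 1) (a := a)).mdifferentiable one_ne_zero x)⟩

theorem inv (x : G) : ∃ A : F →L[𝕜] F, HasMD 𝕜 (fun y : G => y⁻¹) x A :=
  ⟨show F →L[𝕜] F from _, MDifferentiableAt.hasMD ((contMDiff_inv 𝓘(𝕜, F) 1).mdifferentiable one_ne_zero x)⟩

/-- The derivative of the multiplication of `G` is the sum of its two partial derivatives, and these
are the derivatives of the right and left translations. -/
theorem mul {f g : M → G} {x : M} {A B : E →L[𝕜] F} {R S : F →L[𝕜] F}
    (hf : HasMD 𝕜 f x A) (hg : HasMD 𝕜 g x B)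
    (hR : HasMD 𝕜 (fun y => y * g x) (f x) R) (hS : HasMD 𝕜 (fun y => f x * y) (g x) S) :
    HasMD 𝕜 (fun y => f y * g y) x (R ∘L A + S ∘L B) := by
  have hF : ContMDiff (𝓘(𝕜, F).prod 𝓘(𝕜, F)) 𝓘(𝕜, F) 1 (fun p : G × G => p.1 * p.2) :=
    contMDiff_fst.mul contMDiff_snd
  obtain ⟨D, hd⟩ : ∃ D : F × F →L[𝕜] F,
      HasMFDerivAt (𝓘(𝕜, F).prod 𝓘(𝕜, F)) 𝓘(𝕜, F) (fun p : G × G => p.1 * p.2) (f x, g x) D :=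
    ⟨_, (hF.mdifferentiable one_ne_zero (f x, g x)).hasMFDerivAt⟩
  have h1 : HasMD 𝕜 (fun y => f y * g y) x (D ∘L (A.prod B)) :=
    HasMFDerivAt.comp (f := fun y => (f y, g y)) x hd (HasMFDerivAt.prodMk hf hg)
  have h2 : HasMD 𝕜 (fun y => y * g x) (f x)
      (D ∘L ((ContinuousLinearMap.id 𝕜 F).prod (0 : F →L[𝕜] F))) :=
    HasMFDerivAt.comp (f := fun y => (y, g x)) (f x) hd
      (HasMFDerivAt.prodMk (HasMD.id 𝕜 (f x)) (HasMD.const 𝕜 (f x) (g x)))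
  have h3 : HasMD 𝕜 (fun y => f x * y) (g x)
      (D ∘L ((0 : F →L[𝕜] F).prod (ContinuousLinearMap.id 𝕜 F))) :=
    HasMFDerivAt.comp (f := fun y => (f x, y)) (g x) hd
      (HasMFDerivAt.prodMk (HasMD.const 𝕜 (g x) (f x)) (HasMD.id 𝕜 (g x)))
  refine h1.congr ?_
  rw [hR.unique h2, hS.unique h3]
  ext v
  simp [← map_add]

/-- The derivative of the inversion need not be computed: since `y * y⁻¹` is constant, the product
rule gives the one relation `R + S ∘ I = 0` that makes the derivative of the quotient vanish. -/
theorem mul_inv {f g : M → G} {x : M} {A : E →L[𝕜] F}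
    (hf : HasMD 𝕜 f x A) (hg : HasMD 𝕜 g x A) (hfg : f x = g x) :
    HasMD 𝕜 (fun y => f y * (g y)⁻¹) x (0 : E →L[𝕜] F) := by
  obtain ⟨I, hI⟩ := HasMD.inv (𝕜 := 𝕜) (F := F) (f x)
  obtain ⟨R, hR⟩ := HasMD.mul_right (𝕜 := 𝕜) (F := F) (f x)⁻¹ (f x)
  obtain ⟨S, hS⟩ := HasMD.mul_left (𝕜 := 𝕜) (F := F) (f x) (f x)⁻¹
  have h1 := HasMD.mul (HasMD.id 𝕜 (f x)) hI hR hS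
  have h2 : HasMD 𝕜 (fun y : G => y * y⁻¹) (f x) (0 : F →L[𝕜] F) := by
    simp only [mul_inv_cancel]
    exact HasMD.const 𝕜 (f x) 1
  have h3 := h1.unique h2
  have h4 := HasMD.mul hf (hI.comp hg hfg.symm) (by rwa [← hfg]) (by rwa [← hfg])
  refine h4.congr ?_
  ext v
  simpa using congrArg (fun B : F →L[𝕜] F => B (A v)) h3

theorem mul_of_eq_one {f g : M → G} {x : M} {A B : E →L[𝕜] F} (hf : HasMD 𝕜 f x A)
    (hg : HasMD 𝕜 g x B) (hfx : f x = 1) (hgx : g x = 1) :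
    HasMD 𝕜 (fun y => f y * g y) x (A + B) := by
  refine (HasMD.mul hf hg (R := ContinuousLinearMap.id 𝕜 F)
    (S := ContinuousLinearMap.id 𝕜 F) ?_ ?_).congr ?_
  · simpa [hgx] using HasMD.id 𝕜 (f x)
  · simpa [hfx] using HasMD.id 𝕜 (g x)
  · simp

end Group

section RestrictScalars

variable {E : Type*} [NormedAddCommGroup E] [NormedSpace ℂ E]
  {M : Type*} [TopologicalSpace M] [ChartedSpace E M]
  {F : Type*} [NormedAddCommGroup F] [NormedSpace ℂ F]
  {N : Type*} [TopologicalSpace N] [ChartedSpace F N]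

theorem restrictScalars {f : M → N} {x : M} {A : E →L[ℂ] F} (h : HasMD ℂ f x A) :
    HasMD ℝ f x (A.restrictScalars ℝ) :=
  iff.2 ⟨h.1, (iff.1 h).2.restrictScalars ℝ⟩

theorem of_restrictScalars {f : M → N} {x : M} {A : E →L[ℂ] F}
    (h : HasMD ℝ f x (A.restrictScalars ℝ)) : HasMD ℂ f x A :=
  iff.2 ⟨h.1, hasFDerivAt_of_restrictScalars ℝ (iff.1 h).2 rfl⟩

end RestrictScalars

end HasMD

/-! ### Complex Lie groups as real Lie groups -/

section RealStructure

open Set Topology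

variable {E : Type*} [NormedAddCommGroup E] [NormedSpace ℂ E]
  {M : Type*} [TopologicalSpace M] [ChartedSpace E M]
  {F : Type*} [NormedAddCommGroup F] [NormedSpace ℂ F]
  {N : Type*} [TopologicalSpace N] [ChartedSpace F N] {n : WithTop ℕ∞}

theorem ContMDiff.restrictScalars {f : M → N}
    (h : ContMDiff 𝓘(ℂ, E) 𝓘(ℂ, F) n f) : ContMDiff 𝓘(ℝ, E) 𝓘(ℝ, F) n f :=
  fun x => ⟨(h x).1, ContDiffWithinAt.restrict_scalars ℝ (h x).2⟩

theorem isManifold_real [IsManifold 𝓘(ℂ, E) n M] : IsManifold 𝓘(ℝ, E) n M := by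
  refine isManifold_of_contDiffOn 𝓘(ℝ, E) n M fun e e' he he' => ?_
  have := (contDiffGroupoid n 𝓘(ℂ, E)).compatible he he'
  rw [contDiffGroupoid, mem_groupoid_of_pregroupoid] at this
  exact ContDiffOn.restrict_scalars ℝ this.1

theorem lieGroup_real (G : Type*) [Group G] [TopologicalSpace G] [ChartedSpace E G]
    [LieGroup 𝓘(ℂ, E) n G] : LieGroup 𝓘(ℝ, E) n G :=
  { toIsManifold := isManifold_real
    contMDiff_mul := fun x => by
      have := contMDiff_mul 𝓘(ℂ, E) n (G := G) x
      exact ⟨this.1, ContDiffWithinAt.restrict_scalars ℝ this.2⟩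
    contMDiff_inv := ContMDiff.restrictScalars (contMDiff_inv 𝓘(ℂ, E) n) }

end RealStructure

/-! ### Cousin groups are commutative -/

section Commutative

open Set Topology

variable {E : Type} [NormedAddCommGroup E] [NormedSpace ℂ E]
  {G : Type} [Group G] [TopologicalSpace G] [ChartedSpace E G] [LieGroup 𝓘(ℂ, E) ω G]

theorem t2Space_of_lieGroup (E G : Type) [NormedAddCommGroup E] [NormedSpace ℂ E] [Group G]
    [TopologicalSpace G] [ChartedSpace E G] [LieGroup 𝓘(ℂ, E) ω G] : T2Space G := by
  have : IsTopologicalGroup G := topologicalGroup_of_lieGroup 𝓘(ℂ, E) ω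
  have : T1Space G := ChartedSpace.t1Space E G
  infer_instance

/-- Conjugation by `a`, read in the preferred chart at `1`. -/
def conjChart (a : G) (w : E) : E :=
  extChartAt 𝓘(ℂ, E) (1 : G) (a * (extChartAt 𝓘(ℂ, E) (1 : G)).symm w * a⁻¹)

/-- Joint analyticity in the conjugating element and the point is what makes the adjoint
representation holomorphic in the group variable. -/
theorem contMDiffAt_conjChart (a : G) :
    ContMDiffAt (𝓘(ℂ, E).prod 𝓘(ℂ, E)) 𝓘(ℂ, E) ω
      (Function.uncurry (conjChart (E := E) (G := G))) (a, extChartAt 𝓘(ℂ, E) (1 : G) 1) := by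
  have h1 : ContMDiffAt (𝓘(ℂ, E).prod 𝓘(ℂ, E)) 𝓘(ℂ, E) ω
      (fun p : G × E => (extChartAt 𝓘(ℂ, E) (1 : G)).symm p.2)
      (a, extChartAt 𝓘(ℂ, E) (1 : G) 1) := by
    have h2 : ContMDiffAt 𝓘(ℂ, E) 𝓘(ℂ, E) ω (extChartAt 𝓘(ℂ, E) (1 : G)).symm
        (extChartAt 𝓘(ℂ, E) (1 : G) 1) :=
      (contMDiffOn_extChartAt_symm (1 : G)).contMDiffAt (extChartAt_target_mem_nhds _)
    exact ContMDiffAt.comp (a, extChartAt 𝓘(ℂ, E) (1 : G) 1) (f := Prod.snd) h2 contMDiffAt_snd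
  have h3 := ((contMDiffAt_fst (I := 𝓘(ℂ, E)) (J := 𝓘(ℂ, E)) (n := ω)
    (p := (a, extChartAt 𝓘(ℂ, E) (1 : G) 1))).mul h1).mul (contMDiffAt_fst.inv)
  refine ContMDiffAt.comp (a, extChartAt 𝓘(ℂ, E) (1 : G) 1) (g := extChartAt 𝓘(ℂ, E) (1 : G))
    (f := fun p : G × E => p.1 * (extChartAt 𝓘(ℂ, E) (1 : G)).symm p.2 * p.1⁻¹) ?_ h3
  refine contMDiffAt_extChartAt' ?_
  simp

/-- The coefficients of `a ↦ Ad a`, obtained by applying a functional `l` to `Ad a v`, are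
holomorphic functions on `G`. They are constant, hence equal to their value at `a = 1`, and
functionals separate points. -/
theorem hasMD_conj [ConnectedSpace G] (h : OnlyConstantFunctions E G) (a : G) :
    HasMD ℂ (fun x => a * x * a⁻¹) 1 (ContinuousLinearMap.id ℂ E) := by
  set z := extChartAt 𝓘(ℂ, E) (1 : G) 1
  have hL : LieGroup 𝓘(ℂ, E) 1 G := .of_le le_top
  -- the derivative of conjugation in the chart
  have key : ∀ a : G, ∃ A : E →L[ℂ] E, HasMD ℂ (fun x => a * x * a⁻¹) 1 A ∧
      A = fderiv ℂ (conjChart a) z := by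
    intro a
    obtain ⟨S, hS⟩ := HasMD.mul_left (𝕜 := ℂ) (F := E) a 1
    obtain ⟨R, hR⟩ := HasMD.mul_right (𝕜 := ℂ) (F := E) a⁻¹ (a * 1)
    have hA := hR.comp hS rfl
    refine ⟨_, hA, ?_⟩
    have := (HasMD.iff.1 hA).2
    rw [writtenInExtChartAt] at this
    have e : a * 1 * a⁻¹ = 1 := by simp
    rw [e] at this
    exact this.fderiv.symm
  have hd : ∀ v : E, ∀ l : E →L[ℂ] ℂ, MDifferentiable 𝓘(ℂ, E) 𝓘(ℂ, ℂ)
      (fun a : G => l (fderiv ℂ (conjChart a) z v)) := by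
    intro v l a
    have h1 := ContMDiffAt.mfderiv (m := 1) (fun (a : G) (w : E) => conjChart a w) (fun _ => z)
      (contMDiffAt_conjChart a) contMDiffAt_const le_top
    have h2 : ContMDiffAt 𝓘(ℂ, E) 𝓘(ℂ, E →L[ℂ] E) 1
        (fun a : G => fderiv ℂ (conjChart a) z) a := by
      refine h1.congr_of_eventuallyEq (.of_forall fun b => ?_)
      have e := congrFun (inTangentCoordinates_model_space (I := 𝓘(ℂ, E)) (I' := 𝓘(ℂ, E))
        (fun _ : G => z) (fun a => conjChart a z) (fun a => mfderiv 𝓘(ℂ, E) 𝓘(ℂ, E) (conjChart a) z) a) b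
      exact mfderiv_eq_fderiv.symm.trans e.symm
    have h3 := h2.mdifferentiableAt one_ne_zero
    have h4 : Differentiable ℂ (fun A : E →L[ℂ] E => l (A v)) := by fun_prop
    exact (h4.mdifferentiable _).comp a h3
  obtain ⟨A, hA, hA'⟩ := key a
  obtain ⟨B, hB, hB'⟩ := key 1
  have hB1 : B = ContinuousLinearMap.id ℂ E := by
    refine hB.unique ?_
    simpa using HasMD.id ℂ (1 : G)
  refine hA.congr ?_
  rw [← hB1, hA', hB']
  ext v
  refine (SeparatingDual.eq_iff_forall_dual_eq (R := ℂ)).2 fun l => ?_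
  obtain ⟨c, hc⟩ := h _ (hd v l)
  rw [hc, hc]

/-- Since `Ad z = 1`, the maps `b` and `z b z⁻¹` have the same derivative at `1`, so `b z b⁻¹ z⁻¹`
has derivative zero there. Translation carries this to every point, and a map with zero derivative
on a connected manifold is constant. -/
theorem mul_comm_of_onlyConstantFunctions [ConnectedSpace G] (h : OnlyConstantFunctions E G)
    (x y : G) : x * y = y * x := by
  have hL : LieGroup 𝓘(ℂ, E) 1 G := .of_le le_top
  -- the map `b ↦ b z b⁻¹` has zero derivative at `1`
  have h1 : ∀ z : G, HasMD ℂ (fun b => b * z * b⁻¹) 1 (0 : E →L[ℂ] E) := by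
    intro z
    have h2 := HasMD.mul_inv (HasMD.id ℂ (1 : G)) (hasMD_conj h z) (by simp)
    obtain ⟨R, hR⟩ := HasMD.mul_right (𝕜 := ℂ) (F := E) z 1
    have h3 := hR.comp h2 (by simp)
    refine (h3.congr (by simp)).congr_of_eventuallyEq (.of_forall fun b => ?_)
    simp [mul_assoc]
  have h2 : ∀ a : G, HasMD ℂ (fun b => b * y * b⁻¹) a (0 : E →L[ℂ] E) := by
    intro a
    obtain ⟨R, hR⟩ := HasMD.mul_right (𝕜 := ℂ) (F := E) a⁻¹ a
    -- Uses `b y b⁻¹ = (b a⁻¹) (a y a⁻¹) (b a⁻¹)⁻¹`, with `b a⁻¹` close to `1`.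
    have h3 := (h1 (a * y * a⁻¹)).comp hR (by simp)
    refine (h3.congr (by simp)).congr_of_eventuallyEq (.of_forall fun b => ?_)
    simp [mul_assoc]
  have h3 := eq_of_hasMFDerivAt_zero (𝕜 := ℂ) h2 x 1
  simp only [one_mul, inv_one, mul_one] at h3
  rw [mul_inv_eq_iff_eq_mul] at h3
  exact h3

end Commutative

/-! ### One-parameter subgroups -/

section OneParameter

open Set Topology

variable {E : Type} [NormedAddCommGroup E] [NormedSpace ℝ E] [CompleteSpace E]
  {G : Type} [Group G] [TopologicalSpace G] [ChartedSpace E G] [LieGroup 𝓘(ℝ, E) ω G]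

/-- Take the integral curve through `1` of the left invariant field with value `v`. Left translates
of a local curve at `1` exist on the same interval at every point, so the curve extends to all
times; uniqueness of integral curves identifies `γ (t + s)` with `γ s * γ t`. -/
theorem exists_oneParameterSubgroup [T2Space G] (v : E) :
    ∃ γ : ℝ → G, (∀ s t, γ (s + t) = γ s * γ t) ∧
      HasMD ℝ γ 0 ((1 : ℝ →L[ℝ] ℝ).smulRight v) := by
  have hL : LieGroup 𝓘(ℝ, E) 1 G := .of_le le_top
  have hL3 : LieGroup 𝓘(ℝ, E) (minSmoothness ℝ 3) G := .of_le le_top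
  let V : (g : G) → TangentSpace 𝓘(ℝ, E) g :=
    mulInvariantVectorField (I := 𝓘(ℝ, E)) (G := G) v
  let W : G → E := V
  have hV : ContMDiff 𝓘(ℝ, E) 𝓘(ℝ, E).tangent 1
      (fun x => (⟨x, V x⟩ : TangentBundle 𝓘(ℝ, E) G)) :=
    (contMDiff_mulInvariantVectorField _).of_le ((by norm_num : (1 : ℕ∞ω) ≤ 2).trans
      le_minSmoothness)
  have hV1 : ∀ (g : G) (S : E →L[ℝ] E), HasMD ℝ (fun y => g * y) 1 S → W g = S v := by
    intro g S hS
    change (mfderiv 𝓘(ℝ, E) 𝓘(ℝ, E) (fun y => g * y) 1 : E →L[ℝ] E) v = S v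
    rw [hS.mfderiv_eq]
    rfl
  have hVmul : ∀ (x g : G) (S : E →L[ℝ] E), HasMD ℝ (fun y => x * y) g S →
      S (W g) = W (x * g) := by
    intro x g S hS
    obtain ⟨T, hT⟩ := HasMD.mul_left (𝕜 := ℝ) (F := E) g 1
    have h2 := hS.comp hT (by simp)
    simp only [← mul_assoc] at h2
    rw [hV1 g T hT, hV1 (x * g) _ h2]
    rfl
  have htrans : ∀ (x : G) (γ : ℝ → G) (t : ℝ), 
      HasMD ℝ γ t ((1 : ℝ →L[ℝ] ℝ).smulRight (W (γ t))) →
      HasMD ℝ (fun t => x * γ t) t ((1 : ℝ →L[ℝ] ℝ).smulRight (W (x * γ t))) := by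
    intro x γ t h
    obtain ⟨S, hS⟩ := HasMD.mul_left (𝕜 := ℝ) (F := E) x (γ t)
    refine (hS.comp h rfl).congr ?_
    ext
    simpa using hVmul x (γ t) S hS
  obtain ⟨γ₀, h0, hγ₀⟩ := exists_isMIntegralCurveAt_of_contMDiffAt_boundaryless (t₀ := 0)
    (hV.contMDiffAt (x := 1))
  obtain ⟨ε, hε, hball⟩ := Metric.eventually_nhds_iff_ball.1 hγ₀
  have hex : ∀ x : G, ∃ γ : ℝ → G, γ 0 = x ∧ IsMIntegralCurveOn γ V (Ioo (-ε) ε) := by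
    intro x
    refine ⟨fun t => x * γ₀ t, by simp [h0], fun t ht => ?_⟩
    have ht' : t ∈ Metric.ball (0 : ℝ) ε := by
      rw [Real.ball_eq_Ioo]; simpa using ht
    have := htrans x γ₀ t (hball t ht')
    exact HasMFDerivAt.hasMFDerivWithinAt this
  obtain ⟨γ, hγ0, hγ⟩ := exists_isMIntegralCurve_of_isMIntegralCurveOn hV hε hex 1
  refine ⟨γ, fun s t => ?_, ?_⟩
  · have h1 : IsMIntegralCurve (fun t => γ (t + s)) V := hγ.comp_add s
    have h2 : IsMIntegralCurve (fun t => γ s * γ t) V := fun t => htrans (γ s) γ t (hγ t)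
    have := isMIntegralCurve_Ioo_eq_of_contMDiff_boundaryless (t₀ := 0) hV h1 h2 (by simp [hγ0])
    simpa [add_comm] using congrFun this t
  · refine HasMD.congr (hγ 0) ?_
    have : W (γ 0) = v := by
      rw [hγ0, hV1 1 (ContinuousLinearMap.id ℝ E) (by simpa using HasMD.id ℝ (1 : G))]
      rfl
    exact congrArg (fun w : E => (1 : ℝ →L[ℝ] ℝ).smulRight w) this

end OneParameter

/-! ### Construction and smoothness of the exponential map -/

section Exponential

open Set Topology

/-- `π : E → G` is an exponential map of the Lie group `G`: a smooth surjective homomorphism whose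
derivative at `0` is the identity of `E`, the model of the tangent space of `G` at `1`. -/
structure IsExpMap {E : Type} [NormedAddCommGroup E] [NormedSpace ℂ E]
    {G : Type} [Group G] [TopologicalSpace G] [ChartedSpace E G] (π : E → G) : Prop where
  map_add : ∀ x y, π (x + y) = π x * π y
  contMDiff : ContMDiff 𝓘(ℂ, E) 𝓘(ℂ, E) ∞ π
  surjective : Function.Surjective π
  hasMD_zero : HasMD ℂ π 0 (ContinuousLinearMap.id ℂ E)

variable {E : Type} [NormedAddCommGroup E] [NormedSpace ℂ E] [FiniteDimensional ℂ E]
  {G : Type} [Group G] [TopologicalSpace G] [ChartedSpace E G] [LieGroup 𝓘(ℂ, E) ω G]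

/-- Multiply the one-parameter subgroups along a real basis of `E`, each applied to its coordinate.
Commutativity makes the product a homomorphism. Its real derivative at `0` is the identity, which is
complex linear, so it is a complex derivative. -/
theorem exists_hom_hasMD_id (hcomm : ∀ x y : G, x * y = y * x) :
    ∃ π : E → G, (∀ x y, π (x + y) = π x * π y) ∧ HasMD ℂ π 0 (ContinuousLinearMap.id ℂ E) := by
  have : FiniteDimensional ℝ E := FiniteDimensional.complexToReal E
  have : CompleteSpace E := FiniteDimensional.complete ℝ E
  have hR : LieGroup 𝓘(ℝ, E) ω G := lieGroup_real G
  have hL : LieGroup 𝓘(ℝ, E) 1 G := .of_le le_top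
  have : T2Space G := t2Space_of_lieGroup E G
  let _ : CommGroup G := { ‹Group G› with mul_comm := hcomm }
  let b := Module.finBasis ℝ E
  choose γ hγ hγ' using fun i => exists_oneParameterSubgroup (G := G) (b i)
  have hγ0 : ∀ i, γ i 0 = 1 := fun i => by
    have := hγ i 0 0
    rwa [add_zero, left_eq_mul] at this
  let l : Fin _ → E →L[ℝ] ℝ := fun i => (b.coord i).toContinuousLinearMap
  have hfin : ∀ s : Finset (Fin (Module.finrank ℝ E)), ∃ π : E → G,
      (∀ x y, π (x + y) = π x * π y) ∧ HasMD ℝ π 0 (∑ i ∈ s, (l i).smulRight (b i)) := by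
    intro s
    induction s using Finset.induction_on with
    | empty => exact ⟨fun _ => 1, by simp, by simpa using HasMD.const ℝ (0 : E) (1 : G)⟩
    | insert i s hi ih =>
      obtain ⟨π, h1, h2⟩ := ih
      have h3 : HasMD ℝ (fun x => γ i (l i x)) 0 ((l i).smulRight (b i)) := by
        refine ((hγ' i).comp (l i).hasFDerivAt.hasMD (by simp)).congr ?_
        ext; simp
      have hπ0 : π 0 = 1 := by
        have := h1 0 0
        rwa [add_zero, left_eq_mul] at this
      refine ⟨fun x => γ i (l i x) * π x, fun x y => ?_, ?_⟩
      · simp only [_root_.map_add, hγ, h1, mul_mul_mul_comm]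
      · rw [Finset.sum_insert hi]
        exact HasMD.mul_of_eq_one h3 h2 (by simp [hγ0]) hπ0
  obtain ⟨π, h1, h2⟩ := hfin Finset.univ
  refine ⟨π, h1, HasMD.of_restrictScalars (h2.congr ?_)⟩
  ext x
  simp [l, b.sum_repr]

end Exponential

section Exponential

open Set Topology

variable {E : Type} [NormedAddCommGroup E] [NormedSpace ℂ E]
  {G : Type} [Group G] [TopologicalSpace G] [ChartedSpace E G] [LieGroup 𝓘(ℂ, E) ω G]
  {π : E → G}

theorem map_zero_of_map_add {E G : Type} [AddGroup E] [Group G] {π : E → G}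
    (hadd : ∀ x y, π (x + y) = π x * π y) : π 0 = 1 := by
  have := hadd 0 0
  rwa [add_zero, left_eq_mul] at this

omit [LieGroup 𝓘(ℂ, E) ω G] in
theorem hasMD_of_map_add (hadd : ∀ x y, π (x + y) = π x * π y)
    (h0 : HasMD ℂ π 0 (ContinuousLinearMap.id ℂ E)) (x : E) {S : E →L[ℂ] E}
    (hS : HasMD ℂ (fun y => π x * y) 1 S) : HasMD ℂ π x S := by
  have h1 : HasMD ℂ (fun y => y - x) x (ContinuousLinearMap.id ℂ E) :=
    ((hasFDerivAt_id x).sub_const x).hasMD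
  have h2 := hS.comp (h0.comp h1 (sub_self x)) (by simp [map_zero_of_map_add hadd])
  refine (h2.congr (by simp)).congr_of_eventuallyEq (.of_forall fun y => ?_)
  simp [← hadd]

theorem continuous_of_map_add (hadd : ∀ x y, π (x + y) = π x * π y)
    (h0 : HasMD ℂ π 0 (ContinuousLinearMap.id ℂ E)) : Continuous π := by
  have hL : LieGroup 𝓘(ℂ, E) 1 G := .of_le le_top
  refine continuous_iff_continuousAt.2 fun x => ?_
  obtain ⟨S, hS⟩ := HasMD.mul_left (𝕜 := ℂ) (F := E) (π x) 1
  exact (hasMD_of_map_add hadd h0 x hS).continuousAt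

variable (E G) in
/-- The multiplication of `G` read in the preferred chart at `1`. -/
def mulChart (p : E × E) : E :=
  extChartAt 𝓘(ℂ, E) (1 : G)
    ((extChartAt 𝓘(ℂ, E) (1 : G)).symm p.1 * (extChartAt 𝓘(ℂ, E) (1 : G)).symm p.2)

theorem contDiffAt_mulChart :
    ContDiffAt ℂ ω (mulChart E G)
      (extChartAt 𝓘(ℂ, E) (1 : G) 1, extChartAt 𝓘(ℂ, E) (1 : G) 1) := by
  set z := extChartAt 𝓘(ℂ, E) (1 : G) 1
  have h2 : ContMDiffAt 𝓘(ℂ, E) 𝓘(ℂ, E) ω (extChartAt 𝓘(ℂ, E) (1 : G)).symm z :=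
    (contMDiffOn_extChartAt_symm (1 : G)).contMDiffAt (extChartAt_target_mem_nhds _)
  have h3 : ContMDiffAt (𝓘(ℂ, E).prod 𝓘(ℂ, E)) 𝓘(ℂ, E) ω
      (fun p : E × E => (extChartAt 𝓘(ℂ, E) (1 : G)).symm p.1) (z, z) :=
    ContMDiffAt.comp (z, z) (f := Prod.fst) h2 contMDiffAt_fst
  have h4 : ContMDiffAt (𝓘(ℂ, E).prod 𝓘(ℂ, E)) 𝓘(ℂ, E) ω
      (fun p : E × E => (extChartAt 𝓘(ℂ, E) (1 : G)).symm p.2) (z, z) :=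
    ContMDiffAt.comp (z, z) (f := Prod.snd) h2 contMDiffAt_snd
  have h5 : ContMDiffAt (𝓘(ℂ, E).prod 𝓘(ℂ, E)) 𝓘(ℂ, E) ω (mulChart E G) (z, z) :=
    ContMDiffAt.comp (z, z) (g := extChartAt 𝓘(ℂ, E) (1 : G))
      (contMDiffAt_extChartAt' (by simp [z])) (h3.mul h4)
  rw [← modelWithCornersSelf_prod, chartedSpaceSelf_prod] at h5
  exact h5.contDiffAt

/-- A differentiable homomorphism `E → G` whose derivative at `0` is the identity is smooth. -/
theorem contMDiff_of_map_add (hadd : ∀ x y, π (x + y) = π x * π y)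
    (h0 : HasMD ℂ π 0 (ContinuousLinearMap.id ℂ E)) : ContMDiff 𝓘(ℂ, E) 𝓘(ℂ, E) ∞ π := by
  have hL : LieGroup 𝓘(ℂ, E) 1 G := .of_le le_top
  have hLi : LieGroup 𝓘(ℂ, E) ∞ G := .of_le le_top
  have hc := continuous_of_map_add hadd h0
  have hπ0 := map_zero_of_map_add hadd
  set φ := extChartAt 𝓘(ℂ, E) (1 : G)
  set z := φ 1
  set f : E → E := fun x => φ (π x)
  -- `K w` is the derivative at `1` of the left translation by the point with coordinate `w`. The
  -- homomorphism property then reads as the differential equation `f' = K ∘ f`.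
  let K : E → E →L[ℂ] E := fun w => fderiv ℂ (fun u => mulChart E G (w, u)) z
  have hf0 : HasFDerivAt f (ContinuousLinearMap.id ℂ E) 0 := by
    have := (HasMD.iff.1 h0).2
    rw [writtenInExtChartAt, hπ0] at this
    exact this
  have hKz : ContDiffAt ℂ ω K z := by
    refine ContDiffAt.fderiv (n := ω) (f := fun w u => mulChart E G (w, u)) (g := fun _ => z)
      ?_ contDiffAt_const le_top
    exact contDiffAt_mulChart
  -- the good neighbourhood
  have hfc : ContinuousAt f 0 := hf0.continuousAt
  have hf0z : f 0 = z := by simp [f, hπ0, z]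
  have hsrc : ∀ᶠ x in 𝓝 (0 : E), π x ∈ φ.source := by
    refine hc.continuousAt.eventually ?_
    rw [hπ0]
    exact extChartAt_source_mem_nhds (1 : G)
  have hgood : ∀ᶠ x in 𝓝 (0 : E), ContDiffAt ℂ ω K (f x) ∧
      ContDiffAt ℂ ω (mulChart E G) (f x, z) ∧ π x ∈ φ.source := by
    have e1 : ∀ᶠ w in 𝓝 (f 0), ContDiffAt ℂ ω K w := by
      rw [hf0z]; exact hKz.eventually (by simp)
    have e2 : ∀ᶠ w in 𝓝 (f 0, z), ContDiffAt ℂ ω (mulChart E G) w := by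
      rw [hf0z]; exact contDiffAt_mulChart.eventually (by simp)
    have c2 : ContinuousAt (fun x => (f x, z)) 0 := hfc.prodMk continuousAt_const
    filter_upwards [hfc.eventually e1, c2.eventually e2, hsrc] with x a b c using ⟨a, b, c⟩
  obtain ⟨W, hWg, hWo, h0W⟩ := eventually_nhds_iff.1 hgood
  have hder : ∀ x ∈ W, HasFDerivAt f (K (f x)) x := by
    intro x hx
    obtain ⟨-, hm, hxs⟩ := hWg x hx
    have h1 : HasFDerivAt (fun u => mulChart E G (f x, u)) (K (f x)) z := by
      have : DifferentiableAt ℂ (mulChart E G) (f x, z) := hm.differentiableAt (by simp)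
      exact (this.comp z ((differentiableAt_const _).prodMk differentiableAt_id)).hasFDerivAt
    have h2 : HasFDerivAt (fun y => f (y - x)) (ContinuousLinearMap.id ℂ E) x := by
      have h1 : HasFDerivAt (fun y => y - x) (ContinuousLinearMap.id ℂ E) x :=
        (hasFDerivAt_id x).sub_const x
      have := HasFDerivAt.comp x (g := f) (by rwa [sub_self]) h1
      exact this.congr_fderiv (by simp)
    have h3 : HasFDerivAt (fun y => mulChart E G (f x, f (y - x))) (K (f x)) x := by
      have := HasFDerivAt.comp x (g := fun u => mulChart E G (f x, u)) (f := fun y => f (y - x))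
        (by simpa [hf0z] using h1) h2
      exact this.congr_fderiv (by simp)
    refine h3.congr_of_eventuallyEq ?_
    have : Filter.Tendsto (fun y => y - x) (𝓝 x) (𝓝 0) := by
      have : ContinuousAt (fun y => y - x) x := by fun_prop
      simpa [ContinuousAt] using this
    filter_upwards [this.eventually hsrc] with y hy
    change φ (π y) = φ (φ.symm (φ (π x)) * φ.symm (φ (π (y - x))))
    rw [φ.left_inv hxs, φ.left_inv hy, ← hadd, add_sub_cancel]
  -- Bootstrap: as `K` is analytic near the values in question, `f' = K ∘ f` raises the
  -- differentiability class of `f` by one each time.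
  have hsmooth : ∀ n : ℕ, ContDiffOn ℂ n f W := by
    intro n
    induction n with
    | zero =>
      exact contDiffOn_zero.2 fun x hx => (hder x hx).continuousAt.continuousWithinAt
    | succ n ih =>
      push_cast
      rw [contDiffOn_succ_iff_fderiv_of_isOpen hWo]
      refine ⟨fun x hx => (hder x hx).differentiableAt.differentiableWithinAt,
        fun h => by simp at h, ?_⟩
      have : ContDiffOn ℂ n (fun x => K (f x)) W := fun x hx =>
        ((hWg x hx).1.of_le le_top).comp_contDiffWithinAt x (ih x hx)
      exact this.congr fun x hx => (hder x hx).fderiv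
  have hat0 : ContMDiffAt 𝓘(ℂ, E) 𝓘(ℂ, E) ∞ π 0 := by
    refine contMDiffAt_iff.2 ⟨hc.continuousAt, ?_⟩
    have : ContDiffAt ℂ ∞ f 0 :=
      (contDiffOn_infty.2 hsmooth).contDiffAt (hWo.mem_nhds h0W)
    simp only [hπ0]
    exact this.contDiffWithinAt
  intro x
  have e : π = fun y => π x * π (y - x) := by
    ext y; simp [← hadd]
  rw [e]
  have h1 : ContMDiffAt 𝓘(ℂ, E) 𝓘(ℂ, E) ∞ (fun y => π (y - x)) x := by
    refine ContMDiffAt.comp x (g := π) (f := fun y => y - x) (by simpa using hat0) ?_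
    exact (contDiff_id.sub contDiff_const).contMDiff.contMDiffAt
  exact contMDiffAt_const.mul h1

variable [CompleteSpace E]

/-- The inverse function theorem for homomorphisms from `E` at `0`. -/
theorem isLocalDiffeomorphAt_zero (hadd : ∀ x y, π (x + y) = π x * π y)
    (h0 : HasMD ℂ π 0 (ContinuousLinearMap.id ℂ E)) :
    IsLocalDiffeomorphAt 𝓘(ℂ, E) 𝓘(ℂ, E) ∞ π 0 := by
  have hLi : LieGroup 𝓘(ℂ, E) ∞ G := .of_le le_top
  have hsm := contMDiff_of_map_add hadd h0
  have hπ0 := map_zero_of_map_add hadd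
  set φ := chartAt E (1 : G)
  set f : E → E := fun x => φ (π x)
  have hf0 : HasFDerivAt f ((ContinuousLinearEquiv.refl ℂ E : E ≃L[ℂ] E) : E →L[ℂ] E) 0 := by
    have := (HasMD.iff.1 h0).2
    rw [writtenInExtChartAt, hπ0] at this
    exact this
  set U := π ⁻¹' φ.source
  have hUo : IsOpen U := φ.open_source.preimage hsm.continuous
  have h0U : (0 : E) ∈ U := by
    change π 0 ∈ φ.source
    rw [hπ0]; exact mem_chart_source E 1
  have hfU : ContDiffOn ℂ ∞ f U := by
    rw [← contMDiffOn_iff_contDiffOn]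
    exact (contMDiffOn_chart (I := 𝓘(ℂ, E)) (n := ∞) (x := (1 : G))).comp hsm.contMDiffOn
      (fun x hx => hx)
  have hfd : ContinuousAt (fderiv ℂ f) 0 :=
    ((hfU.continuousOn_fderiv_of_isOpen hUo (by simp)) 0 h0U).continuousAt (hUo.mem_nhds h0U)
  -- The inverse has to be smooth on its whole target, so the source is cut down to points where the
  -- derivative is still invertible, an open condition.
  have hinv : ∀ᶠ x in 𝓝 (0 : E), ∃ A : E ≃L[ℂ] E, (A : E →L[ℂ] E) = fderiv ℂ f x := by
    have := ContinuousLinearEquiv.nhds (ContinuousLinearEquiv.refl ℂ E)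
    rw [← hf0.fderiv] at this
    exact hfd.eventually this
  obtain ⟨W, hW, hWo, h0W⟩ := eventually_nhds_iff.1 (hinv.and (hUo.mem_nhds h0U))
  have hf0' : ContDiffAt ℂ ∞ f 0 := hfU.contDiffAt (hUo.mem_nhds h0U)
  let g := (hf0'.toOpenPartialHomeomorph f hf0 (by simp)).restrOpen W hWo
  have hg : ∀ x, g x = f x := fun x => rfl
  let e := g.trans φ.symm
  have hes : ∀ x ∈ e.source, x ∈ W := by
    intro x hx
    have : x ∈ g.source := by
      rw [OpenPartialHomeomorph.trans_source] at hx; exact hx.1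
    rw [OpenPartialHomeomorph.restrOpen_source] at this
    exact this.2
  have heq : ∀ x ∈ e.source, π x = e x := by
    intro x hx
    change π x = φ.symm (φ (π x))
    rw [φ.left_inv (hW x (hes x hx)).2]
  have het : ∀ y ∈ e.target, y ∈ φ.source ∧ φ y ∈ g.target := by
    intro y hy
    rw [OpenPartialHomeomorph.trans_target] at hy
    exact hy
  refine ⟨{ toPartialEquiv := e.toPartialEquiv
            open_source := e.open_source
            open_target := e.open_target
            contMDiffOn_toFun := hsm.contMDiffOn.congr fun x hx => (heq x hx).symm
            contMDiffOn_invFun := ?_ }, ?_, heq⟩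
  · have h1 : ContMDiffOn 𝓘(ℂ, E) 𝓘(ℂ, E) ∞ g.symm g.target := by
      rw [contMDiffOn_iff_contDiffOn]
      intro y hy
      have hx : g.symm y ∈ W := by
        have := g.map_target hy
        rw [OpenPartialHomeomorph.restrOpen_source] at this
        exact this.2
      obtain ⟨⟨A, hA⟩, hU⟩ := hW _ hx
      have hd : ContDiffAt ℂ ∞ f (g.symm y) := hfU.contDiffAt (hUo.mem_nhds hU)
      refine (g.contDiffAt_symm (f₀' := A) hy ?_ hd).contDiffWithinAt
      rw [hA]
      exact (hd.differentiableAt (by simp)).hasFDerivAt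
    exact h1.comp ((contMDiffOn_chart (I := 𝓘(ℂ, E)) (n := ∞) (x := (1 : G))).mono
      fun y hy => (het y hy).1) fun y hy => (het y hy).2
  · change (0 : E) ∈ e.source
    rw [OpenPartialHomeomorph.trans_source]
    refine ⟨?_, ?_⟩
    · rw [OpenPartialHomeomorph.restrOpen_source]
      exact ⟨hf0'.mem_toOpenPartialHomeomorph_source hf0 (by simp), h0W⟩
    · change f 0 ∈ φ.symm.source
      exact φ.map_source h0U

theorem isLocalDiffeomorph_of_map_add (hadd : ∀ x y, π (x + y) = π x * π y)
    (h0 : HasMD ℂ π 0 (ContinuousLinearMap.id ℂ E)) :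
    IsLocalDiffeomorph 𝓘(ℂ, E) 𝓘(ℂ, E) ∞ π := by
  have hLi : LieGroup 𝓘(ℂ, E) ∞ G := .of_le le_top
  intro x
  let τ : E ≃ₘ^∞⟮𝓘(ℂ, E), 𝓘(ℂ, E)⟯ E :=
    { toEquiv := Equiv.subRight x
      contMDiff_toFun := (contDiff_id.sub contDiff_const).contMDiff
      contMDiff_invFun := (contDiff_id.add contDiff_const).contMDiff }
  let σ : G ≃ₘ^∞⟮𝓘(ℂ, E), 𝓘(ℂ, E)⟯ G :=
    { toEquiv := Equiv.mulLeft (π x)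
      contMDiff_toFun := contMDiff_mul_left
      contMDiff_invFun := contMDiff_mul_left }
  have h1 : IsLocalDiffeomorphAt 𝓘(ℂ, E) 𝓘(ℂ, E) ∞ π (τ x) := by
    have : τ x = 0 := sub_self x
    rw [this]
    exact isLocalDiffeomorphAt_zero hadd h0
  have h2 := ((τ.isLocalDiffeomorph x).comp 𝓘(ℂ, E) G h1).comp 𝓘(ℂ, E) G (σ.isLocalDiffeomorph _)
  have e : π = σ ∘ π ∘ τ := by
    ext y
    change π y = π x * π (y - x)
    rw [← hadd, add_sub_cancel]
  rw [e]
  exact h2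

/-- For surjectivity: the image is an open subgroup, as `π` is a local diffeomorphism, so it is also
closed, and `G` is connected. -/
theorem isExpMap_of_map_add [ConnectedSpace G] (hadd : ∀ x y, π (x + y) = π x * π y)
    (h0 : HasMD ℂ π 0 (ContinuousLinearMap.id ℂ E)) : IsExpMap π where
  map_add := hadd
  contMDiff := contMDiff_of_map_add hadd h0
  hasMD_zero := h0
  surjective := by
    have : IsTopologicalGroup G := topologicalGroup_of_lieGroup 𝓘(ℂ, E) ω
    let f : Multiplicative E →* G :=
      { toFun := fun x => π x.toAdd
        map_one' := map_zero_of_map_add hadd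
        map_mul' := fun x y => hadd _ _ }
    have ho : IsOpen (f.range : Set G) :=
      (isLocalDiffeomorph_of_map_add hadd h0).isOpen_range
    have := IsClopen.eq_univ (s := (f.range : Set G)) ⟨f.range.isClosed_of_isOpen ho, ho⟩
      ⟨1, f.range.one_mem⟩
    intro y
    have hy : y ∈ (f.range : Set G) := this ▸ mem_univ y
    exact hy

end Exponential

/-- A connected complex Lie group with only constant holomorphic functions has an exponential
map. -/
theorem exists_isExpMap {E : Type} [NormedAddCommGroup E] [NormedSpace ℂ E]
    [FiniteDimensional ℂ E] {G : Type} [Group G] [TopologicalSpace G] [ChartedSpace E G]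
    [LieGroup 𝓘(ℂ, E) ω G] [ConnectedSpace G] (h : OnlyConstantFunctions E G) :
    ∃ π : E → G, IsExpMap π := by
  have : CompleteSpace E := FiniteDimensional.complete ℂ E
  obtain ⟨π, hadd, h0⟩ := exists_hom_hasMD_id (E := E) (mul_comm_of_onlyConstantFunctions h)
  exact ⟨π, isExpMap_of_map_add hadd h0⟩

/-! ### The induced form on a real subspace -/

section HermitianLinearAlgebra

variable {T : Type} [AddCommGroup T] [Module ℂ T] {h : HermitianForm T} {V : Submodule ℝ T}

theorem HermitianForm.re_comm (h : HermitianForm T) (v w : T) : h.re v w = h.re w v := by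
  rw [h.re_apply, h.re_apply, ← h.conj_symm v w, Complex.conj_re]

theorem HermitianForm.re_I_left (h : HermitianForm T) (v w : T) :
    h.re (Complex.I • v) w = - h.re v (Complex.I • w) := by
  simp [h.re_apply]

theorem HermitianForm.re_self_nonneg (h : HermitianForm T) (v : T) : 0 ≤ h.re v v := by
  by_cases hv : v = 0
  · simp [hv]
  · exact (h.pos v hv).le

theorem HermitianForm.eq_zero_of_re_self (h : HermitianForm T) {v : T} (hv : h.re v v = 0) :
    v = 0 := by
  by_contra hne
  exact (h.pos v hne).ne' hv

theorem cocomplexPart_le : cocomplexPart h V ≤ V := fun _ hv => hv.1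

theorem I_smul_mem_complexPart {v : T} (hv : v ∈ complexPart V) :
    Complex.I • v ∈ complexPart V :=
  ⟨hv.2, by rw [smul_smul, Complex.I_mul_I, neg_one_smul]; exact V.neg_mem hv.1⟩

theorem mem_cocomplexPart {v : T} :
    v ∈ cocomplexPart h V ↔ v ∈ V ∧ ∀ p ∈ complexPart V, h.re p v = 0 :=
  Iff.rfl

theorem exists_complexPart_add_cocomplexPart [FiniteDimensional ℂ T] (h : HermitianForm T)
    {v : T} (hv : v ∈ V) : ∃ p ∈ complexPart V, ∃ f ∈ cocomplexPart h V, v = p + f := by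
  obtain ⟨p, hp, f, hf, e⟩ := Submodule.mem_sup.1
    ((isCompl_orthogonal h (complexPart V)).sup_eq_top.ge (Submodule.mem_top (x := v)))
  refine ⟨p, hp, f, ⟨?_, hf⟩, e.symm⟩
  have : f = v - p := by rw [← e]; abel
  rw [this]
  exact V.sub_mem hv hp.1

variable [FiniteDimensional ℂ T]

variable (h V) in
/-- The induced form as a bilinear form. -/
def inducedBilin : LinearMap.BilinForm ℝ T :=
  h.re - (2 : ℝ) • h.re.compl₁₂ (orthProj h (complexPart V)) (orthProj h (complexPart V))

theorem inducedBilin_apply (v w : T) : inducedBilin h V v w = inducedForm h V v w := by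
  simp [inducedBilin, inducedForm]

theorem inducedBilin_comm (v w : T) : inducedBilin h V v w = inducedBilin h V w v := by
  simp only [inducedBilin_apply, inducedForm]
  rw [h.re_comm v w, h.re_comm (orthProj h (complexPart V) v)]

theorem inducedBilin_add_add {p p' f f' : T} (hp : p ∈ complexPart V) (hp' : p' ∈ complexPart V)
    (hf : f ∈ cocomplexPart h V) (hf' : f' ∈ cocomplexPart h V) :
    inducedBilin h V (p + f) (p' + f') = h.re f f' - h.re p p' := by
  have e1 : inducedBilin h V p p' = - h.re p p' := by
    rw [inducedBilin_apply, inducedForm_complexPart h V p p' hp hp']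
  have e2 : inducedBilin h V p f' = 0 := by
    rw [inducedBilin_apply, inducedForm_cocomplexPart h V p f' hf']
    exact hf'.2 p hp
  have e3 : inducedBilin h V f p' = 0 := by
    rw [inducedBilin_comm, inducedBilin_apply, inducedForm_cocomplexPart h V p' f hf]
    exact hf.2 p' hp'
  have e4 : inducedBilin h V f f' = h.re f f' := by
    rw [inducedBilin_apply, inducedForm_cocomplexPart h V f f' hf']
  simp only [map_add, LinearMap.add_apply, e1, e2, e3, e4]
  ring

/-- Test `v = p + f` against `-p + f`: the sign change on the complex part undoes the sign in the
induced form and leaves `Re h(p, p) + Re h(f, f)`. -/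
theorem inducedBilin_nondegenerate {v : T} (hv : v ∈ V)
    (h0 : ∀ w ∈ V, inducedBilin h V v w = 0) : v = 0 := by
  obtain ⟨p, hp, f, hf, rfl⟩ := exists_complexPart_add_cocomplexPart h hv
  have := h0 (-p + f) (V.add_mem (V.neg_mem hp.1) hf.1)
  rw [inducedBilin_add_add hp (Submodule.neg_mem _ hp) hf hf] at this
  simp only [map_neg, sub_neg_eq_add] at this
  have hp0 := h.re_self_nonneg p
  have hf0 := h.re_self_nonneg f
  rw [h.eq_zero_of_re_self (v := p) (by linarith), h.eq_zero_of_re_self (v := f) (by linarith),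
    add_zero]

end HermitianLinearAlgebra

/-! ### Transport of the CR Hermitian structure along isometries -/

section Transport

variable {T T' : Type} [AddCommGroup T] [Module ℂ T] [AddCommGroup T'] [Module ℂ T']
  {h : HermitianForm T} {h' : HermitianForm T'} {V : Submodule ℝ T} {V' : Submodule ℝ T'}

theorem mem_complexPart_iff_of_injective {S : T →ₗ[ℂ] T'} (hS : Function.Injective S)
    (hV : ∀ v, v ∈ V' ↔ ∃ u ∈ V, S u = v) {v : T'} :
    v ∈ complexPart V' ↔ ∃ u ∈ complexPart V, S u = v := by
  constructor
  · rintro ⟨h1, h2⟩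
    obtain ⟨u, hu, rfl⟩ := (hV v).1 h1
    obtain ⟨w, hw, e⟩ := (hV _).1 h2
    refine ⟨u, ⟨hu, ?_⟩, rfl⟩
    rw [← map_smul] at e
    rwa [← hS e]
  · rintro ⟨u, hu, rfl⟩
    exact ⟨(hV _).2 ⟨u, hu.1, rfl⟩, (hV _).2 ⟨_, hu.2, map_smul _ _ _⟩⟩

theorem mem_cocomplexPart_iff_of_isometry {S : T →ₗ[ℂ] T'} (hS : Function.Injective S)
    (hh : ∀ v w, h'.form (S v) (S w) = h.form v w)
    (hV : ∀ v, v ∈ V' ↔ ∃ u ∈ V, S u = v) {v : T'} :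
    v ∈ cocomplexPart h' V' ↔ ∃ u ∈ cocomplexPart h V, S u = v := by
  have hre : ∀ v w, h'.re (S v) (S w) = h.re v w := fun v w => by
    rw [h'.re_apply, hh, h.re_apply]
  constructor
  · intro hv
    obtain ⟨u, hu, rfl⟩ := (hV v).1 hv.1
    refine ⟨u, ⟨hu, fun p hp => ?_⟩, rfl⟩
    have := hv.2 (S p) ((mem_complexPart_iff_of_injective hS hV).2 ⟨p, hp, rfl⟩)
    rwa [hre] at this
  · rintro ⟨u, hu, rfl⟩
    refine ⟨(hV _).2 ⟨u, hu.1, rfl⟩, fun p hp => ?_⟩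
    obtain ⟨w, hw, rfl⟩ := (mem_complexPart_iff_of_injective hS hV).1 hp
    rw [hre]
    exact hu.2 w hw

theorem inducedForm_eq_of_isometry [FiniteDimensional ℂ T] [FiniteDimensional ℂ T']
    {S : T →ₗ[ℂ] T'} (hS : Function.Injective S)
    (hh : ∀ v w, h'.form (S v) (S w) = h.form v w)
    (hV : ∀ v, v ∈ V' ↔ ∃ u ∈ V, S u = v) {v w : T} (hv : v ∈ V) (hw : w ∈ V) :
    inducedForm h' V' (S v) (S w) = inducedForm h V v w := by
  have hre : ∀ v w, h'.re (S v) (S w) = h.re v w := fun v w => by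
    rw [h'.re_apply, hh, h.re_apply]
  obtain ⟨p, hp, f, hf, rfl⟩ := exists_complexPart_add_cocomplexPart h hv
  obtain ⟨p', hp', f', hf', rfl⟩ := exists_complexPart_add_cocomplexPart h hw
  rw [← inducedBilin_apply, ← inducedBilin_apply, map_add S, map_add S,
    inducedBilin_add_add hp hp' hf hf',
    inducedBilin_add_add ((mem_complexPart_iff_of_injective hS hV).2 ⟨p, hp, rfl⟩)
      ((mem_complexPart_iff_of_injective hS hV).2 ⟨p', hp', rfl⟩)
      ((mem_cocomplexPart_iff_of_isometry hS hh hV).2 ⟨f, hf, rfl⟩)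
      ((mem_cocomplexPart_iff_of_isometry hS hh hV).2 ⟨f', hf', rfl⟩), hre, hre]

end Transport

/-! ### Periods, covering property and left invariant frame -/

namespace IsExpMap

open Set Topology

variable {E : Type} [NormedAddCommGroup E] [NormedSpace ℂ E] [FiniteDimensional ℂ E]
  {G : Type} [Group G] [TopologicalSpace G] [ChartedSpace E G] [LieGroup 𝓘(ℂ, E) ω G]
  {π : E → G}

theorem map_zero (hπ : IsExpMap π) : π 0 = 1 := map_zero_of_map_add hπ.map_add

theorem map_neg (hπ : IsExpMap π) (x : E) : π (-x) = (π x)⁻¹ := by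
  rw [eq_inv_iff_mul_eq_one, ← hπ.map_add, neg_add_cancel, hπ.map_zero]

theorem map_sub (hπ : IsExpMap π) (x y : E) : π (x - y) = π x * (π y)⁻¹ := by
  rw [sub_eq_add_neg, hπ.map_add, hπ.map_neg]

theorem map_nsmul (hπ : IsExpMap π) (n : ℕ) (x : E) : π (n • x) = π x ^ n := by
  induction n with
  | zero => simp [hπ.map_zero]
  | succ n ih => rw [succ_nsmul, hπ.map_add, ih, pow_succ]

theorem continuous (hπ : IsExpMap π) : Continuous π := hπ.contMDiff.continuous

theorem mul_comm (hπ : IsExpMap π) (x y : G) : x * y = y * x := by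
  obtain ⟨u, rfl⟩ := hπ.surjective x
  obtain ⟨v, rfl⟩ := hπ.surjective y
  rw [← hπ.map_add, ← hπ.map_add, add_comm]

/-- The period group, the kernel of the exponential map. -/
def ker (hπ : IsExpMap π) : AddSubgroup E where
  carrier := {x | π x = 1}
  add_mem' := fun {a b} ha hb => by
    change π (a + b) = 1
    rw [hπ.map_add, ha, hb, one_mul]
  zero_mem' := hπ.map_zero
  neg_mem' := fun {a} ha => by
    change π (-a) = 1
    rw [hπ.map_neg, ha, inv_one]

theorem mem_ker (hπ : IsExpMap π) {x : E} : x ∈ hπ.ker ↔ π x = 1 := Iff.rfl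

theorem eq_iff_sub_mem_ker (hπ : IsExpMap π) {x y : E} : π x = π y ↔ x - y ∈ hπ.ker := by
  rw [hπ.mem_ker, hπ.map_sub, mul_inv_eq_one]

/-- The real span of the period group. -/
def span (hπ : IsExpMap π) : Submodule ℝ E := Submodule.span ℝ (hπ.ker : Set E)

theorem mem_span_of_mem_ker (hπ : IsExpMap π) {x : E} (hx : x ∈ hπ.ker) : x ∈ hπ.span :=
  Submodule.subset_span hx

theorem isLocalDiffeomorph (hπ : IsExpMap π) : IsLocalDiffeomorph 𝓘(ℂ, E) 𝓘(ℂ, E) ∞ π :=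
  have : CompleteSpace E := FiniteDimensional.complete ℂ E
  isLocalDiffeomorph_of_map_add hπ.map_add hπ.hasMD_zero

theorem exists_localInverse (hπ : IsExpMap π) (x : E) : ∃ σ : G → E,
    (∀ᶠ y in 𝓝 (π x), π (σ y) = y) ∧ (∀ᶠ u in 𝓝 x, σ (π u) = u) ∧
      ∀ᶠ y in 𝓝 (π x), ContMDiffAt 𝓘(ℂ, E) 𝓘(ℂ, E) ∞ σ y := by
  obtain ⟨Φ, hx, he⟩ := hπ.isLocalDiffeomorph x
  have hmaps : ∀ u ∈ Φ.source, π u ∈ Φ.target := fun u hu => by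
    rw [he hu]; exact Φ.map_source' hu
  refine ⟨Φ.symm, ?_, ?_, ?_⟩
  · filter_upwards [Φ.open_target.mem_nhds (hmaps x hx)] with y hy
    have h1 : Φ.invFun y ∈ Φ.source := Φ.map_target' hy
    change π (Φ.invFun y) = y
    rw [he h1]
    exact Φ.right_inv' hy
  · filter_upwards [Φ.open_source.mem_nhds hx] with u hu
    rw [he hu]
    exact Φ.left_inv' hu
  · filter_upwards [Φ.open_target.mem_nhds (hmaps x hx)] with y hy
    exact Φ.contMDiffOn_invFun.contMDiffAt (Φ.open_target.mem_nhds hy)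

theorem isOpenQuotientMap (hπ : IsExpMap π) : IsOpenQuotientMap π :=
  ⟨hπ.surjective, hπ.continuous, hπ.isLocalDiffeomorph.isOpenMap⟩

/-- A period `u` near `0` satisfies `u = σ (π u) = σ (π 0) = 0` for a local inverse `σ`. -/
theorem isDiscrete_ker (hπ : IsExpMap π) : IsDiscrete (hπ.ker : Set E) := by
  obtain ⟨σ, -, h2, -⟩ := hπ.exists_localInverse 0
  rw [isDiscrete_iff_discreteTopology]
  refine (discreteTopology_iff_isOpen_singleton_zero (G := hπ.ker)).2 ?_
  have h3 : ∀ᶠ u : hπ.ker in 𝓝 0, σ (π (u : E)) = u :=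
    (continuous_subtype_val.tendsto (0 : hπ.ker)).eventually h2
  refine (isOpen_singleton_iff_nhds_eq_pure _).2 (le_antisymm ?_ (pure_le_nhds _))
  rw [Filter.le_pure_iff]
  filter_upwards [h3] with u hu
  have e0 : σ (π 0) = 0 := h2.self_of_nhds
  rw [show π (u : E) = π 0 from u.2.trans hπ.map_zero.symm, e0] at hu
  exact Subtype.ext hu.symm

theorem isCoveringMap (hπ : IsExpMap π) : IsCoveringMap π := by
  let f : Multiplicative E →* G :=
    { toFun := fun x => π x.toAdd
      map_one' := hπ.map_zero
      map_mul' := fun x y => hπ.map_add _ _ }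
  have hf : IsQuotientMap f := hπ.isOpenQuotientMap.isQuotientMap
  have := hf.isQuotientCoveringMap_of_isDiscrete_ker_monoidHom hπ.isDiscrete_ker
  exact this.isCoveringMap

/-- A continuous map from a connected space to the period group is constant. -/
theorem eq_of_forall_mem_ker (hπ : IsExpMap π) {A : Type} [TopologicalSpace A]
    [PreconnectedSpace A] {f : A → E} (hf : Continuous f) (h : ∀ a, f a ∈ hπ.ker) (a b : A) :
    f a = f b := by
  have : DiscreteTopology hπ.ker := isDiscrete_iff_discreteTopology.1 hπ.isDiscrete_ker
  have h1 := PreconnectedSpace.constant (Y := hπ.ker) ‹_›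
    (f := fun a => ⟨f a, h a⟩) (hf.subtype_mk h) (x := a) (y := b)
  exact congrArg Subtype.val h1

/-- Smooth maps from a real vector space to `G` lift to smooth maps to `E`. -/
theorem exists_lift (hπ : IsExpMap π) {A : Type} [NormedAddCommGroup A] [NormedSpace ℝ A]
    {c : A → G} (hc : ContMDiff 𝓘(ℝ, A) 𝓘(ℝ, E) ∞ c) {a₀ : A} {e₀ : E} (h0 : π e₀ = c a₀) :
    ∃ u : A → E, ContDiff ℝ ∞ u ∧ (∀ a, π (u a) = c a) ∧ u a₀ = e₀ := by
  obtain ⟨u, ⟨hu0, hu⟩, -⟩ := hπ.isCoveringMap.existsUnique_continuousMap_lifts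
    ⟨c, hc.continuous⟩ a₀ e₀ h0
  have hu' : ∀ a, π (u a) = c a := fun a => congrFun hu a
  refine ⟨u, ?_, hu', hu0⟩
  rw [← contMDiff_iff_contDiff]
  intro a
  obtain ⟨σ, -, h2, h3⟩ := hπ.exists_localInverse (u a)
  have hs : ContMDiffAt 𝓘(ℝ, E) 𝓘(ℝ, E) ∞ σ (c a) := by
    have := h3.self_of_nhds
    rw [hu'] at this
    exact ⟨this.1, ContDiffWithinAt.restrict_scalars ℝ this.2⟩
  refine (hs.comp a (hc a)).congr_of_eventuallyEq ?_
  filter_upwards [u.continuous.continuousAt.eventually h2] with b hb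
  rw [Function.comp_apply, ← hu', hb]

theorem contMDiff_comp (hπ : IsExpMap π) {A : Type} [NormedAddCommGroup A] [NormedSpace ℝ A]
    {u : A → E} (hu : ContDiff ℝ ∞ u) : ContMDiff 𝓘(ℝ, A) 𝓘(ℝ, E) ∞ (fun a => π (u a)) :=
  (ContMDiff.restrictScalars hπ.contMDiff).comp hu.contMDiff

variable (E) in
/-- The left invariant frame: the derivative at `1` of the left translation by `g`. -/
def frame (g : G) : E →L[ℂ] E := mfderiv 𝓘(ℂ, E) 𝓘(ℂ, E) (fun y => g * y) 1

theorem hasMD_frame (g : G) : HasMD ℂ (fun y => g * y) 1 (frame E g) := by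
  have hL : LieGroup 𝓘(ℂ, E) 1 G := .of_le le_top
  obtain ⟨S, hS⟩ := HasMD.mul_left (𝕜 := ℂ) (F := E) g 1
  have : frame E g = S := hS.mfderiv_eq
  rwa [this]

theorem hasMD (hπ : IsExpMap π) (x : E) : HasMD ℂ π x (frame E (π x)) :=
  hasMD_of_map_add hπ.map_add hπ.hasMD_zero x (hasMD_frame _)

theorem frame_injective (g : G) : Function.Injective (frame E g) := by
  have hL : LieGroup 𝓘(ℂ, E) 1 G := .of_le le_top
  obtain ⟨S, hS⟩ := HasMD.mul_left (𝕜 := ℂ) (F := E) g⁻¹ g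
  have h1 := hS.comp (hasMD_frame g) (by simp)
  simp only [inv_mul_cancel_left] at h1
  have h2 := h1.unique (HasMD.id ℂ (1 : G))
  intro v w hvw
  have h3 := congrArg (fun A : E →L[ℂ] E => A v) h2
  have h4 := congrArg (fun A : E →L[ℂ] E => A w) h2
  simp only [ContinuousLinearMap.comp_apply, ContinuousLinearMap.id_apply] at h3 h4
  rw [← h3, ← h4, hvw]

theorem velocity_comp (hπ : IsExpMap π) {u : ℝ → E} {t : ℝ} (hu : DifferentiableAt ℝ u t) :
    (velocity (E := E) (fun t => π (u t)) t : E) = frame E (π (u t)) (deriv u t) := by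
  have h1 := (hπ.hasMD (u t)).restrictScalars.comp hu.hasDerivAt.hasFDerivAt.hasMD rfl
  have h2 := congrArg (fun A : ℝ →L[ℝ] E => A 1) h1.mfderiv_eq
  refine Eq.trans h2 ?_
  simp
  rfl

end IsExpMap

/-! ### The maximal compact subgroup and its induced metric -/

namespace IsExpMap

open Set Topology

variable {E : Type} [NormedAddCommGroup E] [NormedSpace ℂ E] [FiniteDimensional ℂ E]
  {G : Type} [Group G] [TopologicalSpace G] [ChartedSpace E G] [LieGroup 𝓘(ℂ, E) ω G]
  {π : E → G}

/-- `C` is the closed parallelepiped on a real basis of the span chosen inside `Λ`; the integer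
parts of the coordinates give the element of `Λ` to subtract. It makes the image of the span in `G`
compact. -/
theorem exists_compact_span (Λ : AddSubgroup E) : ∃ C : Set E, IsCompact C ∧
    C ⊆ Submodule.span ℝ (Λ : Set E) ∧
    ∀ v ∈ Submodule.span ℝ (Λ : Set E), ∃ w ∈ C, v - w ∈ Λ := by
  have : FiniteDimensional ℝ E := FiniteDimensional.complexToReal E
  obtain ⟨b, hb, hspan, hlin⟩ := exists_linearIndependent ℝ (Λ : Set E)
  have : Fintype b := hlin.setFinite.fintype
  let F : (b → ℝ) → E := fun t => ∑ i, t i • (i : E)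
  have hF : Continuous F := by fun_prop
  refine ⟨F '' Icc 0 1, isCompact_Icc.image hF, ?_, fun v hv => ?_⟩
  · rintro _ ⟨t, -, rfl⟩
    exact Submodule.sum_mem _ fun i _ =>
      Submodule.smul_mem _ _ (Submodule.subset_span (hb i.2))
  · rw [← hspan] at hv
    have hv' : v ∈ Submodule.span ℝ (range ((↑) : b → E)) := by simpa using hv
    obtain ⟨t, rfl⟩ := (Submodule.mem_span_range_iff_exists_fun ℝ).1 hv'
    refine ⟨F fun i => Int.fract (t i), ⟨_, ⟨fun i => Int.fract_nonneg _,
      fun i => (Int.fract_lt_one _).le⟩, rfl⟩, ?_⟩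
    rw [← Finset.sum_sub_distrib]
    refine Λ.sum_mem fun i _ => ?_
    rw [← sub_smul, Int.self_sub_fract, Int.cast_smul_eq_zsmul]
    exact Λ.zsmul_mem (hb i.2) _

/-- The image of the span is compact, being the image of a parallelepiped. Conversely, if `x` lies
outside the span, a real functional vanishing on the span but not at `x` descends to a continuous
function `χ` on `G`; on powers of `π x` it grows linearly, so `π x` lies in no compact subgroup. -/
theorem maxCompact_eq (hπ : IsExpMap π) : (maxCompact G : Set G) = π '' hπ.span := by
  have : FiniteDimensional ℝ E := FiniteDimensional.complexToReal E
  apply Subset.antisymm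
  · let W : Subgroup G :=
      { carrier := π '' hπ.span
        mul_mem' := by
          rintro _ _ ⟨x, hx, rfl⟩ ⟨y, hy, rfl⟩
          exact ⟨x + y, hπ.span.add_mem hx hy, hπ.map_add x y⟩
        one_mem' := ⟨0, hπ.span.zero_mem, hπ.map_zero⟩
        inv_mem' := by
          rintro _ ⟨x, hx, rfl⟩
          exact ⟨-x, hπ.span.neg_mem hx, hπ.map_neg x⟩ }
    suffices maxCompact G ≤ W from this
    refine sSup_le fun K hK => ?_
    intro k hk
    obtain ⟨x, rfl⟩ := hπ.surjective k
    refine ⟨x, ?_, rfl⟩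
    by_contra hx
    obtain ⟨l, hlx, hl⟩ := Submodule.exists_dual_map_eq_bot_of_notMem hx inferInstance
    have hl' : ∀ v ∈ hπ.span, l v = 0 := fun v hv => by
      have : l v ∈ hπ.span.map l := ⟨v, hv, rfl⟩
      rw [hl] at this
      exact this
    let L : E →L[ℝ] ℝ := l.toContinuousLinearMap
    have hL : ∀ u v, π u = π v → L u = L v := fun u v huv => by
      have := hl' _ (hπ.mem_span_of_mem_ker (hπ.eq_iff_sub_mem_ker.1 huv))
      rw [_root_.map_sub, sub_eq_zero] at this
      exact this
    choose s hs using hπ.surjective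
    let χ : G → ℝ := fun g => L (s g)
    have hχ : ∀ u, χ (π u) = L u := fun u => hL _ _ (hs _)
    have hχc : Continuous χ := hπ.isOpenQuotientMap.isQuotientMap.continuous_iff.2
      (L.continuous.congr fun u => (hχ u).symm)
    have hbdd := (IsCompact.image (hK : IsCompact (K : Set G)) hχc).isBounded
    obtain ⟨R, hR⟩ := hbdd.exists_norm_le
    obtain ⟨n, hn⟩ := exists_nat_gt (R / |L x|)
    have h1 : ‖χ (π x ^ n)‖ ≤ R := hR _ ⟨_, K.pow_mem hk n, rfl⟩
    rw [← hπ.map_nsmul, hχ, _root_.map_nsmul, nsmul_eq_mul, norm_mul, Real.norm_natCast,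
      Real.norm_eq_abs] at h1
    have h2 : 0 < |L x| := abs_pos.2 hlx
    rw [div_lt_iff₀ h2] at hn
    linarith
  · obtain ⟨C, hC, hCs, hC'⟩ := exists_compact_span hπ.ker
    have hcompact : IsCompact (π '' hπ.span) := by
      have : π '' hπ.span = π '' C := by
        refine Subset.antisymm ?_ (image_mono hCs)
        rintro _ ⟨v, hv, rfl⟩
        obtain ⟨w, hw, hvw⟩ := hC' v hv
        exact ⟨w, hw, (hπ.eq_iff_sub_mem_ker.2 hvw).symm⟩
      rw [this]
      exact hC.image hπ.continuous
    let W : Subgroup G :=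
      { carrier := π '' hπ.span
        mul_mem' := by
          rintro _ _ ⟨x, hx, rfl⟩ ⟨y, hy, rfl⟩
          exact ⟨x + y, hπ.span.add_mem hx hy, hπ.map_add x y⟩
        one_mem' := ⟨0, hπ.span.zero_mem, hπ.map_zero⟩
        inv_mem' := by
          rintro _ ⟨x, hx, rfl⟩
          exact ⟨-x, hπ.span.neg_mem hx, hπ.map_neg x⟩ }
    have : W ≤ maxCompact G := le_sSup (show IsCompact (W : Set G) from hcompact)
    exact this

theorem mem_maxCompact_iff (hπ : IsExpMap π) {x : E} : π x ∈ maxCompact G ↔ x ∈ hπ.span := by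
  rw [← SetLike.mem_coe, hπ.maxCompact_eq]
  constructor
  · rintro ⟨y, hy, e⟩
    have := hπ.span.sub_mem hy (hπ.mem_span_of_mem_ker (hπ.eq_iff_sub_mem_ker.1 e))
    rwa [sub_sub_cancel] at this
  · exact fun hx => ⟨x, hx, rfl⟩

theorem deriv_mem_of_forall_mem {V : Submodule ℝ E} {u : ℝ → E} (hu : ∀ t, u t ∈ V) (t : ℝ)
    (hd : DifferentiableAt ℝ u t) : deriv u t ∈ V := by
  have : FiniteDimensional ℝ E := FiniteDimensional.complexToReal E
  have hV : IsClosed (V : Set E) := V.closed_of_finiteDimensional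
  have h1 := hd.hasDerivAt.tendsto_slope
  refine hV.mem_of_tendsto h1 (.of_forall fun s => ?_)
  rw [slope_def_module]
  exact V.smul_mem _ (V.sub_mem (hu s) (hu t))

/-- The tangent space of the maximal compact subgroup is the translate of the real span of the
period group. -/
theorem mem_tangentTo_iff (hπ : IsExpMap π) {x : E} (hx : x ∈ hπ.span)
    {v : TangentSpace 𝓘(ℂ, E) (π x)} :
    v ∈ tangentTo (maxCompact G : Set G) (π x) ↔ ∃ w ∈ hπ.span, frame E (π x) w = (v : E) := by
  let S : E →ₗ[ℝ] TangentSpace 𝓘(ℂ, E) (π x) := ((frame E (π x)).restrictScalars ℝ).toLinearMap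
  suffices tangentTo (maxCompact G : Set G) (π x) = hπ.span.map S by
    rw [this]; rfl
  apply le_antisymm
  · refine Submodule.span_le.2 ?_
    rintro v ⟨c, hc, hcY, hc0, rfl⟩
    obtain ⟨u, hu, huc, hu0⟩ := hπ.exists_lift hc (a₀ := 0) hc0.symm
    have hus : ∀ t, u t ∈ hπ.span := fun t => by
      rw [← hπ.mem_maxCompact_iff, huc]; exact hcY t
    have hd : DifferentiableAt ℝ u 0 := hu.differentiable (by simp) 0
    refine ⟨deriv u 0, deriv_mem_of_forall_mem hus 0 hd, ?_⟩
    have := hπ.velocity_comp hd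
    rw [hu0] at this
    have e : c = fun t => π (u t) := funext fun t => (huc t).symm
    subst e
    exact this.symm
  · rintro _ ⟨w, hw, rfl⟩
    refine Submodule.subset_span ⟨fun t => π (x + t • w), ?_, fun t => ?_, by simp, ?_⟩
    · exact hπ.contMDiff_comp (by fun_prop)
    · exact hπ.mem_maxCompact_iff.2 (hπ.span.add_mem hx (hπ.span.smul_mem t hw))
    · have hd : HasDerivAt (fun t : ℝ => x + t • w) w 0 := by
        simpa using ((hasDerivAt_id (0 : ℝ)).smul_const w).const_add x
      have := hπ.velocity_comp hd.differentiableAt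
      rw [hd.deriv] at this
      refine this.trans ?_
      simp only [zero_smul, add_zero]
      rfl

variable {h : ∀ x : G, HermitianForm (TangentSpace 𝓘(ℂ, E) x)}

/-- Left invariance of a Hermitian metric. -/
def IsLeftInvariant (h : ∀ x : G, HermitianForm (TangentSpace 𝓘(ℂ, E) x)) : Prop :=
  ∀ (a x : G) (v w : TangentSpace 𝓘(ℂ, E) x),
    (h (a * x)).form (mfderiv 𝓘(ℂ, E) 𝓘(ℂ, E) (fun y => a * y) x v)
      (mfderiv 𝓘(ℂ, E) 𝓘(ℂ, E) (fun y => a * y) x w) = (h x).form v w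

/-- The Hermitian form at the identity, as a form on the model space. -/
def formAtOne (h : ∀ x : G, HermitianForm (TangentSpace 𝓘(ℂ, E) x)) : HermitianForm E := h 1

/-- The left invariant frame as a linear map to the tangent space. -/
def frameAt (g : G) : E →ₗ[ℂ] TangentSpace 𝓘(ℂ, E) g := (frame E g).toLinearMap

theorem form_frame (hinv : IsLeftInvariant h) (g : G) (v w : E) :
    (h g).form (frameAt g v) (frameAt g w) = (formAtOne h).form v w := by
  -- Invariance speaks about the tangent space at `g * 1`, a type that differs from the one at `g`;
  -- generalizing the point allows the substitution.
  have key : ∀ g', g' = g * 1 → (h g').form (show E from frame E g v) (show E from frame E g w)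
      = (formAtOne h).form v w := by
    rintro _ rfl
    exact hinv g 1 v w
  exact key g (mul_one g).symm

theorem mem_tangentTo_iff' (hπ : IsExpMap π) {x : E} (hx : x ∈ hπ.span)
    (v : TangentSpace 𝓘(ℂ, E) (π x)) :
    v ∈ tangentTo (maxCompact G : Set G) (π x) ↔ ∃ w ∈ hπ.span, frameAt (π x) w = v :=
  hπ.mem_tangentTo_iff hx

/-- Left translations are isometries that carry tangent spaces of the compact subgroup to each
other, so in the left invariant frame the metric has constant coefficients. Geodesics thereby become
a problem about one bilinear form on the span. -/
theorem inducedMetric_frame (hπ : IsExpMap π) (hinv : IsLeftInvariant h) {x v w : E}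
    (hx : x ∈ hπ.span) (hv : v ∈ hπ.span) (hw : w ∈ hπ.span) :
    inducedMetric h (maxCompact G : Set G) (π x) (frameAt (π x) v) (frameAt (π x) w)
      = inducedBilin (formAtOne h) hπ.span v w := by
  rw [inducedBilin_apply]
  exact inducedForm_eq_of_isometry (S := frameAt (π x)) (frame_injective (π x))
    (form_frame hinv (π x)) (hπ.mem_tangentTo_iff' hx) hv hw

theorem mem_cocomplexPart_iff (hπ : IsExpMap π) (hinv : IsLeftInvariant h) {x : E}
    (hx : x ∈ hπ.span) {v : TangentSpace 𝓘(ℂ, E) (π x)} :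
    v ∈ cocomplexPart (h (π x)) (tangentTo (maxCompact G : Set G) (π x)) ↔
      ∃ w ∈ cocomplexPart (formAtOne h) hπ.span, frameAt (π x) w = v :=
  mem_cocomplexPart_iff_of_isometry (S := frameAt (π x)) (frame_injective (π x))
    (form_frame hinv (π x)) (hπ.mem_tangentTo_iff' hx)

theorem action_comp (hπ : IsExpMap π) (hinv : IsLeftInvariant h) {u : ℝ → E}
    (hu : Differentiable ℝ u) (hus : ∀ t, u t ∈ hπ.span) (a b : ℝ) :
    action h (maxCompact G : Set G) (fun t => π (u t)) a b =
      ∫ t in a..b, inducedBilin (formAtOne h) hπ.span (deriv u t) (deriv u t) := by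
  unfold action
  congr 1
  ext t
  have hd := deriv_mem_of_forall_mem hus t (hu t)
  rw [← hπ.inducedMetric_frame hinv (hus t) hd hd]
  have : velocity (E := E) (fun t => π (u t)) t = frameAt (π (u t)) (deriv u t) :=
    hπ.velocity_comp (hu t)
  rw [this]

end IsExpMap

/-! ### Calculus of variations for a constant quadratic energy -/

section Variations

open Set Topology MeasureTheory

variable {E : Type} [NormedAddCommGroup E] [NormedSpace ℝ E]

/-- The cross term is the integral of a derivative and vanishes because `R` does at both ends. What
is left is quadratic in the derivative of `R` in `t`, which is zero at `s = 0`, hence is `O(s²)`. No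
definiteness of `B` is involved. -/
theorem hasDerivAt_energy_line (B : E →L[ℝ] E →L[ℝ] ℝ) (hB : ∀ v w, B v w = B w v) (v : E)
    {R : ℝ × ℝ → E} (hR : ContDiff ℝ ∞ R) {a b : ℝ} (hab : a < b) (h0 : ∀ t, R (0, t) = 0)
    (ha : ∀ s, R (s, a) = 0) (hb : ∀ s, R (s, b) = 0) :
    HasDerivAt (fun s => ∫ t in a..b,
      B (v + deriv (fun t => R (s, t)) t) (v + deriv (fun t => R (s, t)) t)) 0 0 := by
  let D : ℝ × ℝ → E := fun p => fderiv ℝ R p (0, 1)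
  have hD : ContDiff ℝ ∞ D := (hR.fderiv_right (by simp)).clm_apply contDiff_const
  have hderiv : ∀ s t, HasDerivAt (fun t => R (s, t)) (D (s, t)) t := fun s t => by
    have h1 : HasDerivAt (fun t : ℝ => (s, t)) ((0 : ℝ), (1 : ℝ)) t :=
      (hasDerivAt_const t s).prodMk (hasDerivAt_id t)
    exact ((hR.differentiable (by simp) (s, t)).hasFDerivAt.comp_hasDerivAt t h1)
  have hD0 : ∀ t, D (0, t) = 0 := fun t => by
    have h1 := hderiv 0 t
    simp only [h0] at h1
    exact h1.unique (hasDerivAt_const t 0)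
  have hDc : ∀ s, Continuous fun t => D (s, t) := fun s =>
    hD.continuous.comp (by fun_prop)
  -- the energy splits
  have hsplit : ∀ s, ∫ t in a..b, B (v + deriv (fun t => R (s, t)) t)
      (v + deriv (fun t => R (s, t)) t) = (b - a) * B v v + ∫ t in a..b, B (D (s, t)) (D (s, t)) := by
    intro s
    have h1 : ∫ t in a..b, B v (D (s, t)) = 0 := by
      rw [intervalIntegral.integral_eq_sub_of_hasDerivAt (f := fun t => B v (R (s, t)))
        (fun t _ => (B v).hasFDerivAt.comp_hasDerivAt t (hderiv s t))
        (((B v).continuous.comp (hDc s)).intervalIntegrable _ _)]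
      simp [ha, hb]
    have e : ∀ t, B (v + deriv (fun t => R (s, t)) t) (v + deriv (fun t => R (s, t)) t) =
        B v v + 2 * B v (D (s, t)) + B (D (s, t)) (D (s, t)) := by
      intro t
      rw [(hderiv s t).deriv]
      simp only [map_add, _root_.add_apply, hB (D (s, t)) v]
      ring
    have c1 : Continuous fun t => B v (D (s, t)) := (B v).continuous.comp (hDc s)
    have c2 : Continuous fun t => B (D (s, t)) (D (s, t)) :=
      (B.continuous.comp (hDc s)).clm_apply (hDc s)
    simp only [e]
    rw [intervalIntegral.integral_add, intervalIntegral.integral_add,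
      intervalIntegral.integral_const_mul, h1]
    · simp
    · exact continuous_const.intervalIntegrable _ _
    · exact (continuous_const.mul c1).intervalIntegrable _ _
    · exact (continuous_const.add (continuous_const.mul c1)).intervalIntegrable _ _
    · exact c2.intervalIntegrable _ _
  -- the remainder is quadratic
  have hcomp : IsCompact (Icc (-1 : ℝ) 1 ×ˢ Icc a b) := isCompact_Icc.prod isCompact_Icc
  obtain ⟨M, hM⟩ := hcomp.exists_bound_of_continuousOn
    (hD.continuous_fderiv (by simp)).continuousOn
  have hbound : ∀ s ∈ Icc (-1 : ℝ) 1, ∀ t ∈ Icc a b, ‖D (s, t)‖ ≤ M * ‖s‖ := by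
    intro s hs t ht
    have := Convex.norm_image_sub_le_of_norm_fderiv_le (𝕜 := ℝ) (f := D)
      (fun p _ => hD.differentiable (by simp) p) hM ((convex_Icc _ _).prod (convex_Icc _ _))
      (x := (0, t)) (y := (s, t)) ⟨by simp, ht⟩ ⟨hs, ht⟩
    rw [hD0, sub_zero] at this
    simpa [Prod.norm_def] using this
  have hO : (fun s => ∫ t in a..b, B (D (s, t)) (D (s, t))) =O[𝓝 (0 : ℝ)]
      fun s => ‖s - 0‖ ^ 2 := by
    refine Asymptotics.IsBigO.of_bound (‖B‖ * M ^ 2 * |b - a|) ?_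
    filter_upwards [Icc_mem_nhds (show (-1 : ℝ) < 0 by norm_num) (show (0 : ℝ) < 1 by norm_num)]
      with s hs
    have : ∀ t ∈ uIoc a b, ‖B (D (s, t)) (D (s, t))‖ ≤ ‖B‖ * (M * ‖s‖) * (M * ‖s‖) := by
      intro t ht
      rw [uIoc_of_le hab.le] at ht
      have h1 := hbound s hs t ⟨ht.1.le, ht.2⟩
      have h2 := (norm_nonneg _).trans h1
      exact (B.le_opNorm₂ _ _).trans (mul_le_mul (mul_le_mul_of_nonneg_left h1 B.opNorm_nonneg) h1
        (norm_nonneg _) (mul_nonneg B.opNorm_nonneg h2))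
    refine (intervalIntegral.norm_integral_le_of_norm_le_const this).trans_eq ?_
    rw [sub_zero, norm_pow, norm_norm]
    ring
  have h2 := (hO.hasFDerivAt (by norm_num)).hasDerivAt
  simp only [hsplit]
  simpa using h2.const_add ((b - a) * B v v)

/-- The du Bois-Reymond argument in the single direction `w`. With `φ = B u' w` and mean `m`, the
function `η` with `η' = φ - m` and `η 0 = 0` also vanishes at `1`; criticality along `η w` gives `∫
φ (φ - m) = 0`, hence `∫ (φ - m)² = 0`. -/
theorem eqOn_const_of_critical (B : E →L[ℝ] E →L[ℝ] ℝ) (hB : ∀ v w, B v w = B w v) (w : E)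
    {u : ℝ → E} (hu : ContDiff ℝ ∞ u)
    (hcrit : ∀ η : ℝ → ℝ, ContDiff ℝ ∞ η → η 0 = 0 → η 1 = 0 →
      HasDerivAt (fun s : ℝ => ∫ t in (0 : ℝ)..1,
        B (deriv u t + (s * deriv η t) • w) (deriv u t + (s * deriv η t) • w)) 0 0) :
    ∀ t ∈ Icc (0 : ℝ) 1, B (deriv u t) w = B (u 1 - u 0) w := by
  have hu' : ContDiff ℝ ∞ (deriv u) := (contDiff_infty_iff_deriv.1 hu).2
  let φ : ℝ → ℝ := fun t => B (deriv u t) w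
  have hφ : ContDiff ℝ ∞ φ := by
    have : ContDiff ℝ ∞ (fun x => B x w) := by fun_prop
    exact this.comp hu'
  let m : ℝ := B (u 1 - u 0) w
  have hm : ∫ t in (0 : ℝ)..1, φ t = m := by
    have := intervalIntegral.integral_eq_sub_of_hasDerivAt (a := 0) (b := 1)
      (f := fun t => B (u t) w) (f' := φ)
      (fun t _ => by
        have h1 := (hu.differentiable (by simp) t).hasDerivAt
        exact ((B.flip w).hasFDerivAt.comp_hasDerivAt t h1))
      (hφ.continuous.intervalIntegrable _ _)
    rw [this]
    simp [m]
  let η : ℝ → ℝ := fun t => ∫ τ in (0 : ℝ)..t, (φ τ - m)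
  have hη' : ∀ t, HasDerivAt η (φ t - m) t := fun t =>
    intervalIntegral.integral_hasDerivAt_right
      ((hφ.continuous.sub continuous_const).intervalIntegrable _ _)
      ((hφ.continuous.sub continuous_const).stronglyMeasurableAtFilter _ _)
      (hφ.continuous.sub continuous_const).continuousAt
  have hdη : deriv η = fun t => φ t - m := funext fun t => (hη' t).deriv
  have hη : ContDiff ℝ ∞ η := by
    refine contDiff_infty_iff_deriv.2 ⟨fun t => (hη' t).differentiableAt, ?_⟩
    rw [hdη]
    exact hφ.sub contDiff_const
  have hη0 : η 0 = 0 := by simp [η]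
  have hη1 : η 1 = 0 := by
    change ∫ τ in (0 : ℝ)..1, (φ τ - m) = 0
    rw [intervalIntegral.integral_sub (hφ.continuous.intervalIntegrable _ _)
      (continuous_const.intervalIntegrable _ _), hm]
    simp
  have hc := hcrit η hη hη0 hη1
  rw [hdη] at hc
  -- the energy is a quadratic polynomial in the parameter
  set I0 := ∫ t in (0 : ℝ)..1, B (deriv u t) (deriv u t)
  set I1 := ∫ t in (0 : ℝ)..1, φ t * (φ t - m)
  set I2 := ∫ t in (0 : ℝ)..1, (φ t - m) ^ 2 * B w w
  have hpoly : ∀ s : ℝ, ∫ t in (0 : ℝ)..1,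
      B (deriv u t + (s * (φ t - m)) • w) (deriv u t + (s * (φ t - m)) • w)
      = I0 + s * (2 * I1) + s ^ 2 * I2 := by
    intro s
    have e : ∀ t, B (deriv u t + (s * (φ t - m)) • w) (deriv u t + (s * (φ t - m)) • w) =
        B (deriv u t) (deriv u t) + s * (2 * (φ t * (φ t - m)))
          + s ^ 2 * ((φ t - m) ^ 2 * B w w) := by
      intro t
      simp only [map_add, _root_.add_apply, map_smul, _root_.smul_apply,
        smul_eq_mul, hB w (deriv u t)]
      simp only [φ]
      ring
    simp only [e]
    have c0 : Continuous fun t => B (deriv u t) (deriv u t) :=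
      (B.continuous.comp hu'.continuous).clm_apply hu'.continuous
    have c := hφ.continuous
    rw [intervalIntegral.integral_add, intervalIntegral.integral_add,
      intervalIntegral.integral_const_mul, intervalIntegral.integral_const_mul,
      intervalIntegral.integral_const_mul]
    · exact c0.intervalIntegrable _ _
    · exact Continuous.intervalIntegrable (by fun_prop) _ _
    · exact Continuous.intervalIntegrable (c0.add (by fun_prop)) _ _
    · exact Continuous.intervalIntegrable (by fun_prop) _ _
  simp only [hpoly] at hc
  have hd : HasDerivAt (fun s : ℝ => I0 + s * (2 * I1) + s ^ 2 * I2) (2 * I1) 0 := by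
    have h1 := (((hasDerivAt_id (0 : ℝ)).mul_const (2 * I1)).const_add I0).add
      (((hasDerivAt_id (0 : ℝ)).pow 2).mul_const I2)
    exact h1.congr_deriv (by simp)
  have hI1 : I1 = 0 := by
    have := hc.unique hd
    linarith
  have hsq : ∫ t in (0 : ℝ)..1, (φ t - m) ^ 2 = 0 := by
    have e : ∀ t, (φ t - m) ^ 2 = φ t * (φ t - m) - m * (φ t - m) := fun t => by ring
    simp only [e]
    have c := hφ.continuous
    rw [intervalIntegral.integral_sub, intervalIntegral.integral_const_mul]
    · change I1 - m * η 1 = 0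
      rw [hI1, hη1]; ring
    · exact Continuous.intervalIntegrable (by fun_prop) _ _
    · exact Continuous.intervalIntegrable (by fun_prop) _ _
  intro t ht
  by_contra hne
  have hpos : 0 < ∫ t in (0 : ℝ)..1, (φ t - m) ^ 2 := by
    have c := hφ.continuous
    refine intervalIntegral.integral_pos one_pos (by fun_prop) (fun _ _ => sq_nonneg _)
      ⟨t, ht, ?_⟩
    have : φ t - m ≠ 0 := sub_ne_zero.2 hne
    positivity
  exact hpos.ne' hsq

end Variations

/-! ### Closed geodesics are periods -/

namespace IsExpMap

open Set Topology

variable {E : Type} [NormedAddCommGroup E] [NormedSpace ℂ E] [FiniteDimensional ℂ E]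
  {G : Type} [Group G] [TopologicalSpace G] [ChartedSpace E G] [LieGroup 𝓘(ℂ, E) ω G]
  {π : E → G} {h : ∀ x : G, HermitianForm (TangentSpace 𝓘(ℂ, E) x)}

theorem isGeodesic_line (hπ : IsExpMap π) (hinv : IsLeftInvariant h) {v : E} (hv : v ∈ hπ.span) :
    IsGeodesic h (maxCompact G : Set G) (fun t => π (t • v)) where
  smooth := hπ.contMDiff_comp (by fun_prop)
  mem := fun t => hπ.mem_maxCompact_iff.2 (hπ.span.smul_mem t hv)
  critical := by
    intro a b hab Γ hΓ
    have : FiniteDimensional ℝ E := FiniteDimensional.complexToReal E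
    let B : E →L[ℝ] E →L[ℝ] ℝ := (inducedBilin (formAtOne h) hπ.span).toContinuousBilinearMap
    obtain ⟨U, hU, hUΓ, hU0⟩ := hπ.exists_lift (a₀ := (0, 0)) (e₀ := (0 : E)) hΓ.smooth
      (by simp [hΓ.zero])
    have hUc := hU.continuous
    -- The lift `U` and the line agree in `G`, so they differ by a continuous function with values
    -- in the discrete period group, which is constant. The same argument in `s` fixes the end
    -- points of the lifted curves.
    have hU0t : ∀ t, U (0, t) = t • v := by
      intro t
      have h1 : ∀ t : ℝ, U (0, t) - t • v ∈ hπ.ker := fun t => by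
        rw [← hπ.eq_iff_sub_mem_ker, hUΓ, hΓ.zero]
      have h2 := hπ.eq_of_forall_mem_ker (by fun_prop) h1 t 0
      simpa [hU0, sub_eq_zero] using h2
    have hconst : ∀ t₀ : ℝ, (∀ s, Γ s t₀ = π (t₀ • v)) → ∀ s, U (s, t₀) = t₀ • v := by
      intro t₀ ht₀ s
      have h1 : ∀ s : ℝ, U (s, t₀) - t₀ • v ∈ hπ.ker := fun s => by
        rw [← hπ.eq_iff_sub_mem_ker, hUΓ, ht₀]
      have h2 := hπ.eq_of_forall_mem_ker (by fun_prop) h1 s 0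
      rwa [hU0t, sub_self, sub_eq_zero] at h2
    let R : ℝ × ℝ → E := fun p => U p - p.2 • v
    have hR : ContDiff ℝ ∞ R := hU.sub (contDiff_snd.smul contDiff_const)
    have key := hasDerivAt_energy_line B inducedBilin_comm v hR hab
      (fun t => by simp [R, hU0t]) (fun s => by simp [R, hconst a hΓ.left])
      (fun s => by simp [R, hconst b hΓ.right])
    refine key.congr_of_eventuallyEq (.of_forall fun s => ?_)
    have hUs : ∀ t, U (s, t) ∈ hπ.span := fun t => by
      rw [← hπ.mem_maxCompact_iff, hUΓ]; exact hΓ.mem s t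
    have hd : Differentiable ℝ fun t => U (s, t) :=
      (hU.differentiable (by simp)).comp (by fun_prop)
    have e : Γ s = fun t => π (U (s, t)) := funext fun t => (hUΓ (s, t)).symm
    simp only [e]
    rw [hπ.action_comp hinv hd hUs]
    have e2 : ∀ t, deriv (fun t => U (s, t)) t = v + deriv (fun t => R (s, t)) t := by
      intro t
      have h1 : HasDerivAt (fun t : ℝ => t • v) v t := by
        simpa using (hasDerivAt_id t).smul_const v
      have h2 := ((hd t).hasDerivAt.sub h1).deriv
      change deriv (fun t => R (s, t)) t = _ at h2
      rw [h2]
      abel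
    simp only [e2]
    rfl

theorem action_line (hπ : IsExpMap π) (hinv : IsLeftInvariant h) {v : E} (hv : v ∈ hπ.span) :
    action h (maxCompact G : Set G) (fun t => π (t • v)) 0 1 =
      inducedForm (formAtOne h) hπ.span v v := by
  rw [hπ.action_comp hinv (by fun_prop) (fun t => hπ.span.smul_mem t hv)]
  have : ∀ t : ℝ, deriv (fun t : ℝ => t • v) t = v := fun t => by
    simpa using ((hasDerivAt_id t).smul_const v).deriv
  simp [this, inducedBilin_apply]

/-- Criticality in every direction `w` of the span shows that `u' - (u 1 - u 0)` is orthogonal to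
the whole span on `[0, 1]`. By nondegeneracy the lift has constant velocity there, equal to a period
because the curve closes up. -/
theorem action_of_isGeodesic (hπ : IsExpMap π) (hinv : IsLeftInvariant h) {c : ℝ → G}
    (hc : IsGeodesic h (maxCompact G : Set G) c) (hper : c 1 = c 0) :
    ∃ γ ∈ hπ.ker, action h (maxCompact G : Set G) c 0 1 =
      inducedForm (formAtOne h) hπ.span γ γ := by
  have : FiniteDimensional ℝ E := FiniteDimensional.complexToReal E
  let B : E →L[ℝ] E →L[ℝ] ℝ := (inducedBilin (formAtOne h) hπ.span).toContinuousBilinearMap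
  obtain ⟨e₀, he₀⟩ := hπ.surjective (c 0)
  obtain ⟨u, hu, huc, -⟩ := hπ.exists_lift hc.smooth he₀
  have hus : ∀ t, u t ∈ hπ.span := fun t => by
    rw [← hπ.mem_maxCompact_iff, huc]; exact hc.mem t
  have hud : Differentiable ℝ u := hu.differentiable (by simp)
  have e : c = fun t => π (u t) := funext fun t => (huc t).symm
  have hγ : u 1 - u 0 ∈ hπ.ker := by
    rw [← hπ.eq_iff_sub_mem_ker, huc, huc, hper]
  have hderiv : ∀ t ∈ Icc (0 : ℝ) 1, deriv u t = u 1 - u 0 := by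
    intro t ht
    rw [← sub_eq_zero]
    refine inducedBilin_nondegenerate (h := formAtOne h) (V := hπ.span)
      (hπ.span.sub_mem (deriv_mem_of_forall_mem hus t (hud t)) (hπ.mem_span_of_mem_ker hγ))
      fun w hw => ?_
    rw [_root_.map_sub, LinearMap.sub_apply, sub_eq_zero]
    refine eqOn_const_of_critical B inducedBilin_comm w hu (fun η hη hη0 hη1 => ?_) t ht
    let Γ : ℝ → ℝ → G := fun s t => π (u t + (s * η t) • w)
    have hmem : ∀ s t, u t + (s * η t) • w ∈ hπ.span := fun s t =>
      hπ.span.add_mem (hus t) (hπ.span.smul_mem _ hw)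
    have hΓ : IsVariation E (maxCompact G : Set G) c 0 1 Γ :=
      { smooth := hπ.contMDiff_comp (A := ℝ × ℝ)
          (u := fun p => u p.2 + (p.1 * η p.2) • w)
          ((hu.comp contDiff_snd).add ((contDiff_fst.mul (hη.comp contDiff_snd)).smul
            contDiff_const))
        mem := fun s t => hπ.mem_maxCompact_iff.2 (hmem s t)
        zero := fun t => by simp [Γ, huc]
        left := fun s => by simp [Γ, hη0, huc]
        right := fun s => by simp [Γ, hη1, huc] }
    refine (hc.critical 0 1 one_pos Γ hΓ).congr_of_eventuallyEq (.of_forall fun s => ?_)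
    have hd : ∀ t, HasDerivAt (fun t => u t + (s * η t) • w)
        (deriv u t + (s * deriv η t) • w) t := fun t =>
      (hud t).hasDerivAt.add
        (((hη.differentiable (by simp) t).hasDerivAt.const_mul s).smul_const w)
    change _ = action h (maxCompact G : Set G) (fun t => π (u t + (s * η t) • w)) 0 1
    rw [hπ.action_comp hinv (fun t => (hd t).differentiableAt) (hmem s)]
    simp only [(hd _).deriv]
    rfl
  refine ⟨u 1 - u 0, hγ, ?_⟩
  rw [e, hπ.action_comp hinv hud hus]
  have : ∫ t in (0 : ℝ)..1, inducedBilin (formAtOne h) hπ.span (deriv u t) (deriv u t) =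
      ∫ t in (0 : ℝ)..1, inducedBilin (formAtOne h) hπ.span (u 1 - u 0) (u 1 - u 0) := by
    refine intervalIntegral.integral_congr fun t ht => ?_
    rw [uIcc_of_le zero_le_one] at ht
    simp only [hderiv t ht]
  rw [this, intervalIntegral.integral_const, sub_zero, one_smul, inducedBilin_apply]

/-- The maximal compact subgroup is polarized if and only if the induced form takes rational
values on the periods. -/
theorem isPolarized_iff (hπ : IsExpMap π) (hinv : IsLeftInvariant h) :
    IsPolarized h (maxCompact G : Set G) ↔
      ∀ γ ∈ hπ.ker, ∃ q : ℚ, inducedForm (formAtOne h) hπ.span γ γ = q := by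
  constructor
  · intro H γ hγ
    have hγ' := hπ.mem_span_of_mem_ker hγ
    obtain ⟨q, hq⟩ := H _ (hπ.isGeodesic_line hinv hγ') fun t => by
      rw [add_smul, one_smul, hπ.map_add, hπ.mem_ker.1 hγ, mul_one]
    exact ⟨q, by rw [← hq, hπ.action_line hinv hγ']⟩
  · intro H c hc hper
    obtain ⟨γ, hγ, e⟩ := hπ.action_of_isGeodesic hinv hc (by simpa using hper 0)
    obtain ⟨q, hq⟩ := H γ hγ
    exact ⟨q, e.trans hq⟩

end IsExpMap

/-! ### The quotient of a vector space by a discrete subgroup as a Lie group -/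

section DiscreteQuotient

open Set Topology

variable {E : Type} [NormedAddCommGroup E] [NormedSpace ℂ E]

/-- The quotient `E / Γ`, written multiplicatively. -/
def DiscreteQuotient (Γ : AddSubgroup E) : Type := Multiplicative (E ⧸ Γ)

namespace DiscreteQuotient

variable (Γ : AddSubgroup E)

instance : CommGroup (DiscreteQuotient Γ) := inferInstanceAs (CommGroup (Multiplicative (E ⧸ Γ)))

instance : TopologicalSpace (DiscreteQuotient Γ) :=
  inferInstanceAs (TopologicalSpace (Multiplicative (E ⧸ Γ)))

/-- The projection `E → E / Γ`. -/
def mk (x : E) : DiscreteQuotient Γ := Multiplicative.ofAdd (QuotientAddGroup.mk x)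

theorem mk_add (x y : E) : mk Γ (x + y) = mk Γ x * mk Γ y := rfl

theorem mk_neg (x : E) : mk Γ (-x) = (mk Γ x)⁻¹ := rfl

theorem mk_surjective : Function.Surjective (mk Γ) := QuotientAddGroup.mk_surjective

theorem mk_eq_iff {x y : E} : mk Γ x = mk Γ y ↔ y - x ∈ Γ := by
  refine (QuotientAddGroup.eq (s := Γ)).trans ?_
  rw [neg_add_eq_sub]

theorem mk_continuous : Continuous (mk Γ) :=
  (continuous_quotient_mk' : Continuous (QuotientAddGroup.mk : E → E ⧸ Γ))

instance : ConnectedSpace (DiscreteQuotient Γ) :=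
  (mk_surjective Γ).connectedSpace (mk_continuous Γ)

variable [DiscreteTopology Γ]

theorem isLocalHomeomorph_mk : IsLocalHomeomorph (mk Γ) :=
  ((AddSubgroup.isAddQuotientCoveringMap_of_comm Γ
    (isDiscrete_iff_discreteTopology.2 ‹_›)).isCoveringMap).isLocalHomeomorph

/-- A local section of the projection around a point. -/
theorem exists_localHomeomorph (q : DiscreteQuotient Γ) :
    ∃ e : OpenPartialHomeomorph E (DiscreteQuotient Γ), q ∈ e.target ∧ mk Γ = e := by
  obtain ⟨x, rfl⟩ := mk_surjective Γ q
  obtain ⟨e, hx, he⟩ := isLocalHomeomorph_mk Γ x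
  refine ⟨e, ?_, he⟩
  rw [he]
  exact e.map_source hx

instance : ChartedSpace E (DiscreteQuotient Γ) where
  atlas := {φ | ∃ e : OpenPartialHomeomorph E (DiscreteQuotient Γ), mk Γ = e ∧ φ = e.symm}
  chartAt q := (exists_localHomeomorph Γ q).choose.symm
  mem_chart_source q := (exists_localHomeomorph Γ q).choose_spec.1
  chart_mem_atlas q := ⟨_, (exists_localHomeomorph Γ q).choose_spec.2, rfl⟩

theorem mk_chartAt_symm (q : DiscreteQuotient Γ) : mk Γ = (chartAt E q).symm :=
  (exists_localHomeomorph Γ q).choose_spec.2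

theorem mk_chartAt {q p : DiscreteQuotient Γ} (hp : p ∈ (chartAt E q).source) :
    mk Γ (chartAt E q p) = p := by
  rw [mk_chartAt_symm Γ q, (chartAt E q).left_inv hp]

/-- A continuous map that lifts the identity of `E / Γ` is locally a translation. -/
theorem eventuallyEq_add_of_mk_eq {f : E → E} {x : E}
    (hf : ∀ᶠ y in 𝓝 x, ContinuousAt f y ∧ mk Γ (f y) = mk Γ y) :
    f =ᶠ[𝓝 x] fun y => y + (f x - x) := by
  obtain ⟨W, hW, hWo, hxW⟩ := eventually_nhds_iff.1 hf
  let g : W → Γ := fun y => ⟨f y - y, (mk_eq_iff Γ).1 (hW y y.2).2.symm⟩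
  have hg : Continuous g := by
    refine Continuous.subtype_mk ?_ _
    refine Continuous.sub ?_ continuous_subtype_val
    exact continuousOn_iff_continuous_domRestrict.1
      fun y hy => (hW y hy).1.continuousWithinAt
  have h1 : ∀ᶠ y in 𝓝 (⟨x, hxW⟩ : W), g y = g ⟨x, hxW⟩ :=
    hg.continuousAt.eventually ((isOpen_discrete {g ⟨x, hxW⟩}).mem_nhds rfl)
  have h2 : ∀ᶠ y in 𝓝 x, ∀ hy : y ∈ W, g ⟨y, hy⟩ = g ⟨x, hxW⟩ := by
    rw [nhds_subtype_eq_comap, Filter.eventually_comap] at h1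
    filter_upwards [h1] with y hy hyW using hy ⟨y, hyW⟩ rfl
  filter_upwards [h2, hWo.mem_nhds hxW] with y hy hyW
  have := congrArg Subtype.val (hy hyW)
  change f y - y = f x - x at this
  rw [← this]
  abel

/-- Charts are local sections of the projection, so a transition map lifts the identity of the
quotient and is locally a translation. -/
instance : IsManifold 𝓘(ℂ, E) ω (DiscreteQuotient Γ) := by
  refine isManifold_of_contDiffOn 𝓘(ℂ, E) ω _ ?_
  rintro _ _ ⟨e, he, rfl⟩ ⟨e', he', rfl⟩
  intro x hx
  have hx1 : x ∈ (e.symm.symm ≫ₕ e'.symm).source := by simpa using hx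
  have hloc : ∀ᶠ y in 𝓝 x, ContinuousAt (e.symm.symm ≫ₕ e'.symm) y ∧
      mk Γ ((e.symm.symm ≫ₕ e'.symm) y) = mk Γ y := by
    filter_upwards [(e.symm.symm ≫ₕ e'.symm).open_source.mem_nhds hx1] with y hy
    refine ⟨(e.symm.symm ≫ₕ e'.symm).continuousAt hy, ?_⟩
    have hy2 : e y ∈ e'.target := by
      rw [OpenPartialHomeomorph.trans_source] at hy
      exact hy.2
    change mk Γ (e'.symm (e y)) = mk Γ y
    rw [he', e'.right_inv hy2, ← he', he]
  have := eventuallyEq_add_of_mk_eq Γ hloc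
  have h2 : ContDiffAt ℂ ω (e.symm.symm ≫ₕ e'.symm) x :=
    (contDiffAt_id.add contDiffAt_const).congr_of_eventuallyEq this
  exact h2.contDiffWithinAt

theorem eventuallyEq_chartAt_mk (x : E) :
    (fun y => chartAt E (mk Γ x) (mk Γ y)) =ᶠ[𝓝 x]
      fun y => y + (chartAt E (mk Γ x) (mk Γ x) - x) := by
  refine eventuallyEq_add_of_mk_eq Γ ?_
  filter_upwards [(mk_continuous Γ).continuousAt.eventually
    ((chartAt E (mk Γ x)).open_source.mem_nhds (mem_chart_source E (mk Γ x)))] with y hy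
  exact ⟨((chartAt E (mk Γ x)).continuousAt hy).comp (mk_continuous Γ).continuousAt,
    mk_chartAt Γ hy⟩

theorem contMDiff_mk : ContMDiff 𝓘(ℂ, E) 𝓘(ℂ, E) ω (mk Γ) := by
  intro x
  refine contMDiffAt_iff.2 ⟨(mk_continuous Γ).continuousAt, ?_⟩
  have : ContDiffAt ℂ ω (fun y => chartAt E (mk Γ x) (mk Γ y)) x :=
    (contDiffAt_id.add contDiffAt_const).congr_of_eventuallyEq (eventuallyEq_chartAt_mk Γ x)
  exact this.contDiffWithinAt

theorem hasMD_mk (x : E) : HasMD ℂ (mk Γ) x (ContinuousLinearMap.id ℂ E) := by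
  refine HasMD.iff.2 ⟨(mk_continuous Γ).continuousAt, ?_⟩
  have : HasFDerivAt (fun y => chartAt E (mk Γ x) (mk Γ y)) (ContinuousLinearMap.id ℂ E) x :=
    ((hasFDerivAt_id x).add_const _).congr_of_eventuallyEq (eventuallyEq_chartAt_mk Γ x)
  exact this

theorem contMDiffAt_chartAt (q : DiscreteQuotient Γ) :
    ContMDiffAt 𝓘(ℂ, E) 𝓘(ℂ, E) ω (chartAt E q) q :=
  (contMDiffOn_chart (I := 𝓘(ℂ, E)) (x := q)).contMDiffAt
    ((chartAt E q).open_source.mem_nhds (mem_chart_source E q))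

instance : LieGroup 𝓘(ℂ, E) ω (DiscreteQuotient Γ) where
  contMDiff_mul := by
    rintro ⟨p, q⟩
    have h1 : ContMDiffAt (𝓘(ℂ, E).prod 𝓘(ℂ, E)) 𝓘(ℂ, E) ω
        (fun r : DiscreteQuotient Γ × DiscreteQuotient Γ => chartAt E p r.1) (p, q) :=
      ContMDiffAt.comp (p, q) (f := Prod.fst) (contMDiffAt_chartAt Γ p) contMDiffAt_fst
    have h2 : ContMDiffAt (𝓘(ℂ, E).prod 𝓘(ℂ, E)) 𝓘(ℂ, E) ω
        (fun r : DiscreteQuotient Γ × DiscreteQuotient Γ => chartAt E q r.2) (p, q) :=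
      ContMDiffAt.comp (p, q) (f := Prod.snd) (contMDiffAt_chartAt Γ q) contMDiffAt_snd
    refine ((contMDiff_mk Γ _).comp (p, q) (h1.add h2)).congr_of_eventuallyEq ?_
    filter_upwards [((chartAt E p).open_source.prod (chartAt E q).open_source).mem_nhds
      ⟨mem_chart_source E p, mem_chart_source E q⟩] with r hr
    change r.1 * r.2 = mk Γ (chartAt E p r.1 + chartAt E q r.2)
    rw [mk_add, mk_chartAt Γ hr.1, mk_chartAt Γ hr.2]
  contMDiff_inv := by
    intro p
    refine ((contMDiff_mk Γ _).comp p (contMDiffAt_chartAt Γ p).neg).congr_of_eventuallyEq ?_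
    filter_upwards [(chartAt E p).open_source.mem_nhds (mem_chart_source E p)] with r hr
    change r⁻¹ = mk Γ (-chartAt E p r)
    rw [mk_neg, mk_chartAt Γ hr]

theorem isExpMap_mk : IsExpMap (mk Γ) where
  map_add := mk_add Γ
  contMDiff := (contMDiff_mk Γ).of_le le_top
  surjective := mk_surjective Γ
  hasMD_zero := hasMD_mk Γ 0

variable [FiniteDimensional ℂ E]

theorem ker_isExpMap_mk : (isExpMap_mk Γ).ker = Γ := by
  ext x
  rw [IsExpMap.mem_ker, ← (isExpMap_mk Γ).map_zero, eq_comm, mk_eq_iff, sub_zero]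

/-- In the preferred charts the projection has identity derivative everywhere, so every translation
of the quotient does too. Hence a constant Hermitian form is an invariant metric. -/
theorem hasMD_mul_left (a x : DiscreteQuotient Γ) :
    HasMD ℂ (fun y => a * y) x (ContinuousLinearMap.id ℂ E) := by
  have hL : LieGroup 𝓘(ℂ, E) 1 (DiscreteQuotient Γ) := .of_le le_top
  obtain ⟨u, rfl⟩ := mk_surjective Γ a
  obtain ⟨y, rfl⟩ := mk_surjective Γ x
  obtain ⟨A, hA⟩ := HasMD.mul_left (𝕜 := ℂ) (F := E) (mk Γ u) (mk Γ y)
  have h1 := hA.comp (hasMD_mk Γ y) rfl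
  have h2 : HasMD ℂ (fun z => u + z) y (ContinuousLinearMap.id ℂ E) :=
    ((hasFDerivAt_id y).const_add u).hasMD
  have h3 := ((hasMD_mk Γ (u + y)).comp h2 rfl).unique h1
  refine hA.congr ?_
  simpa using h3.symm

/-- The translation invariant metric on `E / Γ` given by a Hermitian form on `E`. -/
def metric (h : HermitianForm E) (x : DiscreteQuotient Γ) :
    HermitianForm (TangentSpace 𝓘(ℂ, E) x) := h

theorem isLeftInvariant_metric (h : HermitianForm E) :
    IsExpMap.IsLeftInvariant (metric Γ h) := by
  intro a x v w
  rw [(hasMD_mul_left Γ a x).mfderiv_eq]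
  rfl

end DiscreteQuotient

end DiscreteQuotient

/-! ### Holomorphic functions as periodic functions -/

namespace IsExpMap

variable {E : Type} [NormedAddCommGroup E] [NormedSpace ℂ E] [FiniteDimensional ℂ E]
  {G : Type} [Group G] [TopologicalSpace G] [ChartedSpace E G] [LieGroup 𝓘(ℂ, E) ω G]
  {π : E → G}

/-- Differentiability descends along an exponential map. -/
theorem mdifferentiable_of_comp (hπ : IsExpMap π) {F : Type} [NormedAddCommGroup F]
    [NormedSpace ℂ F] {N : Type} [TopologicalSpace N] [ChartedSpace F N] {g : G → N}
    (hg : MDifferentiable 𝓘(ℂ, E) 𝓘(ℂ, F) (fun x => g (π x))) :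
    MDifferentiable 𝓘(ℂ, E) 𝓘(ℂ, F) g := by
  intro y
  obtain ⟨x, rfl⟩ := hπ.surjective y
  obtain ⟨σ, h1, -, h3⟩ := hπ.exists_localInverse x
  have h4 := (hg _).comp (π x) (h3.self_of_nhds.mdifferentiableAt (by simp))
  refine h4.congr_of_eventuallyEq ?_
  filter_upwards [h1] with z hz
  rw [Function.comp_apply, hz]

/-- All holomorphic functions on `G` are constant if and only if all periodic holomorphic functions
on `E` are. -/
theorem onlyConstantFunctions_iff (hπ : IsExpMap π) : OnlyConstantFunctions E G ↔
    ∀ f : E → ℂ, Differentiable ℂ f → (∀ x, ∀ γ ∈ hπ.ker, f (x + γ) = f x) →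
      ∃ a, ∀ x, f x = a := by
  constructor
  · intro H f hf hper
    choose s hs using hπ.surjective
    have e : ∀ x, f (s (π x)) = f x := fun x => by
      have := hper x _ (hπ.eq_iff_sub_mem_ker.1 (hs (π x)))
      rwa [add_sub_cancel] at this
    obtain ⟨a, ha⟩ := H (fun y => f (s y)) (hπ.mdifferentiable_of_comp (by
      simp only [e]
      exact hf.mdifferentiable))
    exact ⟨a, fun x => by rw [← e, ha]⟩
  · intro H f hf
    obtain ⟨a, ha⟩ := H (fun x => f (π x))
      (mdifferentiable_iff_differentiable.1
        (hf.comp (hπ.contMDiff.mdifferentiable (by simp))))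
      (fun x γ hγ => by rw [hπ.map_add, hπ.mem_ker.1 hγ, mul_one])
    exact ⟨a, fun y => by obtain ⟨x, rfl⟩ := hπ.surjective y; exact ha x⟩

end IsExpMap

/-! ### Semisimplicity from pseudo-inverses -/

section RegularCategory

variable {C : Type*} [Category C]

/-- Every morphism has a pseudo-inverse (von Neumann regularity). -/
def HasPseudoInverses (C : Type*) [Category C] : Prop :=
  ∀ ⦃X Y : C⦄ (f : X ⟶ Y), ∃ g : Y ⟶ X, f ≫ g ≫ f = f

theorem HasPseudoInverses.isSplitMono (hC : HasPseudoInverses C) {X Y : C} (f : X ⟶ Y) [Mono f] :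
    IsSplitMono f := by
  obtain ⟨g, hg⟩ := hC f
  exact ⟨⟨⟨g, by rw [← cancel_mono f, Category.assoc, hg, Category.id_comp]⟩⟩⟩

variable [Preadditive C] [IsIdempotentComplete C]

/-- `𝟙 X - f ≫ g` is an idempotent that fixes exactly the morphisms killed by `f`; the object
splitting it is the kernel. Cokernels arise dually from `𝟙 Y - g ≫ f`. -/
theorem HasPseudoInverses.hasKernel (hC : HasPseudoInverses C) {X Y : C}
    (f : X ⟶ Y) : HasKernel f := by
  obtain ⟨g, hg⟩ := hC f
  obtain ⟨K, i, p, h1, h2⟩ := IsIdempotentComplete.idempotents_split X (𝟙 X - f ≫ g) (by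
    simp [reassoc_of% hg])
  have h0 : i ≫ f = 0 := by
    have : i ≫ p ≫ i ≫ f = 0 := by rw [reassoc_of% h2]; simp [hg]
    rwa [reassoc_of% h1] at this
  have key : ∀ {W : C} (k : W ⟶ X), k ≫ f = 0 → (k ≫ p) ≫ i = k := fun k hk => by
    rw [Category.assoc, h2, Preadditive.comp_sub, reassoc_of% hk]
    simp
  exact ⟨⟨_, KernelFork.IsLimit.ofι i h0 (fun k _ => k ≫ p) (fun k hk => key k hk)
    fun k _ m hm => by rw [← hm, Category.assoc, h1, Category.comp_id]⟩⟩

theorem HasPseudoInverses.hasCokernel (hC : HasPseudoInverses C) {X Y : C}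
    (f : X ⟶ Y) : HasCokernel f := by
  obtain ⟨g, hg⟩ := hC f
  obtain ⟨Q, i, p, h1, h2⟩ := IsIdempotentComplete.idempotents_split Y (𝟙 Y - g ≫ f) (by
    simp [hg])
  have h0 : f ≫ p = 0 := by
    have : f ≫ p ≫ i ≫ p = 0 := by rw [reassoc_of% h2]; simp [reassoc_of% hg]
    rwa [h1, Category.comp_id] at this
  have key : ∀ {W : C} (k : Y ⟶ W), f ≫ k = 0 → p ≫ i ≫ k = k := fun k hk => by
    rw [reassoc_of% h2, Preadditive.sub_comp, Category.assoc, hk]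
    simp
  exact ⟨⟨_, CokernelCofork.IsColimit.ofπ p h0 (fun k _ => i ≫ k) (fun k hk => key k hk)
    fun k _ m hm => by rw [← hm, reassoc_of% h1]⟩⟩

-- A monomorphism `f` is split by its pseudo-inverse `g`, and is the kernel of the complementary
-- projection `𝟙 Y - g ≫ f`.
omit [IsIdempotentComplete C] in
theorem HasPseudoInverses.exists_normalMono (hC : HasPseudoInverses C) {X Y : C} (f : X ⟶ Y)
    [Mono f] : Nonempty (NormalMono f) := by
  obtain ⟨g, hg⟩ := hC f
  have h1 : f ≫ g = 𝟙 X := by rw [← cancel_mono f, Category.assoc, hg, Category.id_comp]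
  have h0 : f ≫ (𝟙 Y - g ≫ f) = 0 := by simp [hg]
  refine ⟨⟨Y, 𝟙 Y - g ≫ f, h0, KernelFork.IsLimit.ofι f h0 (fun k _ => k ≫ g) (fun k hk => ?_)
    fun k _ m hm => by rw [← hm, Category.assoc, h1, Category.comp_id]⟩⟩
  rw [Preadditive.comp_sub, Category.comp_id, sub_eq_zero] at hk
  rw [Category.assoc, ← hk]

omit [IsIdempotentComplete C] in
theorem HasPseudoInverses.exists_normalEpi (hC : HasPseudoInverses C) {X Y : C} (f : X ⟶ Y)
    [Epi f] : Nonempty (NormalEpi f) := by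
  obtain ⟨g, hg⟩ := hC f
  have h1 : g ≫ f = 𝟙 Y := by rw [← cancel_epi f, hg, Category.comp_id]
  have h0 : (𝟙 X - f ≫ g) ≫ f = 0 := by simp [hg]
  refine ⟨⟨X, 𝟙 X - f ≫ g, h0, CokernelCofork.IsColimit.ofπ f h0 (fun k _ => g ≫ k)
    (fun k hk => ?_) fun k _ m hm => by rw [← hm, reassoc_of% h1]⟩⟩
  rw [Preadditive.sub_comp, Category.id_comp, sub_eq_zero, Category.assoc] at hk
  exact hk.symm

/-- A Karoubian additive category in which every morphism has a pseudo-inverse is abelian. -/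
@[reducible]
def HasPseudoInverses.abelian [HasFiniteProducts C] (hC : HasPseudoInverses C) : Abelian C where
  normalMonoOfMono f _ := hC.exists_normalMono f
  normalEpiOfEpi f _ := hC.exists_normalEpi f
  has_kernels := ⟨fun f => hC.hasKernel f⟩
  has_cokernels := ⟨fun f => hC.hasCokernel f⟩

omit [IsIdempotentComplete C] in
/-- Direct sum decompositions into simple objects, without choosing biproducts. -/
def HasSimpleDecomposition (X : C) : Prop :=
  ∃ (ι : Type) (_ : Fintype ι) (S : ι → C) (i : ∀ j, S j ⟶ X) (p : ∀ j, X ⟶ S j),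
    (∀ j, Simple (S j)) ∧ (∀ j, i j ≫ p j = 𝟙 _) ∧ (∀ j k, j ≠ k → i j ≫ p k = 0) ∧
      ∑ j, p j ≫ i j = 𝟙 X

omit [IsIdempotentComplete C] in
theorem HasSimpleDecomposition.of_splitting {X Y Z : C} {i : Y ⟶ X} {p : X ⟶ Y} {i' : Z ⟶ X}
    {p' : X ⟶ Z} (h : i ≫ p = 𝟙 Y) (h' : i' ≫ p' = 𝟙 Z) (h1 : i ≫ p' = 0) (h2 : i' ≫ p = 0)
    (h3 : p ≫ i + p' ≫ i' = 𝟙 X) (hY : HasSimpleDecomposition Y)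
    (hZ : HasSimpleDecomposition Z) : HasSimpleDecomposition X := by
  obtain ⟨ι, _, S, a, b, hS, hab, hne, hsum⟩ := hY
  obtain ⟨ι', _, S', a', b', hS', hab', hne', hsum'⟩ := hZ
  refine ⟨ι ⊕ ι', inferInstance, Sum.elim S S',
    fun j => match j with | .inl j => a j ≫ i | .inr j => a' j ≫ i',
    fun j => match j with | .inl j => p ≫ b j | .inr j => p' ≫ b' j, ?_, ?_, ?_, ?_⟩
  · rintro (j | j)
    exacts [hS j, hS' j]
  · rintro (j | j)
    · simpa [reassoc_of% h] using hab j
    · simpa [reassoc_of% h'] using hab' j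
  · rintro (j | j) (k | k) hjk
    · change (a j ≫ i) ≫ p ≫ b k = 0
      rw [Category.assoc, reassoc_of% h, hne j k fun e => hjk (e ▸ rfl)]
    · change (a j ≫ i) ≫ p' ≫ b' k = 0
      rw [Category.assoc, reassoc_of% h1, zero_comp, comp_zero]
    · change (a' j ≫ i') ≫ p ≫ b k = 0
      rw [Category.assoc, reassoc_of% h2, zero_comp, comp_zero]
    · change (a' j ≫ i') ≫ p' ≫ b' k = 0
      rw [Category.assoc, reassoc_of% h', hne' j k fun e => hjk (e ▸ rfl)]
  · have e1 : ∑ j, p ≫ b j ≫ a j ≫ i = p ≫ i := by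
      have : p ≫ (∑ j, b j ≫ a j) ≫ i = p ≫ i := by rw [hsum, Category.id_comp]
      rw [← this, Preadditive.sum_comp, Preadditive.comp_sum]
      simp
    have e2 : ∑ j, p' ≫ b' j ≫ a' j ≫ i' = p' ≫ i' := by
      have : p' ≫ (∑ j, b' j ≫ a' j) ≫ i' = p' ≫ i' := by rw [hsum', Category.id_comp]
      rw [← this, Preadditive.sum_comp, Preadditive.comp_sum]
      simp
    rw [Fintype.sum_sum_type]
    simpa [e1, e2] using h3

/-- If the rank drops along proper retracts, every object is a sum of simple objects. -/
theorem HasPseudoInverses.hasSimpleDecomposition (hC : HasPseudoInverses C) (r : C → ℕ)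
    (hr : ∀ ⦃Y X : C⦄ (i : Y ⟶ X) (p : X ⟶ Y), i ≫ p = 𝟙 Y → ¬ IsIso i → r Y < r X) (X : C) :
    HasSimpleDecomposition X := by
  induction hn : r X using Nat.strong_induction_on generalizing X with
  | _ n ih =>
    subst hn
    by_cases h0 : 𝟙 X = 0
    · exact ⟨Empty, inferInstance, fun j => j.elim, fun j => j.elim, fun j => j.elim,
        fun j => j.elim, fun j => j.elim, fun j => j.elim, by simpa using h0.symm⟩
    by_cases hS : Simple X
    · exact ⟨Unit, inferInstance, fun _ => X, fun _ => 𝟙 X, fun _ => 𝟙 X, fun _ => hS,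
        fun _ => by simp, fun j k h => (h rfl).elim, by simp⟩
    -- Failure of simplicity gives a monomorphism that is both zero and invertible or neither; the
    -- first case would make `𝟙 X` zero.
    have : ∃ (Y : C) (f : Y ⟶ X), Mono f ∧ ¬ (IsIso f ↔ f ≠ 0) := by
      by_contra! hcon
      exact hS ⟨fun f _ => hcon _ f inferInstance⟩
    obtain ⟨Y, f, hf, hiff⟩ := this
    have hf1 : ¬ IsIso f := by
      intro hi
      have hf0 : f = 0 := by
        by_contra hne
        exact hiff ⟨fun _ => hne, fun _ => hi⟩
      apply h0
      have : inv f ≫ f = 0 := by simp only [hf0, comp_zero]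
      rwa [IsIso.inv_hom_id] at this
    have hf0 : f ≠ 0 := fun h => hiff ⟨fun hi => (hf1 hi).elim, fun hne => (hne h).elim⟩
    obtain ⟨g, hg⟩ := hC f
    have h1 : f ≫ g = 𝟙 Y := by rw [← cancel_mono f, Category.assoc, hg, Category.id_comp]
    -- `Z` is the complement of `Y`. Both summands are proper retracts: `Y` because `f` is not
    -- invertible, `Z` because `f` is not zero, so induction on the rank applies to both.
    obtain ⟨Z, i, p, h2, h3⟩ := IsIdempotentComplete.idempotents_split X (𝟙 X - g ≫ f) (by
      simp [hg])
    have hfp : f ≫ p = 0 := by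
      have : f ≫ p ≫ i ≫ p = 0 := by rw [reassoc_of% h3]; simp [reassoc_of% h1]
      rwa [h2, Category.comp_id] at this
    have hig : i ≫ g = 0 := by
      have : i ≫ p ≫ i ≫ g = 0 := by rw [reassoc_of% h3]; simp [h1]
      rwa [reassoc_of% h2] at this
    have hi : ¬ IsIso i := by
      intro hi
      apply hf0
      have hgz : g = 0 := by rw [← cancel_epi i, hig, comp_zero]
      rw [← hg, hgz, zero_comp, comp_zero]
    exact HasSimpleDecomposition.of_splitting h1 h2 hfp hig (by rw [h3]; simp)
      (ih _ (hr f g h1 hf1) Y rfl) (ih _ (hr i p h2 hi) Z rfl)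

attribute [local instance] Abelian.hasFiniteBiproducts

theorem HasPseudoInverses.isSemisimpleCategory [HasFiniteProducts C] (hC : HasPseudoInverses C)
    (r : C → ℕ)
    (hr : ∀ ⦃Y X : C⦄ (i : Y ⟶ X) (p : X ⟶ Y), i ≫ p = 𝟙 Y → ¬ IsIso i → r Y < r X) :
    IsSemisimpleCategory C := by
  classical
  refine ⟨hC.abelian, fun X => ?_, fun X Y f _ => hC.isSplitMono f⟩
  let := hC.abelian
  obtain ⟨ι, _, S, i, p, hS, h1, h2, h3⟩ := hC.hasSimpleDecomposition r hr X
  let e := (Fintype.equivFin ι).symm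
  refine ⟨Fintype.card ι, fun j => S (e j), fun j => hS (e j), ?_⟩
  let b : Bicone (fun j => S (e j)) :=
    { pt := X
      π := fun j => p (e j)
      ι := fun j => i (e j)
      ι_π := fun j k => by
        split_ifs with hjk
        · subst hjk
          simpa using h1 (e j)
        · exact h2 _ _ fun h => hjk (e.injective h) }
  have hb : b.IsBilimit := isBilimitOfTotal b (by
    change ∑ j, p (e j) ≫ i (e j) = 𝟙 X
    rw [← h3]
    exact e.sum_comp fun j => p j ≫ i j)
  exact ⟨biproduct.uniqueUpToIso _ hb⟩

end RegularCategory

/-- The criterion for semisimplicity can be checked after an equivalence. -/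
theorem isSemisimpleCategory_of_equivalence {C D : Type*} [Category C] [Category D]
    [Preadditive D] [IsIdempotentComplete D] [HasFiniteProducts D] (hD : HasPseudoInverses D)
    (r : D → ℕ)
    (hr : ∀ ⦃Y X : D⦄ (i : Y ⟶ X) (p : X ⟶ Y), i ≫ p = 𝟙 Y → ¬ IsIso i → r Y < r X)
    (e : C ≌ D) : IsSemisimpleCategory C := by
  let : Preadditive C := Preadditive.ofFullyFaithful e.fullyFaithfulFunctor
  have : IsIdempotentComplete C :=
    (Idempotents.isIdempotentComplete_iff_of_equivalence e).2 inferInstance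
  have : HasFiniteProducts C :=
    ⟨fun n => Adjunction.hasLimitsOfShape_of_equivalence e.functor⟩
  refine HasPseudoInverses.isSemisimpleCategory (fun X Y f => ?_) (fun X => r (e.functor.obj X))
    fun Y X i p h hi => hr (e.functor.map i) (e.functor.map p)
      (by rw [← e.functor.map_comp, h, e.functor.map_id]) fun h => hi ?_
  · obtain ⟨g, hg⟩ := hD (e.functor.map f)
    exact ⟨e.functor.preimage g, e.functor.map_injective (by simpa using hg)⟩
  · exact isIso_of_reflects_iso i e.functor

/-! ### Period data and their category -/

/-- The linear data of an abelian Cousin group `E / Γ`: a complex vector space, a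
discrete subgroup of periods such that all periodic holomorphic functions are constant, and a
Hermitian form whose induced form is rational on the periods. -/
structure PeriodData : Type 1 where
  E : Type
  [normed : NormedAddCommGroup E]
  [normedSpace : NormedSpace ℂ E]
  [finDim : FiniteDimensional ℂ E]
  Γ : AddSubgroup E
  [discrete : DiscreteTopology Γ]
  form : HermitianForm E
  cousin : ∀ f : E → ℂ, Differentiable ℂ f → (∀ x, ∀ γ ∈ Γ, f (x + γ) = f x) →
    ∃ a, ∀ x, f x = a
  polar : ∀ γ ∈ Γ, ∃ q : ℚ, inducedForm form (Submodule.span ℝ (Γ : Set E)) γ γ = q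

namespace PeriodData

attribute [instance] normed normedSpace finDim discrete

variable (A B : PeriodData)

instance : FiniteDimensional ℝ A.E := FiniteDimensional.complexToReal A.E

/-- The real span of the periods. -/
def V : Submodule ℝ A.E := Submodule.span ℝ (A.Γ : Set A.E)

/-- The cocomplex part of the real span of the periods. -/
def F : Submodule ℝ A.E := cocomplexPart A.form A.V

/-- The rational span of the periods: the vectors that have a positive multiple in `Γ`. -/
def rat : AddSubgroup A.E where
  carrier := {x | ∃ n : ℕ, 0 < n ∧ n • x ∈ A.Γ}
  add_mem' := by
    rintro x y ⟨m, hm, hx⟩ ⟨n, hn, hy⟩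
    refine ⟨m * n, Nat.mul_pos hm hn, ?_⟩
    rw [nsmul_add]
    refine A.Γ.add_mem ?_ ?_
    · rw [mul_comm, mul_nsmul']
      exact A.Γ.nsmul_mem hx n
    · rw [mul_nsmul']
      exact A.Γ.nsmul_mem hy m
  zero_mem' := ⟨1, one_pos, by simp [A.Γ.zero_mem]⟩
  neg_mem' := by
    rintro x ⟨n, hn, hx⟩
    exact ⟨n, hn, by rw [smul_neg]; exact A.Γ.neg_mem hx⟩

variable {A B}

theorem le_rat : A.Γ ≤ A.rat := fun x hx => ⟨1, one_pos, by simpa using hx⟩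

theorem mem_rat_of_nsmul {n : ℕ} (hn : 0 < n) {x : A.E} (hx : n • x ∈ A.rat) : x ∈ A.rat := by
  obtain ⟨m, hm, h⟩ := hx
  exact ⟨m * n, Nat.mul_pos hm hn, by rwa [mul_nsmul']⟩

theorem mem_V_of_mem {x : A.E} (hx : x ∈ A.Γ) : x ∈ A.V := Submodule.subset_span hx

theorem mem_V_of_nsmul {n : ℕ} (hn : 0 < n) {x : A.E} (hx : n • x ∈ A.V) : x ∈ A.V := by
  have : ((n : ℝ)⁻¹) • (n • x) ∈ A.V := A.V.smul_mem _ hx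
  rwa [← Nat.cast_smul_eq_nsmul ℝ, smul_smul, inv_mul_cancel₀ (by positivity), one_smul] at this

theorem mem_V_of_mem_rat {x : A.E} (hx : x ∈ A.rat) : x ∈ A.V := by
  obtain ⟨n, hn, h⟩ := hx
  exact mem_V_of_nsmul hn (mem_V_of_mem h)

theorem F_le_V : A.F ≤ A.V := cocomplexPart_le

/-- The complex span of the periods is everything. -/
theorem eq_zero_of_forall_mem {f : A.E →ₗ[ℂ] ℂ} (hf : ∀ γ ∈ A.Γ, f γ = 0) : f = 0 := by
  -- A functional that kills the periods is a periodic holomorphic function, hence constant.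
  obtain ⟨a, ha⟩ := A.cousin f f.toContinuousLinearMap.differentiable fun x γ hγ => by
    rw [map_add, hf γ hγ, add_zero]
  ext x
  rw [ha x, ← ha 0, map_zero, LinearMap.zero_apply]

theorem span_complex_eq_top : Submodule.span ℂ (A.Γ : Set A.E) = ⊤ := by
  by_contra hne
  obtain ⟨f, hf, hle⟩ := Submodule.exists_le_ker_of_lt_top _ (lt_top_iff_ne_top.2 hne)
  exact hf (eq_zero_of_forall_mem fun γ hγ => hle (Submodule.subset_span hγ))

theorem exists_eq_add_I_smul (x : A.E) : ∃ v ∈ A.V, ∃ w ∈ A.V, x = v + Complex.I • w := by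
  have hx : x ∈ Submodule.span ℂ (A.Γ : Set A.E) := by
    rw [span_complex_eq_top]
    trivial
  induction hx using Submodule.span_induction with
  | mem x hx => exact ⟨x, mem_V_of_mem hx, 0, A.V.zero_mem, by simp⟩
  | zero => exact ⟨0, A.V.zero_mem, 0, A.V.zero_mem, by simp⟩
  | add x y _ _ hx hy =>
    obtain ⟨v, hv, w, hw, rfl⟩ := hx
    obtain ⟨v', hv', w', hw', rfl⟩ := hy
    refine ⟨v + v', A.V.add_mem hv hv', w + w', A.V.add_mem hw hw', ?_⟩
    rw [smul_add]
    abel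
  | smul c x _ hx =>
    obtain ⟨v, hv, w, hw, rfl⟩ := hx
    refine ⟨c.re • v - c.im • w, A.V.sub_mem (A.V.smul_mem _ hv) (A.V.smul_mem _ hw),
      c.re • w + c.im • v, A.V.add_mem (A.V.smul_mem _ hw) (A.V.smul_mem _ hv), ?_⟩
    have e : ∀ (r : ℝ) (y : A.E), r • y = (r : ℂ) • y := fun _ _ => rfl
    simp only [e]
    conv_lhs => rw [← Complex.re_add_im c]
    have hI : Complex.I * Complex.I = -1 := Complex.I_mul_I
    match_scalars <;> first | ring1 | linear_combination (c.im : ℂ) * hI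

theorem linearMap_ext {W : Type*} [AddCommGroup W] [Module ℂ W] {f g : A.E →ₗ[ℂ] W}
    (h : ∀ γ ∈ A.Γ, f γ = g γ) : f = g :=
  LinearMap.ext_on span_complex_eq_top h

/-! ### The category of period data -/

variable (A B) in
/-- The group of morphisms: complex linear maps that preserve the rational spans of the periods and
the cocomplex parts. -/
def homs : AddSubgroup (A.E →ₗ[ℂ] B.E) where
  carrier := {φ | (∀ γ ∈ A.Γ, φ γ ∈ B.rat) ∧ ∀ v ∈ A.F, φ v ∈ B.F}
  add_mem' := fun ha hb => ⟨fun γ hγ => B.rat.add_mem (ha.1 γ hγ) (hb.1 γ hγ),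
    fun v hv => B.F.add_mem (ha.2 v hv) (hb.2 v hv)⟩
  zero_mem' := ⟨fun _ _ => B.rat.zero_mem, fun _ _ => B.F.zero_mem⟩
  neg_mem' := fun ha => ⟨fun γ hγ => B.rat.neg_mem (ha.1 γ hγ),
    fun v hv => B.F.neg_mem (ha.2 v hv)⟩

theorem map_mem_rat {φ : A.E →ₗ[ℂ] B.E} (hφ : ∀ γ ∈ A.Γ, φ γ ∈ B.rat) {x : A.E}
    (hx : x ∈ A.rat) : φ x ∈ B.rat := by
  obtain ⟨n, hn, h⟩ := hx
  have := hφ _ h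
  rw [map_nsmul] at this
  exact mem_rat_of_nsmul hn this

instance : Category PeriodData where
  Hom A B := homs A B
  id A := ⟨LinearMap.id, fun _ hγ => le_rat hγ, fun _ hv => hv⟩
  comp f g := ⟨g.1 ∘ₗ f.1, fun γ hγ => map_mem_rat g.2.1 (f.2.1 γ hγ),
    fun v hv => g.2.2 _ (f.2.2 v hv)⟩

/-- The linear map underlying a morphism. -/
def lin (f : A ⟶ B) : A.E →ₗ[ℂ] B.E := Subtype.val f

/-- Morphisms from linear maps. -/
def ofLin (φ : A.E →ₗ[ℂ] B.E) (hφ : φ ∈ homs A B) : A ⟶ B := ⟨φ, hφ⟩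

@[simp] theorem lin_id : lin (𝟙 A) = LinearMap.id := rfl

@[simp] theorem lin_comp {D : PeriodData} (f : A ⟶ B) (g : B ⟶ D) :
    lin (f ≫ g) = lin g ∘ₗ lin f := rfl

theorem lin_injective : Function.Injective (lin : (A ⟶ B) → _) := Subtype.val_injective

theorem hom_ext {f g : A ⟶ B} (h : ∀ x, lin f x = lin g x) : f = g :=
  lin_injective (LinearMap.ext h)

theorem lin_mem_rat (f : A ⟶ B) {x : A.E} (hx : x ∈ A.rat) : lin f x ∈ B.rat :=
  map_mem_rat f.2.1 hx

theorem lin_mem_F (f : A ⟶ B) {x : A.E} (hx : x ∈ A.F) : lin f x ∈ B.F := f.2.2 x hx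

theorem lin_mem_V (f : A ⟶ B) {x : A.E} (hx : x ∈ A.V) : lin f x ∈ B.V := by
  have : A.V ≤ B.V.comap ((lin f).restrictScalars ℝ) :=
    Submodule.span_le.2 fun γ hγ => mem_V_of_mem_rat (lin_mem_rat f (le_rat hγ))
  exact this hx

theorem lin_mem_complexPart (f : A ⟶ B) {x : A.E} (hx : x ∈ complexPart A.V) :
    lin f x ∈ complexPart B.V :=
  ⟨lin_mem_V f hx.1, by rw [← map_smul]; exact lin_mem_V f hx.2⟩

instance : Preadditive PeriodData where
  homGroup A B := inferInstanceAs (AddCommGroup (homs A B))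
  add_comp _ _ _ _ _ g := hom_ext fun _ => map_add (lin g) _ _
  comp_add _ _ _ _ _ _ := rfl

@[simp] theorem lin_zsmul (n : ℤ) (f : A ⟶ B) : lin (n • f) = n • lin f := rfl

theorem mem_F_of_nsmul {n : ℕ} (hn : 0 < n) {x : A.E} (hx : n • x ∈ A.F) : x ∈ A.F := by
  have : ((n : ℝ)⁻¹) • (n • x) ∈ A.F := A.F.smul_mem _ hx
  rwa [← Nat.cast_smul_eq_nsmul ℝ, smul_smul, inv_mul_cancel₀ (by positivity), one_smul] at this

/-- Morphisms are divisible by nonzero integers. -/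
theorem exists_zsmul_eq (f : A ⟶ B) {n : ℤ} (hn : n ≠ 0) : ∃ g : A ⟶ B, n • g = f := by
  have hn' : (n : ℂ) ≠ 0 := by exact_mod_cast hn
  have hn2 : 0 < n.natAbs := Int.natAbs_pos.2 hn
  have e : ∀ x, n • (((n : ℂ)⁻¹) • lin f) x = lin f x := fun x => by
    rw [LinearMap.smul_apply, ← Int.cast_smul_eq_zsmul ℂ, smul_smul, mul_inv_cancel₀ hn', one_smul]
  have e2 : ∀ x, n.natAbs • (((n : ℂ)⁻¹) • lin f) x = n.sign • lin f x := fun x => by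
    rw [← e x, smul_smul, ← natCast_zsmul, Int.sign_mul_self_eq_natAbs]
  refine ⟨ofLin (((n : ℂ)⁻¹) • lin f) ⟨fun γ hγ => ?_, fun v hv => ?_⟩, hom_ext e⟩
  · exact mem_rat_of_nsmul hn2 (by
      rw [e2]
      exact B.rat.zsmul_mem (lin_mem_rat f (le_rat hγ)) _)
  · exact mem_F_of_nsmul hn2 (by
      rw [e2]
      exact B.F.toAddSubgroup.zsmul_mem (lin_mem_F f hv) _)

theorem zsmul_right_injective {n : ℤ} (hn : n ≠ 0) {f g : A ⟶ B} (h : n • f = n • g) : f = g := by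
  refine hom_ext fun x => ?_
  have hx := LinearMap.congr_fun (congrArg lin h) x
  have hn' : (n : ℂ) ≠ 0 := by exact_mod_cast hn
  simp only [lin_zsmul, LinearMap.smul_apply, ← Int.cast_smul_eq_zsmul ℂ] at hx
  exact smul_right_injective _ hn' hx

variable (A) in
theorem fg_Γ : A.Γ.FG := by
  have : DiscreteTopology (AddSubgroup.toIntSubmodule A.Γ) := A.discrete
  have h : Module.Finite ℤ (AddSubgroup.toIntSubmodule A.Γ) := instModuleFinite_of_discrete_submodule _
  have := Module.Finite.iff_fg.1 h
  rw [Submodule.fg_iff_addSubgroup_fg] at this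
  exact this

/-- A multiple of every morphism preserves the periods themselves. -/
theorem exists_nsmul_mem (f : A ⟶ B) : ∃ n : ℕ, 0 < n ∧ ∀ γ ∈ A.Γ, n • lin f γ ∈ B.Γ := by
  obtain ⟨S, hS⟩ := fg_Γ A
  have : ∀ s ∈ S, ∃ n : ℕ, 0 < n ∧ n • lin f s ∈ B.Γ := fun s hs =>
    lin_mem_rat f (le_rat (hS ▸ AddSubgroup.subset_closure hs))
  choose! n hn hmem using this
  refine ⟨∏ s ∈ S, n s, Finset.prod_pos hn, fun γ hγ => ?_⟩
  rw [← hS] at hγ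
  induction hγ using AddSubgroup.closure_induction with
  | mem s hs =>
    obtain ⟨k, hk⟩ := Finset.dvd_prod_of_mem n hs
    rw [hk, mul_comm, mul_nsmul']
    exact B.Γ.nsmul_mem (hmem s hs) k
  | zero => simp [B.Γ.zero_mem]
  | add x y _ _ hx hy => rw [map_add, nsmul_add]; exact B.Γ.add_mem hx hy
  | neg x _ hx => rw [map_neg, smul_neg]; exact B.Γ.neg_mem hx

end PeriodData

/-! ### Rationality, adjoints and pseudo-inverses -/

namespace PeriodData

variable {A B : PeriodData}

/-- The induced form on the real span of the periods. -/
def g (A : PeriodData) : LinearMap.BilinForm ℝ A.E := inducedBilin A.form A.V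

theorem exists_rat_g_self {x : A.E} (hx : x ∈ A.rat) : ∃ q : ℚ, A.g x x = q := by
  obtain ⟨n, hn, h⟩ := hx
  obtain ⟨q, hq⟩ := A.polar _ h
  have hn' : (n : ℝ) ≠ 0 := by positivity
  refine ⟨q / n ^ 2, ?_⟩
  have : A.g (n • x) (n • x) = q := by rw [← hq, ← inducedBilin_apply]; rfl
  rw [map_nsmul, map_nsmul, LinearMap.smul_apply] at this
  push_cast
  rw [← this]
  simp only [nsmul_eq_mul]
  field_simp

theorem exists_rat_g {x y : A.E} (hx : x ∈ A.rat) (hy : y ∈ A.rat) : ∃ q : ℚ, A.g x y = q := by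
  obtain ⟨a, ha⟩ := exists_rat_g_self hx
  obtain ⟨b, hb⟩ := exists_rat_g_self hy
  obtain ⟨c, hc⟩ := exists_rat_g_self (A.rat.add_mem hx hy)
  have hsymm : A.g y x = A.g x y := inducedBilin_comm _ _
  simp only [map_add, LinearMap.add_apply, hsymm] at hc
  refine ⟨(c - a - b) / 2, ?_⟩
  push_cast
  linarith

theorem rat_smul_mem_rat (q : ℚ) {x : A.E} (hx : x ∈ A.Γ) : (q : ℝ) • x ∈ A.rat := by
  refine ⟨q.den, q.den_pos, ?_⟩
  have : (q.den : ℝ) * q = q.num := by exact_mod_cast q.den_mul_eq_num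
  rw [← Nat.cast_smul_eq_nsmul ℝ, smul_smul, this, Int.cast_smul_eq_zsmul]
  exact A.Γ.zsmul_mem hx _

/-- A vector of the real span is rational if its products with the periods are rational. -/
theorem mem_rat_of_forall_g {x : A.E} (hx : x ∈ A.V)
    (h : ∀ γ ∈ A.Γ, ∃ q : ℚ, A.g x γ = q) : x ∈ A.rat := by
  obtain ⟨b, hb, hspan, hlin⟩ := exists_linearIndependent ℝ (A.Γ : Set A.E)
  have : Fintype b := hlin.setFinite.fintype
  have hb' : ∀ i : b, (i : A.E) ∈ A.Γ := fun i => hb i.2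
  have hzero : ∀ y ∈ A.V, (∀ i : b, A.g y i = 0) → y = 0 := fun y hy h0 => by
    refine inducedBilin_nondegenerate (h := A.form) hy fun w hw => ?_
    have hle : A.V ≤ LinearMap.ker (A.g y) := by
      change Submodule.span ℝ _ ≤ _
      rw [← hspan]
      exact Submodule.span_le.2 fun i hi => h0 ⟨i, hi⟩
    exact hle hw
  choose G hG using fun i j : b => exists_rat_g (le_rat (hb' i)) (le_rat (hb' j))
  choose r hr using fun j : b => h j (hb' j)
  let comb : (b → ℚ) → A.E := fun v => ∑ i, (v i : ℝ) • (i : A.E)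
  have hcombrat : ∀ v, comb v ∈ A.rat := fun v =>
    A.rat.sum_mem fun i _ => rat_smul_mem_rat _ (hb' i)
  have hcomb : ∀ v (j : b), A.g (comb v) j = ((Matrix.vecMul v (Matrix.of G) j : ℚ) : ℝ) := fun v (j : b) => by
    simp [comb, Matrix.vecMul, dotProduct, hG]
  classical
  -- The Gram matrix of a real basis of `V` made of periods is rational. A rational null vector
  -- would give a combination orthogonal to all of `V`, so the matrix is invertible, and solving the
  -- linear system for `x` produces rational coordinates.
  have hdet : (Matrix.of G).det ≠ 0 := by
    intro hdet
    obtain ⟨v, hv, hv0⟩ := Matrix.exists_vecMul_eq_zero_iff.2 hdet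
    have h0 := hzero (comb v) (mem_V_of_mem_rat (hcombrat v)) fun j => by
      rw [hcomb, hv0]
      simp
    have := Fintype.linearIndependent_iff.1 hlin (fun i => (v i : ℝ)) h0
    exact hv (funext fun i => by exact_mod_cast this i)
  have hx' := hzero (x - comb (Matrix.vecMul r (Matrix.of G)⁻¹))
    (A.V.sub_mem hx (mem_V_of_mem_rat (hcombrat _))) fun j => by
      rw [map_sub, LinearMap.sub_apply, hcomb, Matrix.vecMul_vecMul,
        Matrix.nonsing_inv_mul _ (isUnit_iff_ne_zero.2 hdet), Matrix.vecMul_one, hr, sub_self]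
  rw [sub_eq_zero.1 hx']
  exact hcombrat _

/-- The space is `V + √-1 V`, so the formula `v + √-1 w ↦ T v + √-1 T w` is forced. It is well
defined because two such expressions of a vector differ by elements of `V ∩ √-1 V`, where `hT` says
that `T` is complex linear. -/
theorem exists_complex_extension {W : Type*} [AddCommGroup W] [Module ℂ W] (T : A.V →ₗ[ℝ] W)
    (hT : ∀ v w : A.V, (w : A.E) = Complex.I • (v : A.E) → T w = Complex.I • T v) :
    ∃ f : A.E →ₗ[ℂ] W, ∀ v : A.V, f v = T v := by
  have key : ∀ v w v' w' : A.V, (v : A.E) + Complex.I • (w : A.E) = v' + Complex.I • (w' : A.E) →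
      T v + Complex.I • T w = T v' + Complex.I • T w' := fun v w v' w' e => by
    have h1 := hT (w - w') (v' - v) (by
      simp only [AddSubgroupClass.coe_sub, smul_sub]
      rw [sub_eq_sub_iff_add_eq_add, ← e, add_comm])
    simp only [map_sub, smul_sub] at h1
    rw [sub_eq_sub_iff_add_eq_add] at h1
    rw [h1, add_comm]
  choose re hre im him heq using fun x : A.E => exists_eq_add_I_smul x
  let F : A.E → W := fun x => T ⟨re x, hre x⟩ + Complex.I • T ⟨im x, him x⟩
  have hF : ∀ v w : A.V, F (v + Complex.I • (w : A.E)) = T v + Complex.I • T w := fun v w =>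
    key _ _ _ _ (heq _).symm
  have hI : Complex.I * Complex.I = -1 := Complex.I_mul_I
  have hreal : ∀ (r : ℝ) (y : W), r • y = (r : ℂ) • y := fun _ _ => rfl
  have hreal' : ∀ (r : ℝ) (y : A.E), r • y = (r : ℂ) • y := fun _ _ => rfl
  refine ⟨{ toFun := F, map_add' := fun x y => ?_, map_smul' := fun c x => ?_ }, fun v => ?_⟩
  · obtain ⟨v, hv, w, hw, rfl⟩ := exists_eq_add_I_smul x
    obtain ⟨v', hv', w', hw', rfl⟩ := exists_eq_add_I_smul y
    have := hF (⟨v, hv⟩ + ⟨v', hv'⟩) (⟨w, hw⟩ + ⟨w', hw'⟩)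
    have e1 := hF ⟨v, hv⟩ ⟨w, hw⟩
    have e2 := hF ⟨v', hv'⟩ ⟨w', hw'⟩
    simp only [Submodule.coe_add] at this e1 e2
    rw [e1, e2, add_add_add_comm v, ← smul_add, this, map_add, map_add, smul_add]
    abel
  · obtain ⟨v, hv, w, hw, rfl⟩ := exists_eq_add_I_smul x
    have := hF (c.re • ⟨v, hv⟩ - c.im • ⟨w, hw⟩) (c.re • ⟨w, hw⟩ + c.im • ⟨v, hv⟩)
    have e1 := hF ⟨v, hv⟩ ⟨w, hw⟩
    simp only at e1
    have e2 : c • (v + Complex.I • w) = ((c.re • ⟨v, hv⟩ - c.im • ⟨w, hw⟩ : A.V) : A.E) +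
        Complex.I • ((c.re • ⟨w, hw⟩ + c.im • ⟨v, hv⟩ : A.V) : A.E) := by
      simp only [Submodule.coe_add, AddSubgroupClass.coe_sub, Submodule.coe_smul, hreal']
      conv_lhs => rw [← Complex.re_add_im c]
      match_scalars <;> first | ring1 | linear_combination (c.im : ℂ) * hI
    rw [e1, e2, this]
    simp only [map_add, map_sub, map_smul, hreal, RingHom.id_apply]
    conv_rhs => rw [← Complex.re_add_im c]
    match_scalars <;> first | ring1 | linear_combination (-c.im : ℂ) * hI
  · have := hF v 0
    simpa using this

/-- The adjoint of a morphism, with respect to the real parts of the Hermitian forms on the real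
spans of the periods. -/
theorem exists_adjoint (f : A ⟶ B) : ∃ f' : B ⟶ A, ∀ x ∈ A.V, ∀ y ∈ B.V,
    A.form.re (lin f' y) x = B.form.re y (lin f x) := by
  let b : LinearMap.BilinForm ℝ A.V := A.form.re.restrict A.V
  have hb : b.Nondegenerate := by
    have key : ∀ x : A.V, b x x = 0 → x = 0 := fun x hx =>
      Subtype.ext (A.form.eq_zero_of_re_self hx)
    exact ⟨fun x hx => key x (hx x), fun x hx => key x (hx x)⟩
  let φ : B.V →ₗ[ℝ] Module.Dual ℝ A.V :=
    B.form.re.compl₁₂ B.V.subtype (((lin f).restrictScalars ℝ) ∘ₗ A.V.subtype)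
  let T : B.V →ₗ[ℝ] A.E := A.V.subtype ∘ₗ (b.toDual hb).symm.toLinearMap ∘ₗ φ
  have hTV : ∀ y, T y ∈ A.V := fun y => Subtype.property _
  have hT : ∀ y : B.V, ∀ x ∈ A.V, A.form.re (T y) x = B.form.re y (lin f x) := fun y x hx =>
    LinearMap.BilinForm.apply_toDual_symm_apply (B := b) (hB := hb) (φ y) ⟨x, hx⟩
  -- `T` is the adjoint of `f` on `V` for `Re h`. As `f` maps `H` to `H`, `T` maps orthogonal
  -- complements of `H` to each other; as `f` maps `F` to `F`, `T` preserves the complex parts too.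
  have hTF : ∀ y : B.V, (y : B.E) ∈ B.F → T y ∈ A.F := fun y hy => by
    refine ⟨hTV y, fun p hp => ?_⟩
    change A.form.re p (T y) = 0
    rw [A.form.re_comm, hT y p hp.1, B.form.re_comm]
    exact hy.2 _ (lin_mem_complexPart f hp)
  have hTH : ∀ y : B.V, (y : B.E) ∈ complexPart B.V → T y ∈ complexPart A.V := fun y hy => by
    obtain ⟨p, hp, q, hq, e⟩ := exists_complexPart_add_cocomplexPart A.form (hTV y)
    have h1 : A.form.re (T y) q = 0 := by
      rw [hT y q hq.1]
      exact (lin_mem_F f hq).2 _ hy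
    have h2 : A.form.re p q = 0 := hq.2 p hp
    rw [e, map_add, LinearMap.add_apply, h2, zero_add] at h1
    rw [e, A.form.eq_zero_of_re_self h1, add_zero]
    exact hp
  -- On the complex parts `√-1` is skew for `Re h` and commutes with `f`, so it commutes with the
  -- adjoint as well.
  obtain ⟨f', hf'⟩ := exists_complex_extension T fun v w e => by
    have hv : (v : B.E) ∈ complexPart B.V := ⟨v.2, by rw [← e]; exact w.2⟩
    have hw : (w : B.E) ∈ complexPart B.V := by rw [e]; exact I_smul_mem_complexPart hv
    have hd : T w - Complex.I • T v ∈ complexPart A.V :=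
      Submodule.sub_mem _ (hTH w hw) (I_smul_mem_complexPart (hTH v hv))
    rw [← sub_eq_zero]
    refine A.form.eq_zero_of_re_self ?_
    have : ∀ x ∈ complexPart A.V, A.form.re (T w - Complex.I • T v) x = 0 := fun x hx => by
      rw [map_sub, LinearMap.sub_apply, hT w x hx.1, A.form.re_I_left, hT v _ hx.2, map_smul, e,
        B.form.re_I_left, sub_self]
    exact this _ hd
  have hf'V : ∀ y ∈ B.V, f' y ∈ A.V := fun y hy => by rw [hf' ⟨y, hy⟩]; exact hTV _
  -- Both maps respect the splittings, and `g` is `Re h` with the sign changed on the complex parts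
  -- on either side, so `f'` is also the adjoint for `g`. This is the form that is rational on
  -- periods.
  have hg : ∀ y ∈ B.V, ∀ x ∈ A.V, A.g (f' y) x = B.g y (lin f x) := fun y hy x hx => by
    obtain ⟨p, hp, q, hq, rfl⟩ := exists_complexPart_add_cocomplexPart B.form hy
    obtain ⟨p', hp', q', hq', rfl⟩ := exists_complexPart_add_cocomplexPart A.form hx
    have e1 : f' p ∈ complexPart A.V := by rw [hf' ⟨p, hp.1⟩]; exact hTH _ hp
    have e2 : f' q ∈ A.F := by rw [hf' ⟨q, hq.1⟩]; exact hTF _ hq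
    rw [map_add f', map_add (lin f), g, g, inducedBilin_add_add e1 hp' e2 hq',
      inducedBilin_add_add hp (lin_mem_complexPart f hp') hq (lin_mem_F f hq'),
      hf' ⟨p, hp.1⟩, hf' ⟨q, hq.1⟩, hT _ _ hq'.1, hT _ _ hp'.1]
  refine ⟨ofLin f' ⟨fun γ hγ => ?_, fun v hv => ?_⟩, fun x hx y hy => ?_⟩
  · refine mem_rat_of_forall_g (hf'V _ (mem_V_of_mem hγ)) fun γ' hγ' => ?_
    rw [hg _ (mem_V_of_mem hγ) _ (mem_V_of_mem hγ')]
    exact exists_rat_g (le_rat hγ) (lin_mem_rat f (le_rat hγ'))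
  · rw [hf' ⟨v, F_le_V hv⟩]
    exact hTF _ hv
  · change A.form.re (f' y) x = _
    rw [hf' ⟨y, hy⟩]
    exact hT _ x hx

/-- An endomorphism that preserves the periods is integral over `ℤ`. -/
theorem exists_monic_aeval_eq_zero (t : End A) (ht : ∀ γ ∈ A.Γ, lin t γ ∈ A.Γ) :
    ∃ p : Polynomial ℤ, p.Monic ∧ Polynomial.aeval t p = 0 := by
  have : Module.Finite ℤ A.Γ := Module.Finite.iff_addGroup_fg.2
    ((AddGroup.fg_iff_addSubgroup_fg _).2 (fg_Γ A))
  let t' : Module.End ℤ A.Γ := AddMonoidHom.toIntLinearMap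
    (AddMonoidHom.mk' (fun γ => ⟨lin t γ, ht γ γ.2⟩) fun x y => Subtype.ext (map_add (lin t) _ _))
  have ht' : ∀ γ : A.Γ, (t' γ : A.E) = lin t γ := fun _ => rfl
  have hpow : ∀ (n : ℕ) (γ : A.Γ), lin (t ^ n) γ = ((t' ^ n) γ : A.Γ) := fun n => by
    induction n with
    | zero => exact fun γ => rfl
    | succ n ih =>
      intro γ
      rw [pow_succ, pow_succ, End.mul_def, lin_comp, LinearMap.comp_apply, ← ht', ih]
      rfl
  have key : ∀ (p : Polynomial ℤ) (γ : A.Γ),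
      lin (Polynomial.aeval t p) γ = (Polynomial.aeval t' p γ : A.Γ) := fun p γ => by
    induction p using Polynomial.induction_on' with
    | add p q hp hq =>
      simp only [map_add, LinearMap.add_apply, AddSubgroup.coe_add, ← hp, ← hq]
      rfl
    | monomial n a =>
      simp only [Polynomial.aeval_monomial, ← Algebra.smul_def, LinearMap.smul_apply,
        AddSubgroup.coe_zsmul, ← hpow]
      rfl
  obtain ⟨p, hp, h0⟩ := LinearMap.exists_monic_and_aeval_eq_zero ℤ t'
  -- The polynomial kills `t` on the periods, which span the space over `ℂ`.
  refine ⟨p, hp, lin_injective (linearMap_ext fun γ hγ => ?_)⟩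
  have := key p ⟨γ, hγ⟩
  rw [h0] at this
  exact this

/-- Let `t` be a multiple of `f ≫ f'` preserving the periods, and write an integral equation of `t`
as `X ^ k * q` with `c = q(0) ≠ 0`. Positivity makes the kernel of `t ^ k` on `V` die under `f`, so
`q(t) ≫ f = 0`. With `q = X * q.divX + c` and `r` the value of `q.divX` at `t`, this says `c • f =
-(t ≫ r ≫ f)`, and `t` begins with `f`, so `-(n / c) • (f' ≫ r)` is a pseudo-inverse. -/
theorem hasPseudoInverses : HasPseudoInverses PeriodData := by
  intro A B f
  obtain ⟨f', hf'⟩ := exists_adjoint f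
  obtain ⟨n, hn, hmem⟩ := exists_nsmul_mem (f ≫ f')
  let t : End A := n • (f ≫ f')
  have ht : ∀ x ∈ A.V, ∀ y ∈ A.V, A.form.re (lin t x) y = n * B.form.re (lin f x) (lin f y) :=
    fun x hx y hy => by
      have : lin t x = (n : ℝ) • lin f' (lin f x) := (Nat.cast_smul_eq_nsmul ℝ _ _).symm
      rw [this, map_smul, LinearMap.smul_apply, hf' y hy _ (lin_mem_V f hx), smul_eq_mul]
  have hn' : (n : ℝ) ≠ 0 := by positivity
  have hker : ∀ x ∈ A.V, lin t x = 0 → lin f x = 0 := fun x hx h0 => by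
    have := ht x hx x hx
    rw [h0, map_zero, LinearMap.zero_apply, eq_comm, mul_eq_zero] at this
    exact B.form.eq_zero_of_re_self (this.resolve_left hn')
  -- `t x` lies in the kernel of `f`, and `Re h(t x, t x)` is `n` times the pairing of `f x` with `f
  -- (t x) = 0`.
  have hsq : ∀ x ∈ A.V, lin t (lin t x) = 0 → lin t x = 0 := fun x hx h0 => by
    refine A.form.eq_zero_of_re_self ?_
    rw [ht x hx _ (lin_mem_V t hx), hker _ (lin_mem_V t hx) h0, map_zero, mul_zero]
  have hpow : ∀ (k : ℕ), ∀ x ∈ A.V, lin (t ^ k) x = 0 → lin t x = 0 := fun k => by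
    induction k with
    | zero =>
      intro x _ h0
      have : x = 0 := h0
      rw [this, map_zero]
    | succ k ih =>
      intro x hx h0
      rw [pow_succ, End.mul_def, lin_comp, LinearMap.comp_apply] at h0
      exact hsq x hx (ih _ (lin_mem_V t hx) h0)
  obtain ⟨p, hp, hp0⟩ := exists_monic_aeval_eq_zero t hmem
  obtain ⟨q, hq, hndvd⟩ := Polynomial.exists_eq_pow_rootMultiplicity_mul_and_not_dvd p hp.ne_zero 0
  rw [Polynomial.C_0, sub_zero] at hq hndvd
  rw [Polynomial.X_dvd_iff] at hndvd
  have hfq : (Polynomial.aeval t q : End A) ≫ f = 0 := by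
    refine lin_injective (linearMap_ext fun γ hγ => ?_)
    refine hker _ (lin_mem_V _ (mem_V_of_mem hγ)) (hpow (p.rootMultiplicity 0) _
      (lin_mem_V _ (mem_V_of_mem hγ)) ?_)
    rw [hq, map_mul, map_pow, Polynomial.aeval_X] at hp0
    exact LinearMap.congr_fun (congrArg lin hp0) γ
  set c := q.coeff 0
  set r : A ⟶ A := Polynomial.aeval t q.divX
  have hdecomp : (Polynomial.aeval t q : End A) = t ≫ r + c • 𝟙 A := by
    conv_lhs => rw [← Polynomial.divX_mul_X_add q]
    rw [map_add, map_mul, Polynomial.aeval_X, Polynomial.aeval_C, Algebra.algebraMap_eq_smul_one]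
    rfl
  obtain ⟨g, hg⟩ := exists_zsmul_eq (-(n • (f' ≫ r))) hndvd
  refine ⟨g, zsmul_right_injective hndvd ?_⟩
  rw [hdecomp, Preadditive.add_comp, Preadditive.zsmul_comp, Category.id_comp] at hfq
  rw [← Preadditive.comp_zsmul, ← Preadditive.zsmul_comp, hg, eq_neg_of_add_eq_zero_right hfq]
  simp [t, r]

end PeriodData

/-! ### Finite products and splitting of idempotents -/

namespace PeriodData

variable (A B : PeriodData)

/-! ### The zero object -/

/-- The trivial period data. -/
def trivial : PeriodData where
  E := PUnit
  Γ := ⊥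
  form :=
    { form := 0
      conj_symm := by simp
      pos := fun v hv => (hv rfl).elim }
  cousin := fun f _ _ => ⟨f 0, fun _ => rfl⟩
  polar := fun γ _ => ⟨0, by
    rw [Subsingleton.elim γ 0, ← inducedBilin_apply, map_zero, Rat.cast_zero]⟩

instance : HasTerminal PeriodData :=
  IsTerminal.hasTerminal (X := trivial) <| IsTerminal.ofUniqueHom (fun _ => 0)
    fun _ _ => hom_ext fun _ => rfl

/-! ### Products -/

/-- The orthogonal sum of two Hermitian forms. -/
def _root_.Cousin.HermitianForm.prod {T T' : Type} [AddCommGroup T] [Module ℂ T] [AddCommGroup T']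
    [Module ℂ T'] (h : HermitianForm T) (h' : HermitianForm T') : HermitianForm (T × T') where
  form := LinearMap.mk₂'ₛₗ (starRingEnd ℂ) (RingHom.id ℂ)
    (fun v w => h.form v.1 w.1 + h'.form v.2 w.2)
    (fun v v' w => by simp only [Prod.fst_add, Prod.snd_add, map_add, LinearMap.add_apply]; ring)
    (fun c v w => by simp [mul_add])
    (fun v w w' => by simp only [Prod.fst_add, Prod.snd_add, map_add]; ring)
    (fun c v w => by simp [mul_add])
  conj_symm v w := by simp [h.conj_symm, h'.conj_symm]
  pos v hv := by
    have h1 := h.re_self_nonneg v.1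
    have h2 := h'.re_self_nonneg v.2
    change 0 < (h.form v.1 v.1 + h'.form v.2 v.2).re
    rw [Complex.add_re]
    by_cases h0 : v.1 = 0
    · have : v.2 ≠ 0 := fun h0' => hv (Prod.ext h0 h0')
      exact add_pos_of_nonneg_of_pos h1 (h'.pos _ this)
    · exact add_pos_of_pos_of_nonneg (h.pos _ h0) h2

theorem _root_.Cousin.HermitianForm.prod_re {T T' : Type} [AddCommGroup T] [Module ℂ T]
    [AddCommGroup T'] [Module ℂ T'] (h : HermitianForm T) (h' : HermitianForm T') (v w : T × T') :
    (h.prod h').re v w = h.re v.1 w.1 + h'.re v.2 w.2 := by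
  simp [HermitianForm.re_apply, HermitianForm.prod]

variable {A B} in
theorem mem_span_prod {x : A.E × B.E} :
    x ∈ Submodule.span ℝ (A.Γ.prod B.Γ : Set (A.E × B.E)) ↔ x.1 ∈ A.V ∧ x.2 ∈ B.V := by
  constructor
  · intro hx
    have : Submodule.span ℝ (A.Γ.prod B.Γ : Set (A.E × B.E)) ≤ A.V.prod B.V :=
      Submodule.span_le.2 fun y hy => ⟨mem_V_of_mem hy.1, mem_V_of_mem hy.2⟩
    exact this hx
  · rintro ⟨h1, h2⟩
    have e1 : A.V ≤ (Submodule.span ℝ (A.Γ.prod B.Γ : Set (A.E × B.E))).comap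
        (LinearMap.inl ℝ A.E B.E) :=
      Submodule.span_le.2 fun y hy => Submodule.subset_span ⟨hy, B.Γ.zero_mem⟩
    have e2 : B.V ≤ (Submodule.span ℝ (A.Γ.prod B.Γ : Set (A.E × B.E))).comap
        (LinearMap.inr ℝ A.E B.E) :=
      Submodule.span_le.2 fun y hy => Submodule.subset_span ⟨A.Γ.zero_mem, hy⟩
    have : x = LinearMap.inl ℝ A.E B.E x.1 + LinearMap.inr ℝ A.E B.E x.2 := by simp
    rw [this]
    exact Submodule.add_mem _ (e1 h1) (e2 h2)

variable {A B} in
theorem mem_complexPart_prod {x : A.E × B.E} :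
    x ∈ complexPart (Submodule.span ℝ (A.Γ.prod B.Γ : Set (A.E × B.E))) ↔
      x.1 ∈ complexPart A.V ∧ x.2 ∈ complexPart B.V := by
  change (_ ∈ Submodule.span ℝ _ ∧ _ ∈ Submodule.span ℝ _) ↔ (_ ∧ _) ∧ (_ ∧ _)
  rw [mem_span_prod, mem_span_prod]
  exact and_and_and_comm

variable {A B} in
theorem mem_cocomplexPart_prod {x : A.E × B.E} :
    x ∈ cocomplexPart (A.form.prod B.form) (Submodule.span ℝ (A.Γ.prod B.Γ : Set (A.E × B.E))) ↔
      x.1 ∈ A.F ∧ x.2 ∈ B.F := by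
  rw [mem_cocomplexPart, mem_span_prod, F, F, mem_cocomplexPart, mem_cocomplexPart]
  constructor
  · rintro ⟨⟨h1, h2⟩, h⟩
    refine ⟨⟨h1, fun p hp => ?_⟩, ⟨h2, fun p hp => ?_⟩⟩
    · have := h (p, 0) (mem_complexPart_prod.2 ⟨hp, Submodule.zero_mem _⟩)
      simpa [HermitianForm.prod_re] using this
    · have := h (0, p) (mem_complexPart_prod.2 ⟨Submodule.zero_mem _, hp⟩)
      simpa [HermitianForm.prod_re] using this
  · rintro ⟨⟨h1, h1'⟩, ⟨h2, h2'⟩⟩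
    refine ⟨⟨h1, h2⟩, fun p hp => ?_⟩
    obtain ⟨hp1, hp2⟩ := mem_complexPart_prod.1 hp
    rw [HermitianForm.prod_re, h1' _ hp1, h2' _ hp2, add_zero]

/-- The product of two period data. -/
def prod : PeriodData where
  E := A.E × B.E
  Γ := A.Γ.prod B.Γ
  discrete := by
    refine DiscreteTopology.of_continuous_injective (β := A.Γ × B.Γ)
      (f := fun x => (⟨x.1.1, x.2.1⟩, ⟨x.1.2, x.2.2⟩)) ?_ ?_
    · fun_prop
    · intro x y hxy
      simp only [Prod.mk.injEq, Subtype.mk.injEq] at hxy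
      exact Subtype.ext (Prod.ext hxy.1 hxy.2)
  form := A.form.prod B.form
  cousin := fun f hf hper => by
    refine ⟨f (0, 0), fun x => ?_⟩
    obtain ⟨a, ha⟩ := A.cousin (fun y => f (y, x.2)) (by fun_prop) fun y γ hγ => by
      have := hper (y, x.2) (γ, 0) ⟨hγ, B.Γ.zero_mem⟩
      simpa using this
    obtain ⟨b, hb⟩ := B.cousin (fun y => f (0, y)) (by fun_prop) fun y γ hγ => by
      have := hper (0, y) (0, γ) ⟨A.Γ.zero_mem, hγ⟩
      simpa using this
    exact (ha x.1).trans ((ha 0).symm.trans ((hb x.2).trans (hb 0).symm))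
  polar := by
    rintro ⟨γ, γ'⟩ ⟨hγ, hγ'⟩
    obtain ⟨q, hq⟩ := exists_rat_g_self (le_rat hγ)
    obtain ⟨q', hq'⟩ := exists_rat_g_self (le_rat hγ')
    obtain ⟨p, hp, f, hf, rfl⟩ := exists_complexPart_add_cocomplexPart A.form (mem_V_of_mem hγ)
    obtain ⟨p', hp', f', hf', rfl⟩ := exists_complexPart_add_cocomplexPart B.form (mem_V_of_mem hγ')
    rw [g, inducedBilin_add_add hp hp hf hf] at hq
    rw [g, inducedBilin_add_add hp' hp' hf' hf'] at hq'
    refine ⟨q + q', ?_⟩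
    have hP := (mem_complexPart_prod (A := A) (B := B) (x := (p, p'))).2 ⟨hp, hp'⟩
    have hF := (mem_cocomplexPart_prod (A := A) (B := B) (x := (f, f'))).2 ⟨hf, hf'⟩
    rw [← inducedBilin_apply, ← Prod.mk_add_mk, inducedBilin_add_add hP hP hF hF,
      HermitianForm.prod_re, HermitianForm.prod_re]
    push_cast
    linarith

/-- The product as a binary bicone. -/
def binaryBicone : BinaryBicone A B where
  pt := prod A B
  fst := ofLin (B := A) (A := prod A B) (LinearMap.fst ℂ A.E B.E)
    ⟨fun _ hγ => le_rat hγ.1, fun _ hv => (mem_cocomplexPart_prod.1 hv).1⟩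
  snd := ofLin (B := B) (A := prod A B) (LinearMap.snd ℂ A.E B.E)
    ⟨fun _ hγ => le_rat hγ.2, fun _ hv => (mem_cocomplexPart_prod.1 hv).2⟩
  inl := ofLin (A := A) (B := prod A B) (LinearMap.inl ℂ A.E B.E)
    ⟨fun _ hγ => le_rat ⟨hγ, B.Γ.zero_mem⟩,
      fun _ hv => mem_cocomplexPart_prod.2 ⟨hv, Submodule.zero_mem _⟩⟩
  inr := ofLin (A := B) (B := prod A B) (LinearMap.inr ℂ A.E B.E)
    ⟨fun _ hγ => le_rat ⟨A.Γ.zero_mem, hγ⟩,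
      fun _ hv => mem_cocomplexPart_prod.2 ⟨Submodule.zero_mem _, hv⟩⟩
  inl_fst := hom_ext fun _ => rfl
  inl_snd := hom_ext fun _ => rfl
  inr_fst := hom_ext fun _ => rfl
  inr_snd := hom_ext fun _ => rfl

instance : HasBinaryBiproducts PeriodData where
  has_binary_biproduct A B := hasBinaryBiproduct_of_total (binaryBicone A B) <| hom_ext fun x =>
    Prod.ext (add_zero x.1) (zero_add x.2)

instance : HasFiniteProducts PeriodData := hasFiniteProducts_of_has_binary_and_terminal

/-! ### Idempotents -/

/-- The restriction of a Hermitian form to a complex subspace. -/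
def _root_.Cousin.HermitianForm.restrict {T : Type} [AddCommGroup T] [Module ℂ T]
    (h : HermitianForm T) (W : Submodule ℂ T) : HermitianForm W where
  form := LinearMap.mk₂'ₛₗ (starRingEnd ℂ) (RingHom.id ℂ) (fun v w : W => h.form v w)
    (fun v v' w => by simp) (fun c v w => by simp) (fun v w w' => by simp) (fun c v w => by simp)
  conj_symm v w := h.conj_symm v w
  pos v hv := h.pos v fun h0 => hv (Subtype.ext h0)

section Image

variable {A} (e : A ⟶ A) (he : e ≫ e = e)

/-- The periods in the image of an idempotent. -/
def imageΓ : AddSubgroup (LinearMap.range (lin e)) :=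
  A.Γ.map ((lin e).rangeRestrict : A.E →+ LinearMap.range (lin e))

variable {e}

include he in
theorem lin_eq_self_of_mem_range {w : A.E} (hw : w ∈ LinearMap.range (lin e)) :
    lin e w = w := by
  obtain ⟨x, rfl⟩ := hw
  exact LinearMap.congr_fun (congrArg lin he) x

theorem mem_rat_of_mem_imageΓ {w : LinearMap.range (lin e)} (hw : w ∈ imageΓ e) :
    (w : A.E) ∈ A.rat := by
  obtain ⟨γ, hγ, rfl⟩ := hw
  exact lin_mem_rat e (le_rat hγ)

include he in
theorem mem_span_imageΓ {w : LinearMap.range (lin e)} :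
    w ∈ Submodule.span ℝ (imageΓ e : Set (LinearMap.range (lin e))) ↔ (w : A.E) ∈ A.V := by
  constructor
  · intro hw
    have : Submodule.span ℝ (imageΓ e : Set (LinearMap.range (lin e))) ≤
        A.V.comap ((LinearMap.range (lin e)).subtype.restrictScalars ℝ) :=
      Submodule.span_le.2 fun y hy => mem_V_of_mem_rat (mem_rat_of_mem_imageΓ hy)
    exact this hw
  · intro hw
    have : A.V ≤ (Submodule.span ℝ (imageΓ e : Set (LinearMap.range (lin e)))).comap
        ((lin e).rangeRestrict.restrictScalars ℝ) :=
      Submodule.span_le.2 fun y hy => Submodule.subset_span ⟨y, hy, rfl⟩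
    have h1 := this hw
    have h2 : (lin e).rangeRestrict w = w :=
      Subtype.ext (lin_eq_self_of_mem_range he w.2)
    rw [← h2]
    exact h1

include he in
theorem mem_complexPart_imageΓ {w : LinearMap.range (lin e)} :
    w ∈ complexPart (Submodule.span ℝ (imageΓ e : Set (LinearMap.range (lin e)))) ↔
      (w : A.E) ∈ complexPart A.V := by
  change (_ ∈ Submodule.span ℝ _ ∧ _ ∈ Submodule.span ℝ _) ↔ (_ ∧ _)
  rw [mem_span_imageΓ he, mem_span_imageΓ he]
  rfl

include he in
/-- Vectors in the image of an idempotent have their complex and cocomplex components in the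
image. -/
theorem exists_add_of_mem_range {w : LinearMap.range (lin e)} (hw : (w : A.E) ∈ A.V) :
    ∃ p f : LinearMap.range (lin e), (p : A.E) ∈ complexPart A.V ∧ (f : A.E) ∈ A.F ∧
      w = p + f := by
  obtain ⟨p, hp, f, hf, h⟩ := exists_complexPart_add_cocomplexPart A.form hw
  refine ⟨⟨lin e p, p, rfl⟩, ⟨lin e f, f, rfl⟩, lin_mem_complexPart e hp, lin_mem_F e hf,
    Subtype.ext ?_⟩
  rw [← lin_eq_self_of_mem_range he w.2, h, map_add]
  rfl

include he in
theorem mem_cocomplexPart_imageΓ {w : LinearMap.range (lin e)} :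
    w ∈ cocomplexPart (A.form.restrict _)
      (Submodule.span ℝ (imageΓ e : Set (LinearMap.range (lin e)))) ↔ (w : A.E) ∈ A.F := by
  constructor
  · rintro ⟨h1, h2⟩
    obtain ⟨p, f, hp, hf, rfl⟩ := exists_add_of_mem_range he ((mem_span_imageΓ he).1 h1)
    have h3 : A.form.re p (p + f : LinearMap.range (lin e)) = 0 :=
      h2 p ((mem_complexPart_imageΓ he).2 hp)
    have h4 : A.form.re p f = 0 := hf.2 _ hp
    rw [Submodule.coe_add, map_add, h4, add_zero] at h3
    rw [Submodule.coe_add, A.form.eq_zero_of_re_self h3, zero_add]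
    exact hf
  · intro hw
    exact ⟨(mem_span_imageΓ he).2 hw.1, fun p hp => hw.2 _ ((mem_complexPart_imageΓ he).1 hp)⟩

include he in
/-- The image of an idempotent. -/
def image : PeriodData where
  E := LinearMap.range (lin e)
  Γ := imageΓ e
  discrete := by
    -- The idempotent preserves only the rational span, so its image of `Γ` need not lie in `Γ`; a
    -- multiple does, and multiplication by `n` is injective, so discreteness is inherited.
    obtain ⟨n, hn, hmem⟩ := exists_nsmul_mem e
    have hmem' : ∀ w ∈ imageΓ e, n • (w : A.E) ∈ A.Γ := by
      rintro _ ⟨γ, hγ, rfl⟩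
      exact hmem γ hγ
    refine DiscreteTopology.of_continuous_injective (β := A.Γ)
      (f := fun w => ⟨n • ((w : LinearMap.range (lin e)) : A.E), hmem' _ w.2⟩) ?_ ?_
    · fun_prop
    · intro x y hxy
      have h1 : n • ((x : LinearMap.range (lin e)) : A.E) = n • ((y : LinearMap.range (lin e)) : A.E) :=
        congrArg Subtype.val hxy
      rw [← Nat.cast_smul_eq_nsmul ℂ, ← Nat.cast_smul_eq_nsmul ℂ] at h1
      exact Subtype.ext (Subtype.ext (smul_right_injective _
        (Nat.cast_ne_zero.2 hn.ne' : (n : ℂ) ≠ 0) h1))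
  form := A.form.restrict _
  cousin := fun f hf hper => by
    obtain ⟨a, ha⟩ := A.cousin (fun x => f ((lin e).rangeRestrict x))
      (hf.comp (lin e).rangeRestrict.toContinuousLinearMap.differentiable) fun x γ hγ => by
        rw [map_add]
        exact hper _ _ ⟨γ, hγ, rfl⟩
    refine ⟨a, fun w => ?_⟩
    obtain ⟨x, rfl⟩ := (lin e).surjective_rangeRestrict w
    exact ha x
  polar := by
    intro γ hγ
    have hrat := mem_rat_of_mem_imageΓ hγ
    obtain ⟨q, hq⟩ := exists_rat_g_self hrat
    obtain ⟨p, f, hp, hf, rfl⟩ := exists_add_of_mem_range he (mem_V_of_mem_rat hrat)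
    refine ⟨q, ?_⟩
    -- The complex and cocomplex parts of the image are those of the ambient space intersected with
    -- it, so its induced form is the restriction of `g`.
    have hP := (mem_complexPart_imageΓ he).2 hp
    have hF := (mem_cocomplexPart_imageΓ he).2 hf
    rw [← hq, ← inducedBilin_apply, inducedBilin_add_add hP hP hF hF, Submodule.coe_add, g,
      inducedBilin_add_add hp hp hf hf]
    rfl

/-- The inclusion of the image of an idempotent. -/
def imageι : image he ⟶ A :=
  ofLin (A := image he) (LinearMap.range (lin e)).subtype
    ⟨fun _ hγ => mem_rat_of_mem_imageΓ hγ, fun _ hv => (mem_cocomplexPart_imageΓ he).1 hv⟩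

/-- The projection to the image of an idempotent. -/
def imageπ : A ⟶ image he :=
  ofLin (B := image he) (lin e).rangeRestrict
    ⟨fun γ hγ => le_rat (A := image he) ⟨γ, hγ, rfl⟩,
      fun _ hv => (mem_cocomplexPart_imageΓ he).2 (lin_mem_F e hv)⟩

end Image

instance : IsIdempotentComplete PeriodData where
  idempotents_split _ _ he := ⟨image he, imageι he, imageπ he,
    hom_ext fun w => Subtype.ext (lin_eq_self_of_mem_range he w.2), hom_ext fun _ => rfl⟩

theorem finrank_lt_of_retract ⦃Y X : PeriodData⦄ (i : Y ⟶ X) (p : X ⟶ Y) (h : i ≫ p = 𝟙 Y)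
    (hi : ¬ IsIso i) : Module.finrank ℂ Y.E < Module.finrank ℂ X.E := by
  have hp : ∀ y, lin p (lin i y) = y := fun y => LinearMap.congr_fun (congrArg lin h) y
  have hinj : Function.Injective (lin i) := Function.LeftInverse.injective hp
  refine lt_of_le_of_ne (LinearMap.finrank_le_finrank_of_injective hinj) fun heq => hi ?_
  have hsurj := (LinearMap.injective_iff_surjective_of_finrank_eq_finrank heq).1 hinj
  exact ⟨p, h, hom_ext fun x => by
    obtain ⟨y, rfl⟩ := hsurj x
    simp [hp]⟩

/-- A category equivalent to the category of period data is semisimple. -/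
theorem isSemisimpleCategory_of_equivalence {C : Type*} [Category C] (e : C ≌ PeriodData) :
    IsSemisimpleCategory C :=
  Cousin.isSemisimpleCategory_of_equivalence hasPseudoInverses (fun X => Module.finrank ℂ X.E)
    finrank_lt_of_retract e

end PeriodData

/-! ### Holomorphic homomorphisms and linear maps -/

namespace IsExpMap

variable {E : Type} [NormedAddCommGroup E] [NormedSpace ℂ E] [FiniteDimensional ℂ E]
  {G : Type} [Group G] [TopologicalSpace G] [ChartedSpace E G] [LieGroup 𝓘(ℂ, E) ω G]
  {π : E → G}
  {E' : Type} [NormedAddCommGroup E'] [NormedSpace ℂ E'] [FiniteDimensional ℂ E']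
  {G' : Type} [Group G'] [TopologicalSpace G'] [ChartedSpace E' G'] [LieGroup 𝓘(ℂ, E') ω G']
  {π' : E' → G'}

omit [FiniteDimensional ℂ E] [FiniteDimensional ℂ E'] in
/-- A homomorphism from a vector space to a complex Lie group with vanishing derivative at `0` is
trivial. -/
theorem _root_.Cousin.eq_one_of_hasMD_zero [T2Space G'] {q : E → G'}
    (hadd : ∀ x y, q (x + y) = q x * q y)
    (h0 : HasMD ℂ q 0 (0 : E →L[ℂ] E')) (x : E) : q x = 1 := by
  have hL : LieGroup 𝓘(ℂ, E') 1 G' := .of_le le_top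
  have hq0 := map_zero_of_map_add hadd
  have hM : IsManifold 𝓘(ℂ, E') 1 G' := hL.toIsManifold
  rw [← hq0]
  refine eq_of_hasMFDerivAt_zero (𝕜 := ℂ) (E := E) (F := E') (fun y => ?_) x 0
  obtain ⟨S, hS⟩ := HasMD.mul_left (𝕜 := ℂ) (F := E') (q y) 1
  have h1 : HasMD ℂ (fun z => z - y) y (ContinuousLinearMap.id ℂ E) :=
    ((hasFDerivAt_id y).sub_const y).hasMD
  have h2 := hS.comp (h0.comp h1 (sub_self y)) (by simp [hq0])
  have h3 : HasMD ℂ q y (0 : E →L[ℂ] E') := by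
    refine (h2.congr (by ext; simp)).congr_of_eventuallyEq (.of_forall fun z => ?_)
    change q z = q y * q (z - y)
    rw [← hadd, add_sub_cancel]
  exact h3

/-- Homomorphisms from a vector space are determined by their derivatives at `0`. -/
theorem eq_of_hasMD (hπ' : IsExpMap π') {u w : E → G'}
    (hu : ∀ x y, u (x + y) = u x * u y) (hw : ∀ x y, w (x + y) = w x * w y) {φ : E →L[ℂ] E'}
    (hu0 : HasMD ℂ u 0 φ) (hw0 : HasMD ℂ w 0 φ) (x : E) : u x = w x := by
  have hL : LieGroup 𝓘(ℂ, E') 1 G' := .of_le le_top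
  have : T2Space G' := t2Space_of_lieGroup E' G'
  have h1 : HasMD ℂ (fun y => u y * (w y)⁻¹) 0 (0 : E →L[ℂ] E') :=
    HasMD.mul_inv hu0 hw0 (by rw [map_zero_of_map_add hu, map_zero_of_map_add hw])
  have h2 := eq_one_of_hasMD_zero (fun x y => by
    rw [hu, hw, mul_inv_rev, hπ'.mul_comm (w y)⁻¹, mul_assoc, mul_assoc,
      ← mul_assoc (u y), hπ'.mul_comm (u y), mul_assoc]) h1 x
  exact mul_inv_eq_one.1 h2

/-- Exponential maps are unique. -/
theorem eq (hπ : IsExpMap π) {π₁ : E → G} (hπ₁ : IsExpMap π₁) : π = π₁ :=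
  funext fun x => hπ.eq_of_hasMD hπ.map_add hπ₁.map_add hπ.hasMD_zero hπ₁.hasMD_zero x

/-- Holomorphic homomorphisms lift to linear maps. -/
theorem exists_linear_lift (hπ : IsExpMap π) (hπ' : IsExpMap π') (f : G →* G')
    (hf : MDifferentiable 𝓘(ℂ, E) 𝓘(ℂ, E') f) :
    ∃ φ : E →ₗ[ℂ] E', ∀ x, f (π x) = π' (φ x) := by
  -- The lift is the derivative of `f` at `1`: then `f ∘ π` and `π' ∘ φ` are homomorphisms from `E`
  -- with the same derivative at `0`.
  obtain ⟨φ, hφ⟩ : ∃ φ : E →L[ℂ] E', HasMD ℂ f 1 φ := ⟨_, (hf 1).hasMD⟩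
  refine ⟨φ, fun x => hπ'.eq_of_hasMD (u := fun x => f (π x)) (w := fun x => π' (φ x)) (φ := φ)
    (fun x y => by rw [hπ.map_add, _root_.map_mul])
    (fun x y => by rw [_root_.map_add, hπ'.map_add]) ?_ ?_ x⟩
  · exact hφ.comp hπ.hasMD_zero hπ.map_zero
  · exact hπ'.hasMD_zero.comp φ.hasFDerivAt.hasMD (_root_.map_zero φ)

/-- The difference of two lifts is continuous with values in the discrete period group, and zero at
`0`. -/
theorem linear_lift_unique (hπ' : IsExpMap π') {φ ψ : E →ₗ[ℂ] E'}
    (h : ∀ x, π' (φ x) = π' (ψ x)) : φ = ψ := by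
  ext x
  have := hπ'.eq_of_forall_mem_ker (f := fun x => φ x - ψ x)
    (φ.toContinuousLinearMap.continuous.sub ψ.toContinuousLinearMap.continuous)
    (fun x => hπ'.eq_iff_sub_mem_ker.1 (h x)) x 0
  simpa [sub_eq_zero] using this

theorem hasMD_frame_of_lift (hπ : IsExpMap π) (hπ' : IsExpMap π') {f : G →* G'}
    {φ : E →ₗ[ℂ] E'} (hφ : ∀ x, f (π x) = π' (φ x)) {x : E} {D : E →L[ℂ] E'}
    (hD : HasMD ℂ f (π x) D) (v : E) : D (frame E (π x) v) = frame E' (f (π x)) (φ v) := by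
  have h1 := hD.comp (hπ.hasMD x) rfl
  have h2 := (hπ'.hasMD (φ x)).comp (φ.toContinuousLinearMap.hasFDerivAt (x := x)).hasMD rfl
  simp only [hφ] at h1
  have h3 := congrArg (fun A : E →L[ℂ] E' => A v) (h1.unique h2)
  rw [hφ]
  exact h3

theorem map_ker_of_lift (hπ : IsExpMap π) (hπ' : IsExpMap π') {f : G →* G'}
    {φ : E →ₗ[ℂ] E'} (hφ : ∀ x, f (π x) = π' (φ x)) {γ : E} (hγ : γ ∈ hπ.ker) : φ γ ∈ hπ'.ker := by
  rw [hπ'.mem_ker, ← hφ, hπ.mem_ker.1 hγ, _root_.map_one]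

/-- Linear maps that preserve the periods descend to holomorphic homomorphisms. -/
theorem exists_descent (hπ : IsExpMap π) (hπ' : IsExpMap π') (φ : E →ₗ[ℂ] E')
    (hφ : ∀ γ ∈ hπ.ker, φ γ ∈ hπ'.ker) :
    ∃ f : G →* G', MDifferentiable 𝓘(ℂ, E) 𝓘(ℂ, E') f ∧ ∀ x, f (π x) = π' (φ x) := by
  choose s hs using hπ.surjective
  have key : ∀ x, π' (φ (s (π x))) = π' (φ x) := fun x => by
    rw [hπ'.eq_iff_sub_mem_ker, ← _root_.map_sub]
    exact hφ _ (hπ.eq_iff_sub_mem_ker.1 (hs _))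
  let f : G →* G' := MonoidHom.mk' (fun y => π' (φ (s y))) fun y z => by
    obtain ⟨u, rfl⟩ := hπ.surjective y
    obtain ⟨v, rfl⟩ := hπ.surjective z
    rw [← hπ.map_add, key, key, key, _root_.map_add, hπ'.map_add]
  refine ⟨f, hπ.mdifferentiable_of_comp ?_, key⟩
  have : (fun x => f (π x)) = fun x => π' (φ x) := funext key
  rw [this]
  exact (hπ'.contMDiff.mdifferentiable (by simp)).comp
    φ.toContinuousLinearMap.differentiable.mdifferentiable

end IsExpMap

/-! ### From groups to period data -/

namespace AbelianCousinGroup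

variable (A B : AbelianCousinGroup)

/-- The exponential map. -/
def exp : A.E → A.G := (exists_isExpMap A.cousin).choose

theorem isExpMap_exp : IsExpMap A.exp := (exists_isExpMap A.cousin).choose_spec

/-- The period data of an abelian Cousin group. -/
@[reducible]
def periodData : PeriodData where
  E := A.E
  Γ := A.isExpMap_exp.ker
  discrete := isDiscrete_iff_discreteTopology.1 A.isExpMap_exp.isDiscrete_ker
  form := IsExpMap.formAtOne A.metric
  cousin := A.isExpMap_exp.onlyConstantFunctions_iff.1 A.cousin
  polar := (A.isExpMap_exp.isPolarized_iff A.metric_left_invariant).1 A.polarized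

variable {A B}

theorem mem_periodData_Γ {x : A.E} : x ∈ A.periodData.Γ ↔ A.exp x = 1 := Iff.rfl

theorem exp_mem_maxCompact_iff {x : A.E} : A.exp x ∈ maxCompact A.G ↔ x ∈ A.periodData.V :=
  A.isExpMap_exp.mem_maxCompact_iff

theorem mem_cocomplex_exp {x : A.E} (hx : x ∈ A.periodData.V)
    {v : TangentSpace 𝓘(ℂ, A.E) (A.exp x)} :
    v ∈ A.cocomplex (A.exp x) ↔ ∃ w ∈ A.periodData.F, IsExpMap.frameAt (A.exp x) w = v :=
  A.isExpMap_exp.mem_cocomplexPart_iff A.metric_left_invariant hx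

/-- A holomorphic homomorphism is bi-CR on the maximal compact subgroups if and only if its
linear lift preserves the cocomplex parts. -/
theorem map_cocomplex_iff {f : A.G →* B.G} (hf : MDifferentiable 𝓘(ℂ, A.E) 𝓘(ℂ, B.E) f)
    {φ : A.E →ₗ[ℂ] B.E} (hφ : ∀ x, f (A.exp x) = B.exp (φ x)) :
    (∀ x ∈ maxCompact A.G, ∀ v ∈ A.cocomplex x,
      mfderiv 𝓘(ℂ, A.E) 𝓘(ℂ, B.E) f x v ∈ B.cocomplex (f x)) ↔
      ∀ w ∈ A.periodData.F, φ w ∈ B.periodData.F := by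
  have hφV : ∀ x ∈ A.periodData.V, φ x ∈ B.periodData.V := fun x hx => by
    have : A.periodData.V ≤ B.periodData.V.comap (φ.restrictScalars ℝ) :=
      Submodule.span_le.2 fun γ hγ => PeriodData.mem_V_of_mem
        (A.isExpMap_exp.map_ker_of_lift B.isExpMap_exp hφ hγ)
    exact this hx
  have hD : ∀ x, HasMD ℂ f x (show A.E →L[ℂ] B.E from mfderiv 𝓘(ℂ, A.E) 𝓘(ℂ, B.E) f x) :=
    fun x => (hf x).hasMD
  -- In the left invariant frames the differential of `f` is `φ` at every point, so the condition
  -- does not depend on the point.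
  have key : ∀ x ∈ A.periodData.V, ∀ w : A.E, (mfderiv 𝓘(ℂ, A.E) 𝓘(ℂ, B.E) f (A.exp x)
      (IsExpMap.frameAt (A.exp x) w) ∈ B.cocomplex (f (A.exp x)) ↔ φ w ∈ B.periodData.F) :=
    fun x hx w => by
      have e : mfderiv 𝓘(ℂ, A.E) 𝓘(ℂ, B.E) f (A.exp x) (IsExpMap.frameAt (A.exp x) w) =
          IsExpMap.frameAt (E := B.E) (f (A.exp x)) (φ w) :=
        A.isExpMap_exp.hasMD_frame_of_lift B.isExpMap_exp hφ (hD _) w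
      rw [e]
      rw [hφ, mem_cocomplex_exp (hφV x hx)]
      constructor
      · rintro ⟨w', hw', e'⟩
        have e2 : w' = φ w := IsExpMap.frame_injective (E := B.E) (B.exp (φ x)) e'
        rwa [← e2]
      · exact fun h => ⟨_, h, rfl⟩
  constructor
  · intro H w hw
    have h0 : (0 : A.E) ∈ A.periodData.V := Submodule.zero_mem _
    exact (key 0 h0 w).1 (H _ (exp_mem_maxCompact_iff.2 h0) _ ((mem_cocomplex_exp h0).2 ⟨w, hw, rfl⟩))
  · intro H x hx v hv
    obtain ⟨y, rfl⟩ := A.isExpMap_exp.surjective x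
    have hy := exp_mem_maxCompact_iff.1 hx
    obtain ⟨w, hw, rfl⟩ := (mem_cocomplex_exp hy).1 hv
    exact (key y hy w).2 (H w hw)

theorem exists_lift (f : A ⟶ B) : ∃ φ : A.periodData ⟶ B.periodData,
    ∀ x : A.E, Hom.toHom f (A.exp x) = B.exp (PeriodData.lin φ x) := by
  obtain ⟨φ, hφ⟩ := A.isExpMap_exp.exists_linear_lift B.isExpMap_exp (Hom.toHom f)
    (Hom.holomorphic f)
  have hΓ : ∀ γ ∈ A.periodData.Γ, φ γ ∈ B.periodData.Γ :=
    fun γ hγ => A.isExpMap_exp.map_ker_of_lift B.isExpMap_exp hφ hγ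
  exact ⟨PeriodData.ofLin (A := A.periodData) (B := B.periodData) φ
    ⟨fun γ hγ => PeriodData.le_rat (hΓ γ hγ),
      (map_cocomplex_iff (Hom.holomorphic f) hφ).1 (Hom.map_cocomplex f)⟩, hφ⟩

/-- The linear lift of a morphism. -/
def lift (f : A ⟶ B) : A.periodData ⟶ B.periodData := (exists_lift f).choose

theorem toHom_exp (f : A ⟶ B) (x : A.E) :
    Hom.toHom f (A.exp x) = B.exp (PeriodData.lin (lift f) x) := (exists_lift f).choose_spec x

theorem eq_lift {f : A ⟶ B} {φ : A.periodData ⟶ B.periodData}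
    (h : ∀ x : A.E, Hom.toHom f (A.exp x) = B.exp (PeriodData.lin φ x)) : φ = lift f :=
  PeriodData.lin_injective (B.isExpMap_exp.linear_lift_unique
    (φ := PeriodData.lin φ) (ψ := PeriodData.lin (lift f)) fun x => by rw [← h, toHom_exp])

theorem lift_injective : Function.Injective (lift : (A ⟶ B) → _) := fun f g h => by
  refine Hom.ext (MonoidHom.ext fun y => ?_)
  obtain ⟨x, rfl⟩ := A.isExpMap_exp.surjective y
  rw [toHom_exp, toHom_exp, h]

theorem exists_lift_eq (φ : A.periodData ⟶ B.periodData)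
    (hφ : ∀ γ ∈ A.periodData.Γ, PeriodData.lin φ γ ∈ B.periodData.Γ) :
    ∃ f : A ⟶ B, lift f = φ := by
  obtain ⟨f, hf, h⟩ := A.isExpMap_exp.exists_descent B.isExpMap_exp (PeriodData.lin φ) hφ
  let f' : Hom A B :=
    { toHom := f
      holomorphic := hf
      map_cocomplex := (map_cocomplex_iff hf h).2 fun _ hw => PeriodData.lin_mem_F φ hw }
  exact ⟨f', (eq_lift (f := f') h).symm⟩

end AbelianCousinGroup

/-! ### Criteria for surjectivity and invertibility -/

namespace PeriodData

variable {A B : PeriodData}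

theorem countable_Γ (A : PeriodData) : (A.Γ : Set A.E).Countable := by
  have := FiniteDimensional.proper ℂ A.E
  exact Set.countable_coe_iff.1 (countable_of_Lindelof_of_discrete (X := A.Γ))

/-- If the range of a linear map meets all translates of the periods, it is everything. -/
theorem surjective_of_forall_exists_sub_mem {W : Type*} [AddCommGroup W] [Module ℂ W]
    (φ : W →ₗ[ℂ] B.E) (h : ∀ y, ∃ x, y - φ x ∈ B.Γ) : Function.Surjective φ := by
  rw [← LinearMap.range_eq_top]
  by_contra hne
  obtain ⟨l, hl, hle⟩ := Submodule.exists_le_ker_of_lt_top _ (lt_top_iff_ne_top.2 hne)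
  -- A nonzero functional vanishing on the range would map the countable set of periods onto `ℂ`.
  refine not_countable_complex ((B.countable_Γ.image l).mono fun z _ => ?_)
  obtain ⟨y, rfl⟩ := LinearMap.surjective hl z
  obtain ⟨x, hx⟩ := h y
  refine ⟨y - φ x, hx, ?_⟩
  have : l (φ x) = 0 := hle ⟨x, rfl⟩
  rw [map_sub, this, sub_zero]

/-- A bijective morphism is an isomorphism if the periods are images of rational vectors. -/
theorem isIso_of_bijective (f : A ⟶ B) (hf : Function.Bijective (lin f))
    (h : ∀ x, lin f x ∈ B.Γ → x ∈ A.rat) : IsIso f := by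
  let e : A.E ≃ₗ[ℂ] B.E := LinearEquiv.ofBijective (lin f) hf
  have he : ∀ y, lin f (e.symm y) = y := e.apply_symm_apply
  have hrat : ∀ γ ∈ B.Γ, e.symm γ ∈ A.rat := fun γ hγ => h _ (by rwa [he])
  have hV : ∀ y ∈ B.V, e.symm y ∈ A.V := fun y hy => by
    have : B.V ≤ A.V.comap (e.symm.toLinearMap.restrictScalars ℝ) :=
      Submodule.span_le.2 fun γ hγ => mem_V_of_mem_rat (hrat γ hγ)
    exact this hy
  -- The complex component `p` of the preimage is sent into both the complex and the cocomplex part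
  -- of `B`, which are orthogonal, so it is zero.
  have hF : ∀ y ∈ B.F, e.symm y ∈ A.F := fun y hy => by
    obtain ⟨p, hp, q, hq, hpq⟩ := exists_complexPart_add_cocomplexPart A.form (hV y hy.1)
    have h1 : lin f p = y - lin f q := by rw [← he y, hpq, map_add, add_sub_cancel_right]
    have h2 : lin f p ∈ B.F := by rw [h1]; exact B.F.sub_mem hy (lin_mem_F f hq)
    have h3 : lin f p = 0 :=
      B.form.eq_zero_of_re_self (h2.2 _ (lin_mem_complexPart f hp))
    rw [hpq, hf.1 (h3.trans (map_zero _).symm), zero_add]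
    exact hq
  exact ⟨ofLin (A := B) (B := A) e.symm.toLinearMap ⟨hrat, hF⟩,
    hom_ext e.symm_apply_apply, hom_ext he⟩

end PeriodData

/-! ### Isogenies and the universal property -/

namespace AbelianCousinGroup

variable {A B : AbelianCousinGroup}

@[simp] theorem lift_id : lift (𝟙 A) = 𝟙 A.periodData :=
  (eq_lift fun _ => rfl).symm

@[simp] theorem lift_comp {D : AbelianCousinGroup} (f : A ⟶ B) (g : B ⟶ D) :
    lift (f ≫ g) = lift f ≫ lift g :=
  (eq_lift fun x => by
    change Hom.toHom g (Hom.toHom f _) = _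
    rw [toHom_exp, toHom_exp]
    rfl).symm

/-- Isogenies become isomorphisms on period data. -/
theorem isIso_lift (f : A ⟶ B) (hf : isogenies f) : IsIso (lift f) := by
  obtain ⟨hsurj, hfin⟩ := hf
  -- Such an `x` represents an element of the finite kernel, which is killed by the order of the
  -- kernel.
  have hker : ∀ x : A.E, PeriodData.lin (lift f) x ∈ B.periodData.Γ →
      Nat.card (Hom.toHom f).ker • x ∈ A.periodData.Γ := fun x hx => by
    have h1 : A.exp x ∈ (Hom.toHom f).ker := by
      rw [MonoidHom.mem_ker, toHom_exp]
      exact hx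
    rw [mem_periodData_Γ, A.isExpMap_exp.map_nsmul]
    exact congrArg Subtype.val (pow_card_eq_one' (x := (⟨_, h1⟩ : (Hom.toHom f).ker)))
  have hn : 0 < Nat.card (Hom.toHom f).ker := Nat.card_pos
  refine PeriodData.isIso_of_bijective _ ⟨?_, ?_⟩ fun x hx => ⟨_, hn, hker x hx⟩
  · rw [injective_iff_map_eq_zero]
    intro x hx
    -- If the lift kills `x` it kills the whole real line through `x`, and a multiple of this line
    -- would lie in the discrete group of periods.
    have h1 := A.isExpMap_exp.eq_of_forall_mem_ker
      (f := fun t : ℝ => Nat.card (Hom.toHom f).ker • (t • x)) (by fun_prop) (fun t => hker _ (by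
        have : PeriodData.lin (lift f) (t • x) = 0 := by
          change PeriodData.lin (lift f) ((t : ℂ) • x) = 0
          rw [map_smul, hx, smul_zero]
        rw [this]
        exact AddSubgroup.zero_mem _)) 1 0
    simp only [one_smul, zero_smul, smul_zero] at h1
    rw [← Nat.cast_smul_eq_nsmul ℂ, smul_eq_zero] at h1
    exact h1.resolve_left (Nat.cast_ne_zero.2 hn.ne')
  · refine PeriodData.surjective_of_forall_exists_sub_mem _ fun y => ?_
    obtain ⟨z, hz⟩ := hsurj (B.exp y)
    obtain ⟨x, rfl⟩ := A.isExpMap_exp.surjective z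
    rw [toHom_exp] at hz
    exact ⟨x, B.isExpMap_exp.eq_iff_sub_mem_ker.1 hz.symm⟩

/-- Multiplication by a natural number. -/
theorem exists_mulBy (A : AbelianCousinGroup) (n : ℕ) :
    ∃ f : A ⟶ A, lift f = n • 𝟙 A.periodData :=
  exists_lift_eq _ fun _ hγ => A.periodData.Γ.nsmul_mem hγ n

/-- Multiplication by a natural number. -/
def mulBy (A : AbelianCousinGroup) (n : ℕ) : A ⟶ A := (exists_mulBy A n).choose

theorem lift_mulBy (n : ℕ) : lift (A.mulBy n) = n • 𝟙 A.periodData := (exists_mulBy A n).choose_spec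

theorem mulBy_one : A.mulBy 1 = 𝟙 A := lift_injective (by rw [lift_mulBy, lift_id, one_nsmul])

theorem mulBy_mul (m n : ℕ) : A.mulBy (m * n) = A.mulBy m ≫ A.mulBy n :=
  lift_injective (by
    rw [lift_comp, lift_mulBy, lift_mulBy, lift_mulBy, Preadditive.nsmul_comp, Category.id_comp,
      smul_smul])

theorem mulBy_comp (n : ℕ) (f : A ⟶ B) : A.mulBy n ≫ f = f ≫ B.mulBy n :=
  lift_injective (by
    rw [lift_comp, lift_comp, lift_mulBy, lift_mulBy, Preadditive.nsmul_comp,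
      Preadditive.comp_nsmul, Category.id_comp, Category.comp_id])

/-- `exp x ↦ n x` embeds the kernel into `Γ / nΓ`, a finitely generated torsion group, hence finite.
Surjectivity is division by `n` in `E`. -/
theorem isogenies_mulBy {n : ℕ} (hn : 0 < n) : isogenies (A.mulBy n) := by
  have h : ∀ x : A.E, Hom.toHom (A.mulBy n) (A.exp x) = A.exp (n • x) := fun x => by
    rw [toHom_exp, lift_mulBy]
    rfl
  have hn' : (n : ℂ) ≠ 0 := Nat.cast_ne_zero.2 hn.ne'
  constructor
  · intro y
    obtain ⟨x, rfl⟩ := A.isExpMap_exp.surjective y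
    refine ⟨A.exp ((n : ℂ)⁻¹ • x), ?_⟩
    rw [h, ← Nat.cast_smul_eq_nsmul ℂ, smul_smul, mul_inv_cancel₀ hn', one_smul]
  · have hfg : AddGroup.FG A.periodData.Γ :=
      (AddGroup.fg_iff_addSubgroup_fg _).2 (PeriodData.fg_Γ A.periodData)
    let N : AddSubgroup A.periodData.Γ := (nsmulAddMonoidHom n).range
    have hN : Finite (A.periodData.Γ ⧸ N) := by
      have := AddCommGroup.finite_of_fg_isAddTorsion (A.periodData.Γ ⧸ N) fun x => by
        obtain ⟨γ, rfl⟩ := QuotientAddGroup.mk_surjective x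
        refine isOfFinAddOrder_iff_nsmul_eq_zero.2 ⟨n, hn, ?_⟩
        rw [← QuotientAddGroup.mk_nsmul, QuotientAddGroup.eq_zero_iff]
        exact ⟨γ, rfl⟩
      exact this
    choose s hs using A.isExpMap_exp.surjective
    have hs' : ∀ y ∈ (Hom.toHom (A.mulBy n)).ker, n • s y ∈ A.periodData.Γ := fun y hy => by
      rw [mem_periodData_Γ, ← h, hs]
      exact hy
    refine Finite.of_injective (β := A.periodData.Γ ⧸ N)
      (fun y => QuotientAddGroup.mk ⟨n • s y, hs' y y.2⟩) fun y z hyz => ?_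
    obtain ⟨γ, hγ⟩ := QuotientAddGroup.eq.1 hyz
    have h1 : n • (γ : A.E) = -(n • s y) + n • s z := congrArg Subtype.val hγ
    have h2 : n • (γ : A.E) = n • (s z - s y) := by rw [h1, smul_sub]; abel
    rw [← Nat.cast_smul_eq_nsmul ℂ, ← Nat.cast_smul_eq_nsmul ℂ] at h2
    have h3 : (γ : A.E) = s z - s y := smul_right_injective _ hn' h2
    refine Subtype.ext ?_
    rw [← hs y, ← hs z, eq_comm, A.isExpMap_exp.eq_iff_sub_mem_ker, ← h3]
    exact γ.2

/-- Every morphism of period data becomes a morphism of groups after multiplication by a positive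
number. -/
theorem exists_lift_eq_nsmul (φ : A.periodData ⟶ B.periodData) :
    ∃ (n : ℕ) (f : A ⟶ B), 0 < n ∧ lift f = n • φ := by
  obtain ⟨n, hn, h⟩ := PeriodData.exists_nsmul_mem φ
  obtain ⟨f, hf⟩ := exists_lift_eq (n • φ) h
  exact ⟨n, f, hn, hf⟩

/-! ### The localization -/

/-- Abelian Cousin groups, with the morphisms of their period data. -/
abbrev Rational := InducedCategory PeriodData periodData

/-- The functor to period data. -/
def toRational : AbelianCousinGroup ⥤ Rational where
  obj A := A
  map f := InducedCategory.homMk (lift f)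
  map_id _ := InducedCategory.hom_ext lift_id
  map_comp f g := InducedCategory.hom_ext (lift_comp f g)

section Lift

variable {D : Type*} [Category D] (Φ : AbelianCousinGroup ⥤ D) (hΦ : isogenies.IsInvertedBy Φ)

-- A morphism of period data is a fraction `f / n`, so its image has to be `Φ(n)⁻¹ Φ(f)`. Two
-- fractions `f / n` and `g / m` for the same `φ` satisfy `n g = m f`, so one `u` serves for all of
-- them; it is unique because `Φ(n)` is invertible.
include hΦ in
theorem existsUnique_map (φ : A.periodData ⟶ B.periodData) :
    ∃ u : Φ.obj A ⟶ Φ.obj B, ∀ (n : ℕ) (f : A ⟶ B), 0 < n → lift f = n • φ →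
      Φ.map (A.mulBy n) ≫ u = Φ.map f := by
  obtain ⟨m, g, hm, hg⟩ := exists_lift_eq_nsmul φ
  have : IsIso (Φ.map (A.mulBy m)) := hΦ _ (isogenies_mulBy hm)
  refine ⟨inv (Φ.map (A.mulBy m)) ≫ Φ.map g, fun n f _ hf => ?_⟩
  have h1 : A.mulBy n ≫ g = A.mulBy m ≫ f := lift_injective (by
    rw [lift_comp, lift_comp, lift_mulBy, lift_mulBy, hf, hg]
    simp [smul_smul, mul_comm])
  have h2 : A.mulBy n ≫ A.mulBy m = A.mulBy m ≫ A.mulBy n := mulBy_comp n _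
  rw [← cancel_epi (Φ.map (A.mulBy m)), ← Φ.map_comp_assoc, ← h2, Φ.map_comp_assoc,
    IsIso.hom_inv_id_assoc, ← Φ.map_comp, ← Φ.map_comp, h1]

/-- The extension to morphisms of period data of a functor that inverts the isogenies. -/
def liftMap (φ : A.periodData ⟶ B.periodData) : Φ.obj A ⟶ Φ.obj B :=
  (existsUnique_map Φ hΦ φ).choose

theorem map_mulBy_comp_liftMap {φ : A.periodData ⟶ B.periodData} {n : ℕ} {f : A ⟶ B} (hn : 0 < n)
    (hf : lift f = n • φ) : Φ.map (A.mulBy n) ≫ liftMap Φ hΦ φ = Φ.map f :=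
  (existsUnique_map Φ hΦ φ).choose_spec n f hn hf

theorem liftMap_lift (f : A ⟶ B) : liftMap Φ hΦ (lift f) = Φ.map f := by
  have := map_mulBy_comp_liftMap Φ hΦ one_pos (one_nsmul (lift f)).symm
  rwa [mulBy_one, Φ.map_id, Category.id_comp] at this

theorem liftMap_comp {B' : AbelianCousinGroup} (φ : A.periodData ⟶ B.periodData)
    (ψ : B.periodData ⟶ B'.periodData) :
    liftMap Φ hΦ (φ ≫ ψ) = liftMap Φ hΦ φ ≫ liftMap Φ hΦ ψ := by
  obtain ⟨n, f, hn, hf⟩ := exists_lift_eq_nsmul φ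
  obtain ⟨m, g, hm, hg⟩ := exists_lift_eq_nsmul ψ
  have hmn : 0 < m * n := Nat.mul_pos hm hn
  have : IsIso (Φ.map (A.mulBy (m * n))) := hΦ _ (isogenies_mulBy hmn)
  rw [← cancel_epi (Φ.map (A.mulBy (m * n))), map_mulBy_comp_liftMap Φ hΦ hmn (f := f ≫ g) (by
    rw [lift_comp, hf, hg]; simp [smul_smul]), mulBy_mul, Φ.map_comp_assoc,
    ← Category.assoc (Φ.map (A.mulBy n)), map_mulBy_comp_liftMap Φ hΦ hn hf,
    ← Φ.map_comp_assoc, mulBy_comp, Φ.map_comp_assoc, map_mulBy_comp_liftMap Φ hΦ hm hg,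
    Φ.map_comp]

/-- The functor on `Rational` induced by a functor that inverts the isogenies. -/
def liftFunctor : Rational ⥤ D where
  obj A := Φ.obj A
  map φ := liftMap Φ hΦ φ.hom
  map_id A := by
    have := liftMap_lift Φ hΦ (CategoryStruct.id (obj := AbelianCousinGroup) A)
    rw [lift_id, Φ.map_id] at this
    exact this
  map_comp φ ψ := liftMap_comp Φ hΦ φ.hom ψ.hom

end Lift

theorem isInvertedBy_toRational : isogenies.IsInvertedBy toRational := fun A B f hf => by
  have : IsIso ((inducedFunctor periodData).map (toRational.map f)) := isIso_lift f hf
  exact isIso_of_reflects_iso _ (inducedFunctor periodData)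

/-- The strict universal property of `toRational`. -/
def strictUniversalProperty (D : Type*) [Category D] :
    Localization.StrictUniversalPropertyFixedTarget toRational isogenies D where
  inverts := isInvertedBy_toRational
  lift Φ hΦ := liftFunctor Φ hΦ
  -- The objects of `Rational` are the groups themselves, which is why the factorization is an
  -- equality of functors and not only an isomorphism.
  fac Φ hΦ := CategoryTheory.Functor.ext (fun _ => rfl) fun A B f => by
    change liftMap Φ hΦ (lift f) = 𝟙 _ ≫ Φ.map f ≫ 𝟙 _
    rw [Category.id_comp, Category.comp_id, liftMap_lift]
  uniq F₁ F₂ h := CategoryTheory.Functor.ext (fun A => CategoryTheory.Functor.congr_obj h A) fun A B φ => by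
    obtain ⟨n, f, hn, hf⟩ := exists_lift_eq_nsmul φ.hom
    let s : A ⟶ A := toRational.map (mulBy A n)
    let t : A ⟶ B := toRational.map f
    have hs : IsIso s := isInvertedBy_toRational _ (isogenies_mulBy hn)
    -- Writing `φ` as a fraction with invertible denominator `s` forces the value of any functor at
    -- `φ` from its values on morphisms of groups.
    have hφ : s ≫ φ = t := InducedCategory.hom_ext (by
      change lift (mulBy A n) ≫ φ.hom = lift f
      rw [hf, lift_mulBy, Preadditive.nsmul_comp, Category.id_comp])
    have hobj : ∀ X : Rational, F₁.obj X = F₂.obj X := fun X =>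
      CategoryTheory.Functor.congr_obj h X
    have h1 : F₁.map t = eqToHom (hobj A) ≫ F₂.map t ≫ eqToHom (hobj B).symm :=
      CategoryTheory.Functor.congr_hom h f
    have h2 : F₁.map s = eqToHom (hobj A) ≫ F₂.map s ≫ eqToHom (hobj A).symm :=
      CategoryTheory.Functor.congr_hom h (mulBy A n)
    change F₁.map φ = eqToHom (hobj A) ≫ F₂.map φ ≫ eqToHom (hobj B).symm
    rw [← cancel_epi (F₁.map s), ← F₁.map_comp, hφ, h1, h2, ← hφ, F₂.map_comp]
    simp

instance : toRational.IsLocalization isogenies :=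
  Functor.IsLocalization.mk' _ _ (strictUniversalProperty _) (strictUniversalProperty _)

end AbelianCousinGroup

/-! ### Realization of period data by groups -/

namespace PeriodData

/-- The abelian Cousin group with given period data. -/
def toCousin (P : PeriodData) : AbelianCousinGroup where
  E := P.E
  G := DiscreteQuotient P.Γ
  cousin := (DiscreteQuotient.isExpMap_mk P.Γ).onlyConstantFunctions_iff.2 (by
    rw [DiscreteQuotient.ker_isExpMap_mk]
    exact P.cousin)
  metric := DiscreteQuotient.metric P.Γ P.form
  metric_left_invariant := DiscreteQuotient.isLeftInvariant_metric P.Γ P.form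
  polarized := ((DiscreteQuotient.isExpMap_mk P.Γ).isPolarized_iff
    (DiscreteQuotient.isLeftInvariant_metric P.Γ P.form)).2 (by
      rw [IsExpMap.span, DiscreteQuotient.ker_isExpMap_mk]
      exact P.polar)

/-- Exponential maps are unique, so the chosen one of `E / Γ` is the projection and its kernel is
`Γ`; the form at the identity is the given one by construction. -/
theorem periodData_toCousin (P : PeriodData) : P.toCousin.periodData = P := by
  have h : P.toCousin.isExpMap_exp.ker = P.Γ := by
    rw [← DiscreteQuotient.ker_isExpMap_mk P.Γ]
    have := P.toCousin.isExpMap_exp.eq (DiscreteQuotient.isExpMap_mk P.Γ)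
    ext x
    change P.toCousin.exp x = 1 ↔ DiscreteQuotient.mk P.Γ x = 1
    rw [this]
    rfl
  obtain ⟨E, Γ, form, cousin, polar⟩ := P
  unfold AbelianCousinGroup.periodData
  congr 1

end PeriodData

instance : (inducedFunctor AbelianCousinGroup.periodData).EssSurj :=
  ⟨fun P => ⟨P.toCousin, ⟨eqToIso P.periodData_toCousin⟩⟩⟩

instance : (inducedFunctor AbelianCousinGroup.periodData).IsEquivalence where

end Cousin

end

theorem mainTheorem1 :
    Cousin.IsSemisimpleCategory Cousin.AbelianCousinGroup.UpToIsogeny :=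
  Cousin.PeriodData.isSemisimpleCategory_of_equivalence
    ((Localization.equivalenceFromModel Cousin.AbelianCousinGroup.toRational
      Cousin.AbelianCousinGroup.isogenies).trans
      (inducedFunctor Cousin.AbelianCousinGroup.periodData).asEquivalence)
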